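/- **Proposition (invariance of $J'\circ\pi$ on colored singular triangulations).** *Algebra.* Let $A$ be a finite dimensional Hopf algebra over a field $k$ with bijective antipode $\gamma$, $\bar\gamma=\gamma^{-1}$, with basis $(e_a)$ and dual basis $(e^a)$ of $A^*$. The Heisenberg double $H(A)$ is $A^*\otimes A$ with unit $1\otimes 1$ and product $(f\otimes a)(g\otimes b)=\sum f\,g(?a')\otimes a''b$. Put $\tilde e_a=\gamma(e_a)$, $\tilde e^a=\bar\gamma^*(e^a)$ and $S=\sum (1\otimes e_a)\otimes(e^a\otimes 1)\in H(A)\otimes H(A)$, $S'=\sum (1\otimes\tilde e_a)\otimes(e^a\otimes 1)\in H(A)^{op}\otimes H(A)$, $S''=\sum(1\otimes e_a)\otimes(\tilde e^a\otimes 1)\in H(A)\otimes H(A)^{op}$, $\tilde S=\sum(1\otimes\tilde e_a)\otimes(\tilde e^a\otimes 1)\in H(A)^{op}\otimes H(A)^{op}$. *Colored diagrams.* A colored diagram is a virtual tangle diagram with oriented strands and numbered components, each component thin or thick, presented as a vertical pasting of slices; each slice consists of vertical strands and exactly one crossing, symmetry (virtual crossing), local minimum or local maximum. A crossing is of positive kind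 if its under-strand joins top left and bottom right, and of negative kind if its over-strand does (whatever the orientations are). For $\mu,\nu\in\{\pm\}^n$ let $\mathcal{CD}(\mu;\nu)$ be the set of colored diagrams whose $i$-th component is thin iff $\mu_i=+$ and has non-empty boundary iff $\nu_i=+$. *The map $J'$.* Let $H_i=H(A)$ if $\mu_i=+$ and $H_i=H(A)^{op}$ if $\mu_i=-$; let $H_i^{\nu_i}=H_i$ if $\nu_i=+$, and let $H_i^{\nu_i}$ be the quotient of $H_i$ by the span of all commutators if $\nu_i=-$. A crossing of positive kind is labelled by $S,S',S'',\tilde S$ if (under, over) is (thin, thin), (thick, thin), (thin, thick), (thick, thick) respectively, and a crossing of negative kind by the inverse of that element; the first tensor factor belongs to the under-strand and the second one to the over-strand. Moreover $\mathrm{id}\otimes\gamma$ is applied to the first factor if the under-strand is directed upwards, and $\bar\gamma^*\otimes\mathrm{id}$ to the second one if the over-strand is directed upwards. Then $J'(Z)\in\bigotimes_i H_i^{\nu_i}$ is the element whose $i$-th factor is the product in $H_i$ of the labels on the $i$-th component, read against the orientation and written from left to right (for a closed component from an arbitrary base point). *Colored moves.* Let $\sigma_j$ and $v_j$ denote a crossing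 and a symmetry of the strands at positions $j,j+1$, words being read from top to bottom; all crossings $\sigma_j$ in one Pachner move are of the same kind, which is arbitrary, as are the orientations and colors of the strands unless something else is said. The colored moves are the following replacements inside a diagram, which preserve the numbering of the components. 1. Colored Pachner $(2,3)$ moves on three strands, where the second strand from the left at the top is called the middle strand: $\sigma_2\sigma_1\sigma_2\leftrightarrow\sigma_1v_2\sigma_1$ if the middle strand is thin and directed downwards or thick and directed upwards; $\sigma_1\sigma_2\sigma_1\leftrightarrow\sigma_2v_1\sigma_2$ if it is thick and directed downwards or thin and directed upwards. 2. Colored $(0,2)$ moves: two successive crossings of opposite kinds of the same two strands are cancelled. 3. Symmetry moves: $v_1v_1\leftrightarrow\mathrm{id}$, $v_1v_2v_1\leftrightarrow v_2v_1v_2$, $\sigma_1v_2v_1\leftrightarrow v_2v_1\sigma_2$ (both kinds), a strand passes virtually a local minimum or maximum, and removal of a virtual kink at a local minimum or maximum. 4. Planar isotopies: exchange of the heights of two neighbouring slices whose elementary diagrams are side by side, cancellation of a maximum and a minimum (both zigzags), sliding a strand over or under a local minimum or maximum (from a crossing with one leg to a crossing of the opposite kind with the other leg), and replacing a crossing by the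 crossing of the same kind turned by a half turn to either side by means of two maxima and two minima. The *excluded* moves are the Pachner moves whose middle strand is directed upwards, the slides over or under a minimum or maximum that is oriented from left to right, and the half turns of a crossing with one strand directed upwards and the other one downwards. *Colored cell complexes.* To every crossing (not symmetry) associate a tetrahedron with vertices $0,1,2,3$, face $i$ being opposite to vertex $i$. After the orientation of the thick strands has been reversed, the under-strand enters the tetrahedron through face 2 and leaves it through face 3 and the over-strand enters through face 0 and leaves through face 1 if the oriented crossing is positive, and the other way round (3 to 2, 1 to 0) if it is negative. $\mathcal C(Z)$ is obtained from these tetrahedra by gluing any two faces that are adjacent along $Z$ by the affine isomorphism preserving the order of the vertices. A colored singular triangulation of type $Z$ is a quotient $\psi:\mathcal C(Z)\to X$ by the identification of some pairs of edges (by affine isomorphisms) and some pairs of vertices, such that $X$ is a singular triangulation, i.e. the open faces of all tetrahedra are still embedded. Let $\pi(X)=Z$, and let $\mathcal{CT}(\mu;\nu)$ be the set of all colored singular triangulations of types $Z\in\mathcal{CD}(\mu;\nu)$. *Moves of triangulations.* $X$ and $X'$ of types $Z$ and $Z'$, with projections $\psi$ and $\psi'$, are related by a colored move if $Z$ and $Z'$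 are related by that move and $\psi=\psi'$ on the exteriors of $W$ and $W'$, where $W\subset\mathcal C(Z)$ and $W'\subset\mathcal C(Z')$ consist of the tetrahedra of the crossings involved in the move. This means: any two points of tetrahedra of crossings outside of the move, lying neither in $W$ nor in $W'$, are identified by $\psi$ if and only if the corresponding points are identified by $\psi'$. (In an exchange of heights no crossing is involved.) Let $\sim_{ct}$ be the equivalence relation on $\mathcal{CT}(\mu;\nu)$ generated by all colored moves, and $\sim'_{ct}$ the one generated by the colored moves that are not excluded. *Statement.* For all $n\ge 0$ and $\mu,\nu\in\{\pm\}^n$, the map $J'\circ\pi:\mathcal{CT}(\mu;\nu)\to\bigotimes_i H_i^{\nu_i}$ is invariant under $\sim'_{ct}$: if $X\sim'_{ct}X'$ then $J'(\pi(X))=J'(\pi(X'))$. If $\gamma^2=1$, then it is also invariant under $\sim_{ct}$. -/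

import Mathlib

open scoped TensorProduct

namespace ColTri

/-! ### The Heisenberg double -/

section Heisenberg

variable (k A : Type*) [Field k] [Ring A] [HopfAlgebra k A]

/-- The product of the dual algebra `A^*`, the transpose of the coproduct of `A`. -/
noncomputable def dmul : Module.Dual k A →ₗ[k] Module.Dual k A →ₗ[k] Module.Dual k A :=
  (TensorProduct.mk k _ _).compr₂
    ((Coalgebra.comul (R := k) (A := A)).dualMap ∘ₗ TensorProduct.dualDistrib k A A)

/-- `shift x g = g(? x)`. -/
noncomputable def shift : A →ₗ[k] Module.Dual k A →ₗ[k] Module.Dual k A :=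
  (LinearMap.llcomp k A A k).flip ∘ₗ (LinearMap.mul k A).flip

/-- The underlying space `A^* ⊗ A` of the Heisenberg double `H(A)`. -/
def Heis : Type _ := Module.Dual k A ⊗[k] A

noncomputable instance Heis.addCommGroup : AddCommGroup (Heis k A) :=
  inferInstanceAs (AddCommGroup (Module.Dual k A ⊗[k] A))

noncomputable instance : Module k (Heis k A) :=
  inferInstanceAs (Module k (Module.Dual k A ⊗[k] A))

/-- The element `f ⊗ a` of `H(A)`. -/
def Heis.mk (f : Module.Dual k A) (a : A) : Heis k A := (f ⊗ₜ[k] a : Module.Dual k A ⊗[k] A)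

/-- `act a (g ⊗ b) = ∑ g(? a') ⊗ a'' b`. -/
noncomputable def act : A →ₗ[k] Heis k A →ₗ[k] Heis k A :=
  TensorProduct.homTensorHomMap (RingHom.id k) (Module.Dual k A) A (Module.Dual k A) A ∘ₗ
    TensorProduct.map (shift k A) (LinearMap.mul k A) ∘ₗ Coalgebra.comul

/-- `dact f (g ⊗ b) = f g ⊗ b`. -/
noncomputable def dact : Module.Dual k A →ₗ[k] Heis k A →ₗ[k] Heis k A :=
  LinearMap.rTensorHom A ∘ₗ dmul k A

/-- The product of `H(A)`: `(f ⊗ a) (g ⊗ b) = ∑ f g(? a') ⊗ a'' b`. -/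
noncomputable def hmul : Heis k A →ₗ[k] Heis k A →ₗ[k] Heis k A :=
  TensorProduct.lift
    ((LinearMap.mul k (Module.End k (Heis k A))).compl₁₂ (dact k A) (act k A))

variable {k A}

lemma shift_apply (x : A) (g : Module.Dual k A) (y : A) : shift k A x g y = g (y * x) := rfl

lemma dmul_eq {κ : Type*} (f g : Module.Dual k A) (x : A) (r : Coalgebra.Repr k x κ) :
    dmul k A f g x = ∑ i ∈ r.index, f (r.left i) * g (r.right i) := by
  change TensorProduct.dualDistrib k A A (f ⊗ₜ g) (Coalgebra.comul x) = _
  rw [← r.eq]; simp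

lemma dmul_conv (f g : Module.Dual k A) :
    dmul k A f g = (WithConv.toConv f * WithConv.toConv g).ofConv := by
  ext x
  rw [dmul_eq f g x (Coalgebra.Repr.arbitrary k x)]
  exact ((Coalgebra.Repr.arbitrary k x).convMul_apply _ _).symm

lemma counit_conv : (Coalgebra.counit : Module.Dual k A) = (1 : WithConv (A →ₗ[k] k)).ofConv := by
  ext x; simp

lemma dmul_assoc (f g h : Module.Dual k A) :
    dmul k A (dmul k A f g) h = dmul k A f (dmul k A g h) := by
  simp only [dmul_conv, WithConv.toConv_ofConv, mul_assoc]

lemma dmul_one (f : Module.Dual k A) : dmul k A f Coalgebra.counit = f := by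
  simp only [dmul_conv, counit_conv, WithConv.toConv_ofConv, mul_one, WithConv.ofConv_toConv]

lemma one_dmul (f : Module.Dual k A) : dmul k A Coalgebra.counit f = f := by
  simp only [dmul_conv, counit_conv, WithConv.toConv_ofConv, one_mul, WithConv.ofConv_toConv]

/-- Induction on the tensors in `H(A)`. -/
lemma Heis.ind {P : Heis k A → Prop} (h0 : P 0) (hm : ∀ f a, P (Heis.mk k A f a))
    (ha : ∀ x y, P x → P y → P (x + y)) (x : Heis k A) : P x :=
  TensorProduct.induction_on (motive := P) x h0 hm ha

lemma hmul_mk (f : Module.Dual k A) (a : A) (x : Heis k A) :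
    hmul k A (Heis.mk k A f a) x = dact k A f (act k A a x) := rfl

lemma dact_mk (f g : Module.Dual k A) (b : A) :
    dact k A f (Heis.mk k A g b) = Heis.mk k A (dmul k A f g) b := rfl

lemma act_mk {κ : Type*} (a : A) (r : Coalgebra.Repr k a κ) (g : Module.Dual k A) (b : A) :
    act k A a (Heis.mk k A g b) =
      ∑ i ∈ r.index, Heis.mk k A (shift k A (r.left i) g) (r.right i * b) := by
  change TensorProduct.homTensorHomMap (RingHom.id k) (Module.Dual k A) A (Module.Dual k A) A
    (TensorProduct.map (shift k A) (LinearMap.mul k A) (Coalgebra.comul a)) (g ⊗ₜ b) = _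
  rw [← r.eq]
  simp only [map_sum, LinearMap.sum_apply, TensorProduct.map_tmul,
    TensorProduct.homTensorHomMap_apply]
  rfl

lemma dact_dact (f g : Module.Dual k A) (x : Heis k A) :
    dact k A f (dact k A g x) = dact k A (dmul k A f g) x := by
  induction x using Heis.ind with
  | h0 => simp
  | hm h b => simp only [dact_mk, dmul_assoc]
  | ha x y hx hy => simp only [map_add, hx, hy]

lemma shift_shift (x y : A) (g : Module.Dual k A) :
    shift k A x (shift k A y g) = shift k A (x * y) g := by
  ext z; simp [shift_apply, mul_assoc]

lemma act_act (a b : A) (x : Heis k A) : act k A a (act k A b x) = act k A (a * b) x := by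
  induction x using Heis.ind with
  | h0 => simp
  | hm g c =>
    let ra := Coalgebra.Repr.arbitrary k a
    let rb := Coalgebra.Repr.arbitrary k b
    let rab : Coalgebra.Repr k (a * b) ((A × A) × (A × A)) :=
      { index := ra.index ×ˢ rb.index
        left := fun i => ra.left i.1 * rb.left i.2
        right := fun i => ra.right i.1 * rb.right i.2
        eq := by
          rw [Bialgebra.comul_mul, ← ra.eq, ← rb.eq, Finset.sum_product, Finset.sum_mul_sum]
          simp }
    rw [act_mk _ rab, act_mk _ rb, map_sum, Finset.sum_product, Finset.sum_comm]
    refine Finset.sum_congr rfl fun j _ => ?_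
    rw [act_mk _ ra]
    refine Finset.sum_congr rfl fun i _ => ?_
    simp only [shift_shift, mul_assoc, rab]
  | ha x y hx hy => simp only [map_add, hx, hy]

lemma shift_dmul {κ : Type*} (y : A) (r : Coalgebra.Repr k y κ) (f g : Module.Dual k A) :
    shift k A y (dmul k A f g) =
      ∑ j ∈ r.index, dmul k A (shift k A (r.left j) f) (shift k A (r.right j) g) := by
  ext x
  let rx := Coalgebra.Repr.arbitrary k x
  let rxy : Coalgebra.Repr k (x * y) ((A × A) × κ) :=
    { index := rx.index ×ˢ r.index
      left := fun i => rx.left i.1 * r.left i.2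
      right := fun i => rx.right i.1 * r.right i.2
      eq := by
        rw [Bialgebra.comul_mul, ← rx.eq, ← r.eq, Finset.sum_product, Finset.sum_mul_sum]
        simp }
  rw [shift_apply, dmul_eq _ _ _ rxy, LinearMap.sum_apply, Finset.sum_product, Finset.sum_comm]
  refine Finset.sum_congr rfl fun j _ => ?_
  rw [dmul_eq _ _ _ rx]
  rfl

lemma act_dact {κ : Type*} (a : A) (r : Coalgebra.Repr k a κ) (f : Module.Dual k A)
    (x : Heis k A) :
    act k A a (dact k A f x) =
      ∑ i ∈ r.index, dact k A (shift k A (r.left i) f) (act k A (r.right i) x) := by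
  induction x using Heis.ind with
  | h0 => simp
  | hm g b =>
    have key := Coalgebra.sum_tmul_tmul_eq r (fun i => Coalgebra.Repr.arbitrary k (r.left i))
      (fun i => Coalgebra.Repr.arbitrary k (r.right i))
    apply_fun (TensorProduct.map (TensorProduct.lift (dmul k A)) (LinearMap.id) ∘ₗ
      (TensorProduct.assoc k _ _ _).symm.toLinearMap ∘ₗ
      TensorProduct.map ((shift k A).flip f) (TensorProduct.map ((shift k A).flip g)
        ((LinearMap.mul k A).flip b))) at key
    simp only [map_sum, LinearMap.comp_apply, TensorProduct.map_tmul, LinearEquiv.coe_coe,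
      TensorProduct.assoc_symm_tmul, TensorProduct.lift.tmul, LinearMap.flip_apply,
      LinearMap.id_apply, LinearMap.mul_apply'] at key
    rw [dact_mk, act_mk _ r]
    have h1 : ∀ i, Heis.mk k A (shift k A (r.left i) (dmul k A f g)) (r.right i * b) =
        ∑ j ∈ (Coalgebra.Repr.arbitrary k (r.left i)).index,
          (dmul k A (shift k A ((Coalgebra.Repr.arbitrary k (r.left i)).left j) f)
            (shift k A ((Coalgebra.Repr.arbitrary k (r.left i)).right j) g)) ⊗ₜ[k]
              (r.right i * b) := fun i => by
      rw [shift_dmul _ (Coalgebra.Repr.arbitrary k (r.left i)), Heis.mk, TensorProduct.sum_tmul]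
    have h2 : ∀ i, dact k A (shift k A (r.left i) f) (act k A (r.right i) (Heis.mk k A g b)) =
        ∑ j ∈ (Coalgebra.Repr.arbitrary k (r.right i)).index,
          (dmul k A (shift k A (r.left i) f)
            (shift k A ((Coalgebra.Repr.arbitrary k (r.right i)).left j) g)) ⊗ₜ[k]
              ((Coalgebra.Repr.arbitrary k (r.right i)).right j * b) := fun i => by
      rw [act_mk _ (Coalgebra.Repr.arbitrary k (r.right i)), map_sum]
      rfl
    rw [Finset.sum_congr rfl fun i _ => h1 i, Finset.sum_congr rfl fun i _ => h2 i]
    exact key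
  | ha x y hx hy => simp only [map_add, hx, hy, Finset.sum_add_distrib]

lemma hmul_assoc (x y z : Heis k A) :
    hmul k A (hmul k A x y) z = hmul k A x (hmul k A y z) := by
  induction x using Heis.ind with
  | h0 => simp
  | ha x x' hx hy => simp only [map_add, LinearMap.add_apply, hx, hy]
  | hm f a =>
    induction y using Heis.ind with
    | h0 => simp
    | ha y y' hx hy => simp only [map_add, LinearMap.add_apply, hx, hy]
    | hm g b =>
      let ra := Coalgebra.Repr.arbitrary k a
      rw [hmul_mk, hmul_mk, hmul_mk, act_dact _ ra, act_mk _ ra]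
      simp only [map_sum, LinearMap.sum_apply, dact_mk, hmul_mk, dact_dact, act_act]

noncomputable instance : One (Heis k A) := ⟨Heis.mk k A Coalgebra.counit 1⟩
noncomputable instance : Mul (Heis k A) := ⟨fun x y => hmul k A x y⟩

lemma Heis.one_def : (1 : Heis k A) = Heis.mk k A Coalgebra.counit 1 := rfl
lemma Heis.mul_def (x y : Heis k A) : x * y = hmul k A x y := rfl

lemma dact_one (x : Heis k A) : dact k A Coalgebra.counit x = x := by
  induction x using Heis.ind with
  | h0 => simp
  | ha x y hx hy => simp only [map_add, hx, hy]
  | hm f a => rw [dact_mk, one_dmul]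

/-- `Δ(1) = 1 ⊗ 1`. -/
def reprOne : Coalgebra.Repr k (1 : A) Unit where
  index := {()}
  left _ := 1
  right _ := 1
  eq := by rw [Bialgebra.comul_one]; simp [Algebra.TensorProduct.one_def]

lemma shift_one (f : Module.Dual k A) : shift k A 1 f = f := by
  ext z; simp [shift_apply]

lemma act_one (x : Heis k A) : act k A 1 x = x := by
  induction x using Heis.ind with
  | h0 => simp
  | ha x y hx hy => simp only [map_add, hx, hy]
  | hm f a => rw [act_mk _ reprOne]; simp [reprOne, shift_one]

lemma shift_counit (x : A) :
    shift k A x Coalgebra.counit = Coalgebra.counit (R := k) x • Coalgebra.counit := by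
  ext z; simp [shift_apply, mul_comm]

noncomputable instance : Ring (Heis k A) where
  __ := Heis.addCommGroup k A
  left_distrib x y z := by simp only [Heis.mul_def, map_add]
  right_distrib x y z := by simp only [Heis.mul_def, map_add, LinearMap.add_apply]
  zero_mul x := by simp only [Heis.mul_def, map_zero, LinearMap.zero_apply]
  mul_zero x := by simp only [Heis.mul_def, map_zero]
  mul_assoc := hmul_assoc
  one_mul x := by rw [Heis.mul_def, Heis.one_def, hmul_mk, dact_one, act_one]
  mul_one x := by
    rw [Heis.mul_def, Heis.one_def]
    induction x using Heis.ind with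
    | h0 => simp
    | ha x y hx hy => simp only [map_add, LinearMap.add_apply, hx, hy]
    | hm f a =>
      let ra := Coalgebra.Repr.arbitrary k a
      rw [hmul_mk, act_mk _ ra]
      simp only [map_sum, dact_mk, shift_counit, map_smul, dmul_one, mul_one]
      have : ∑ i ∈ ra.index, Heis.mk k A (Coalgebra.counit (R := k) (ra.left i) • f) (ra.right i)
          = Heis.mk k A f (∑ i ∈ ra.index, Coalgebra.counit (R := k) (ra.left i) • ra.right i) := by
        simp only [Heis.mk, TensorProduct.tmul_sum, TensorProduct.smul_tmul]
        rfl
      rw [this, Coalgebra.sum_counit_smul]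

noncomputable instance : Algebra k (Heis k A) :=
  Algebra.ofModule
    (fun r x y => by simp only [Heis.mul_def, map_smul, LinearMap.smul_apply])
    (fun r x y => by simp only [Heis.mul_def, map_smul])

end Heisenberg

/-! ### The two kinds of tensor factors and the S-tensors

A colour is a Boolean: `false` is thin, `true` is thick. -/

section Colours

variable (k A : Type*) [Field k] [Ring A] [HopfAlgebra k A]

/-- `H(A)` for a thin strand, `H(A)^op` for a thick strand. -/
def HC : Bool → Type _
  | false => Heis k A
  | true => (Heis k A)ᵐᵒᵖ

noncomputable instance (c : Bool) : Ring (HC k A c) :=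
  match c with
  | false => inferInstanceAs (Ring (Heis k A))
  | true => inferInstanceAs (Ring (Heis k A)ᵐᵒᵖ)

noncomputable instance (c : Bool) : Algebra k (HC k A c) :=
  match c with
  | false => inferInstanceAs (Algebra k (Heis k A))
  | true => inferInstanceAs (Algebra k (Heis k A)ᵐᵒᵖ)

/-- The identity map of the underlying vector spaces. -/
noncomputable def HC.of (c : Bool) : Heis k A ≃ₗ[k] HC k A c :=
  match c with
  | false => LinearEquiv.refl k (Heis k A)
  | true => MulOpposite.opLinearEquiv k

/-- The span of the commutators `xy - yx`. -/
noncomputable def commutators (c : Bool) : Submodule k (HC k A c) :=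
  Submodule.span k {z | ∃ x y : HC k A c, z = x * y - y * x}

/-- The tensor factor of a component of the given colour: the algebra itself if the component has
boundary (`closed = false`), and its quotient by the commutators if it is closed. -/
def Factor (c closed : Bool) : Type _ :=
  match closed with
  | false => HC k A c
  | true => HC k A c ⧸ commutators k A c

noncomputable instance (c closed : Bool) : AddCommGroup (Factor k A c closed) :=
  match closed with
  | false => inferInstanceAs (AddCommGroup (HC k A c))
  | true => inferInstanceAs (AddCommGroup (HC k A c ⧸ commutators k A c))

noncomputable instance (c closed : Bool) : Module k (Factor k A c closed) :=
  match closed with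
  | false => inferInstanceAs (Module k (HC k A c))
  | true => inferInstanceAs (Module k (HC k A c ⧸ commutators k A c))

/-- The projection to the tensor factor. -/
noncomputable def Factor.proj (c closed : Bool) : HC k A c →ₗ[k] Factor k A c closed :=
  match closed with
  | false => LinearMap.id
  | true => (commutators k A c).mkQ

/-- The antipode `γ` of `A`. -/
noncomputable def gam : A →ₗ[k] A := HopfAlgebra.antipode k

/-- The inverse of the antipode, in the ring of linear endomorphisms of `A`. -/
noncomputable def gamBar : A →ₗ[k] A :=
  Ring.inverse (HopfAlgebra.antipode k : Module.End k A)

/-- The map `id ⊗ γ` of `A^* ⊗ A`; it extends `1 ⊗ x ↦ 1 ⊗ γ(x)`. -/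
noncomputable def gamH (c : Bool) : HC k A c →ₗ[k] HC k A c :=
  (HC.of k A c).toLinearMap ∘ₗ (LinearMap.lTensor (Module.Dual k A) (gam k A) :
    Heis k A →ₗ[k] Heis k A) ∘ₗ (HC.of k A c).symm.toLinearMap

/-- The map `(γ⁻¹)^* ⊗ id` of `A^* ⊗ A`; it extends `f ⊗ 1 ↦ (γ⁻¹)^*(f) ⊗ 1`. -/
noncomputable def gamBarH (c : Bool) : HC k A c →ₗ[k] HC k A c :=
  (HC.of k A c).toLinearMap ∘ₗ (LinearMap.rTensor A (gamBar k A).dualMap :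
    Heis k A →ₗ[k] Heis k A) ∘ₗ (HC.of k A c).symm.toLinearMap

variable {k A} {ι : Type*} [Fintype ι] (b : Module.Basis ι k A)

/-- `1 ⊗ e_a` for a thin strand and `1 ⊗ γ(e_a)` for a thick strand. -/
noncomputable def lowerE (c : Bool) (a : ι) : HC k A c :=
  HC.of k A c (Heis.mk k A Coalgebra.counit (if c then gam k A (b a) else b a))

/-- `e^a ⊗ 1` for a thin strand and `(γ⁻¹)^*(e^a) ⊗ 1` for a thick strand. -/
noncomputable def upperE (c : Bool) (a : ι) : HC k A c :=
  HC.of k A c (Heis.mk k A (if c then (gamBar k A).dualMap (b.coord a) else b.coord a) 1)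

/-- The four tensors `S`, `S'`, `S''`, `S̃`, for `(c, c') = (thin, thin)`, `(thick, thin)`,
`(thin, thick)`, `(thick, thick)`. -/
noncomputable def STensor (c c' : Bool) : HC k A c ⊗[k] HC k A c' :=
  ∑ a, lowerE b c a ⊗ₜ[k] upperE b c' a

/-- The label of a crossing: `positive` tells which of the two kinds of crossings it is, `c` and
`up` are the colour and the direction of the under-strand, `c'` and `up'` those of the
over-strand. -/
noncomputable def crossLabel (positive c up c' up' : Bool) : HC k A c ⊗[k] HC k A c' :=
  TensorProduct.map (if up then gamH k A c else LinearMap.id)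
    (if up' then gamBarH k A c' else LinearMap.id)
    (if positive then STensor b c c' else Ring.inverse (STensor b c c'))

open Classical in
/-- The basis `e^i ⊗ e_j` of `A^* ⊗ A`, as a basis of `H(A)` or `H(A)^op`. -/
noncomputable def HC.basis (c : Bool) : Module.Basis (ι × ι) k (HC k A c) :=
  (b.dualBasis.tensorProduct b : Module.Basis (ι × ι) k (Heis k A)).map (HC.of k A c)

/-- The coefficients of the label of a crossing. -/
noncomputable def crossCoeff (positive c up c' up' : Bool) (p q : ι × ι) : k :=
  ((HC.basis b c).tensorProduct (HC.basis b c')).repr (crossLabel b positive c up c' up') (p, q)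

end Colours

/-! ### Colored diagrams

A diagram is read from top to bottom as a sequence of slices, each of which is a juxtaposition of
vertical strands and of exactly one of the following: a crossing, a symmetry (virtual crossing), a
local minimum, a local maximum. -/

section Diagrams

/-- A strand cut by a horizontal line: thick or thin, oriented upwards or downwards. -/
structure Pt where
  thick : Bool
  up : Bool

/-- The same colour with the opposite orientation. -/
def Pt.flip (a : Pt) : Pt := ⟨a.thick, !a.up⟩

/-- The elementary diagrams, with the data of their strands.
* `cross positive a b`: a crossing; `a` and `b` describe the strands at the top left and at the top
  right. If `positive`, the strand between top left and bottom right is the under-strand, else it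
  is the over-strand. (For two strands directed downwards, this is a positive, respectively
  negative, crossing.)
* `virt a b`: a symmetry, with the same convention for `a` and `b`.
* `mini a`: a local minimum whose left leg is `a`.
* `maxi a`: a local maximum whose left leg is `a`. -/
inductive Gen where
  | cross (positive : Bool) (a b : Pt)
  | virt (a b : Pt)
  | mini (a : Pt)
  | maxi (a : Pt)

/-- The strands at the top. -/
def Gen.src : Gen → List Pt
  | cross _ a b => [a, b]
  | virt a b => [a, b]
  | mini a => [a, a.flip]
  | maxi _ => []

/-- The strands at the bottom. -/
def Gen.tgt : Gen → List Pt
  | cross _ a b => [b, a]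
  | virt a b => [b, a]
  | mini _ => []
  | maxi a => [a, a.flip]

def Gen.isCross : Gen → Bool
  | cross _ _ _ => true
  | _ => false

/-- The kind of a crossing (irrelevant for the other elementary diagrams). -/
def Gen.positive : Gen → Bool
  | cross s _ _ => s
  | _ => true

/-- The under-strand of a crossing (irrelevant for the other elementary diagrams). -/
def Gen.under : Gen → Pt
  | cross s a b => if s then a else b
  | virt a _ | mini a | maxi a => a

/-- The over-strand of a crossing (irrelevant for the other elementary diagrams). -/
def Gen.over : Gen → Pt
  | cross s a b => if s then b else a
  | virt a _ | mini a | maxi a => a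

/-- A slice: an elementary diagram between vertical strands. -/
structure Slice where
  left : List Pt
  gen : Gen
  right : List Pt

def Slice.src (L : Slice) : List Pt := L.left ++ L.gen.src ++ L.right

def Slice.tgt (L : Slice) : List Pt := L.left ++ L.gen.tgt ++ L.right

/-- Horizontal pasting with vertical strands. -/
def Slice.whisker (l r : List Pt) (L : Slice) : Slice := ⟨l ++ L.left, L.gen, L.right ++ r⟩

/-- A list of slices can be pasted vertically below the strands `w`. -/
def Composable : List Pt → List Slice → Prop
  | _, [] => True
  | w, L :: Ls => w = L.src ∧ Composable L.tgt Ls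

/-- A colored diagram (without a numbering of its components). -/
structure Diagram where
  top : List Pt
  slices : List Slice
  composable : Composable top slices

namespace Diagram

/-- The strands at the `h`-th level; level `0` is the top, slice `h` lies between the levels `h` and
`h + 1`. -/
def word (D : Diagram) : ℕ → List Pt
  | 0 => D.top
  | h + 1 => ((D.slices[h]?).map Slice.tgt).getD []

/-- The points `(h, i)` where the diagram meets the levels; `i` is the position from the left. -/
def Node (D : Diagram) : Type := {x : ℕ × ℕ // x.2 < (D.word x.1).length}

/-- The strand through a node. -/
def pt (D : Diagram) (x : D.Node) : Pt := (D.word x.1.1)[x.1.2]'x.2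

end Diagram

/-- Following a strand downwards into a slice at position `i`, one leaves the slice at the bottom
(`Sum.inl`) or, in the case of a local minimum, at the top (`Sum.inr`). -/
def Slice.down (L : Slice) (i : ℕ) : ℕ ⊕ ℕ :=
  let a := L.left.length
  match L.gen with
  | .cross _ _ _ | .virt _ _ => .inl (if i = a then a + 1 else if i = a + 1 then a else i)
  | .mini _ =>
    if i = a then .inr (a + 1) else if i = a + 1 then .inr a
    else .inl (if i < a then i else i - 2)
  | .maxi _ => .inl (if i < a then i else i + 2)

/-- Following a strand upwards into a slice at position `i`, one leaves the slice at the top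
(`Sum.inl`) or, in the case of a local maximum, at the bottom (`Sum.inr`). -/
def Slice.up (L : Slice) (i : ℕ) : ℕ ⊕ ℕ :=
  let a := L.left.length
  match L.gen with
  | .cross _ _ _ | .virt _ _ => .inl (if i = a then a + 1 else if i = a + 1 then a else i)
  | .maxi _ =>
    if i = a then .inr (a + 1) else if i = a + 1 then .inr a
    else .inl (if i < a then i else i - 2)
  | .mini _ => .inl (if i < a then i else i + 2)

namespace Diagram

/-- The next node along the orientation, if the strand does not end. -/
def next (D : Diagram) (x : ℕ × ℕ) : Option (ℕ × ℕ) :=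
  match (D.word x.1)[x.2]?, x with
  | none, _ => none
  | some ⟨_, true⟩, (0, _) => none
  | some ⟨_, true⟩, (h + 1, i) =>
    (D.slices[h]?).map fun L => match L.up i with
      | .inl j => (h, j)
      | .inr j => (h + 1, j)
  | some ⟨_, false⟩, (h, i) =>
    (D.slices[h]?).map fun L => match L.down i with
      | .inl j => (h + 1, j)
      | .inr j => (h, j)

/-- Two nodes are on the same component. -/
def Connected (D : Diagram) : D.Node → D.Node → Prop :=
  Relation.EqvGen fun x y => D.next x.1 = some y.1

/-- The crossings (the symmetries are not counted), as indices of slices. -/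
def Crossing (D : Diagram) : Type := {h : Fin D.slices.length // D.slices[h].gen.isCross = true}

instance (D : Diagram) : Fintype D.Crossing :=
  inferInstanceAs (Fintype {h : Fin D.slices.length // D.slices[h].gen.isCross = true})

instance (D : Diagram) : DecidableEq D.Crossing :=
  inferInstanceAs (DecidableEq {h : Fin D.slices.length // D.slices[h].gen.isCross = true})

/-- The elementary diagram at a crossing. -/
def Crossing.gen {D : Diagram} (c : D.Crossing) : Gen := D.slices[c.1].gen

/-- The position of the upper left end of a crossing in its level. -/
def Crossing.pos {D : Diagram} (c : D.Crossing) : ℕ := D.slices[c.1].left.length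

/-- The four ends of a crossing: `under` selects the under- or over-strand, `bot` the lower or upper
end of it. -/
def Crossing.leg {D : Diagram} (c : D.Crossing) (under bot : Bool) : ℕ × ℕ :=
  if (under == c.gen.positive) = bot then (c.1 + bot.toNat, c.pos + 1)
  else (c.1 + bot.toNat, c.pos)

/-- The strand of a crossing, `true` for under and `false` for over. -/
def Crossing.strand {D : Diagram} (c : D.Crossing) (under : Bool) : Pt :=
  if under then c.gen.under else c.gen.over

open Classical in
/-- The strand of a crossing which is traversed between the node `x` and the next node, if any. -/
noncomputable def visit (D : Diagram) (x : ℕ × ℕ) : Option (D.Crossing × Bool) :=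
  if h : ∃ v : D.Crossing × Bool, x = v.1.leg v.2 (v.1.strand v.2).up then some h.choose else none

/-- The list of the nodes from `x` along the orientation, up to the end of the strand or to the
return to `x₀`; the number `n` bounds its length. -/
def trace (D : Diagram) (x₀ : ℕ × ℕ) : ℕ → ℕ × ℕ → List (ℕ × ℕ)
  | 0, _ => []
  | n + 1, x => x :: match D.next x with
    | none => []
    | some y => if y = x₀ then [] else trace D x₀ n y

/-- The number of nodes. -/
def size (D : Diagram) : ℕ :=
  ((List.range (D.slices.length + 1)).map fun h => (D.word h).length).sum

end Diagram

end Diagrams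

/-- Colored diagrams with `n` numbered components: component `i` is thick iff `μ i = true` and
closed iff `ν i = true`. -/
structure CD {n : ℕ} (μ ν : Fin n → Bool) extends Diagram where
  /-- The number of the component through a node. -/
  comp : toDiagram.Node → Fin n
  comp_surjective : Function.Surjective comp
  comp_eq_iff : ∀ x y, comp x = comp y ↔ toDiagram.Connected x y
  thick_eq : ∀ x, (toDiagram.pt x).thick = μ (comp x)
  closed_iff : ∀ i, ν i = true ↔
    ∀ x : toDiagram.Node, comp x = i → x.1.1 ≠ 0 ∧ x.1.1 ≠ toDiagram.slices.length

namespace CD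

variable {n : ℕ} {μ ν : Fin n → Bool}

open Classical in
/-- A starting point for reading the `i`-th component: its starting point if it has boundary, and
an arbitrary base point if it is closed. -/
noncomputable def base (Z : CD μ ν) (i : Fin n) : ℕ × ℕ :=
  if h : ∃ x : Z.Node, Z.comp x = i ∧ ∀ y : Z.Node, Z.next y.1 ≠ some x.1 then h.choose.1
  else (Z.comp_surjective i).choose.1

/-- The crossings met along the `i`-th component, in the order of its orientation; `true` means
that it is the under-strand. -/
noncomputable def visits (Z : CD μ ν) (i : Fin n) : List (Z.Crossing × Bool) :=
  (Z.trace (Z.base i) Z.size (Z.base i)).filterMap Z.visit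

variable {k A : Type*} [Field k] [Ring A] [HopfAlgebra k A] {ι : Type*} [Fintype ι]
  (b : Module.Basis ι k A)

/-- The universal quantum invariant `J'`: every crossing carries its label, and the tensor factor of
a component is the product of the labels on it, read against the orientation and written from left
to right. The labels are expanded in the basis of `A^* ⊗ A`; a state `p` selects a basis element for
the two strands of each crossing. -/
noncomputable def J (Z : CD μ ν) : ⨂[k] i, Factor k A (μ i) (ν i) :=
  ∑ p : Z.Crossing × Bool → ι × ι,
    (∏ c : Z.Crossing, crossCoeff b c.gen.positive c.gen.under.thick c.gen.under.up
      c.gen.over.thick c.gen.over.up (p (c, true)) (p (c, false))) •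
    PiTensorProduct.tprod k fun i =>
      Factor.proj k A (μ i) (ν i)
        (((Z.visits i).reverse.map fun v => HC.basis b (μ i) (p v)).prod)

end CD

/-! ### Colored moves -/

/-- The colored moves, as replacements of a pasting of slices by another one. The Boolean `e` tells
whether the move is one of those which are excluded from the smaller equivalence relation. -/
inductive Move : (e : Bool) → List Slice → List Slice → Prop where
  /-- Colored Pachner (2,3) moves; in height, `b` is the middle strand. -/
  | pachner₁ (s : Bool) (a b c : Pt) (h : b.thick = b.up) : Move b.up
      [⟨[a], .cross s b c, []⟩, ⟨[], .cross s a c, [b]⟩, ⟨[c], .cross s a b, []⟩]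
      [⟨[], .cross s a b, [c]⟩, ⟨[b], .virt a c, []⟩, ⟨[], .cross s b c, [a]⟩]
  | pachner₂ (s : Bool) (a b c : Pt) (h : b.thick ≠ b.up) : Move b.up
      [⟨[], .cross s a b, [c]⟩, ⟨[b], .cross s a c, []⟩, ⟨[], .cross s b c, [a]⟩]
      [⟨[a], .cross s b c, []⟩, ⟨[], .virt a c, [b]⟩, ⟨[c], .cross s a b, []⟩]
  /-- Colored (0,2) moves. -/
  | zeroTwo (s : Bool) (a b : Pt) : Move false
      [⟨[], .cross s a b, []⟩, ⟨[], .cross (!s) b a, []⟩] []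
  /-- Symmetry moves: two symmetries cancel. -/
  | virtCancel (a b : Pt) : Move false
      [⟨[], .virt a b, []⟩, ⟨[], .virt b a, []⟩] []
  /-- Symmetry moves: three symmetries. -/
  | virtBraid (a b c : Pt) : Move false
      [⟨[], .virt a b, [c]⟩, ⟨[b], .virt a c, []⟩, ⟨[], .virt b c, [a]⟩]
      [⟨[a], .virt b c, []⟩, ⟨[], .virt a c, [b]⟩, ⟨[c], .virt a b, []⟩]
  /-- Symmetry moves: a strand passes virtually a crossing. -/
  | virtCross (s : Bool) (a b c : Pt) : Move false
      [⟨[], .cross s a b, [c]⟩, ⟨[b], .virt a c, []⟩, ⟨[], .virt b c, [a]⟩]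
      [⟨[a], .virt b c, []⟩, ⟨[], .virt a c, [b]⟩, ⟨[c], .cross s a b, []⟩]
  /-- Symmetry moves: a strand `t` passes virtually a local minimum. -/
  | virtMini (u t : Pt) : Move false
      [⟨[], .virt u t, [u.flip]⟩, ⟨[t], .mini u, []⟩]
      [⟨[u], .virt t u.flip, []⟩, ⟨[], .mini u, [t]⟩]
  /-- Symmetry moves: a strand `t` passes virtually a local maximum. -/
  | virtMaxi (u t : Pt) : Move false
      [⟨[t], .maxi u, []⟩, ⟨[], .virt t u, [u.flip]⟩]
      [⟨[], .maxi u, [t]⟩, ⟨[u], .virt u.flip t, []⟩]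
  /-- Symmetry moves: a virtual kink at a local minimum. -/
  | virtKinkMini (u : Pt) : Move false
      [⟨[], .virt u u.flip, []⟩, ⟨[], .mini u.flip, []⟩] [⟨[], .mini u, []⟩]
  /-- Symmetry moves: a virtual kink at a local maximum. -/
  | virtKinkMaxi (u : Pt) : Move false
      [⟨[], .maxi u, []⟩, ⟨[], .virt u u.flip, []⟩] [⟨[], .maxi u.flip, []⟩]
  /-- Planar isotopies: cancellation of a local maximum and a local minimum. -/
  | zigzagRight (a : Pt) : Move false
      [⟨[a], .maxi a.flip, []⟩, ⟨[], .mini a, [a]⟩] []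
  | zigzagLeft (a : Pt) : Move false
      [⟨[], .maxi a, [a]⟩, ⟨[a], .mini a.flip, []⟩] []
  /-- Planar isotopies: a strand `t` slides under or over a local minimum, which is excluded if the
  minimum is oriented from left to right. -/
  | slideMini (s : Bool) (u t : Pt) : Move (!u.up)
      [⟨[], .cross s u t, [u.flip]⟩, ⟨[t], .mini u, []⟩]
      [⟨[u], .cross (!s) t u.flip, []⟩, ⟨[], .mini u, [t]⟩]
  /-- Planar isotopies: a strand `t` slides under or over a local maximum, which is excluded if the
  maximum is oriented from left to right. -/
  | slideMaxi (s : Bool) (u t : Pt) : Move u.up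
      [⟨[t], .maxi u, []⟩, ⟨[], .cross s t u, [u.flip]⟩]
      [⟨[], .maxi u, [t]⟩, ⟨[u], .cross (!s) u.flip t, []⟩]
  /-- Planar isotopies: half turns of a crossing, excluded if one strand is directed upwards and the
  other one downwards. -/
  | halfTurnRight (s : Bool) (a b : Pt) : Move (a.up != b.up)
      [⟨[a, b], .maxi a.flip, []⟩, ⟨[a, b, a.flip], .maxi b.flip, [a]⟩,
        ⟨[a, b], .cross s a.flip b.flip, [b, a]⟩, ⟨[a], .mini b, [a.flip, b, a]⟩,
        ⟨[], .mini a, [b, a]⟩]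
      [⟨[], .cross s a b, []⟩]
  | halfTurnLeft (s : Bool) (a b : Pt) : Move (a.up != b.up)
      [⟨[], .maxi b, [a, b]⟩, ⟨[b], .maxi a, [b.flip, a, b]⟩,
        ⟨[b, a], .cross s a.flip b.flip, [a, b]⟩, ⟨[b, a, b.flip], .mini a.flip, [b]⟩,
        ⟨[b, a], .mini b.flip, []⟩]
      [⟨[], .cross s a b, []⟩]

/-- Two diagrams are related by a move, in which the slices `p, …, p + q - 1` of the first diagram
are replaced by the slices `p, …, p + q' - 1` of the second one. Besides the moves above there is
the planar isotopy `exchange` of the heights of two elementary diagrams, for which `keep = true`. -/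
inductive DiagramStep : (e keep : Bool) → (D D' : Diagram) → (p q q' : ℕ) → Prop where
  | move {e : Bool} {M M' : List Slice} (hM : Move e M M') (l r : List Pt)
      (pre post : List Slice) (D D' : Diagram) (htop : D.top = D'.top)
      (h : D.slices = pre ++ M.map (Slice.whisker l r) ++ post)
      (h' : D'.slices = pre ++ M'.map (Slice.whisker l r) ++ post) :
      DiagramStep e false D D' pre.length M.length M'.length
  | exchange (l m r : List Pt) (g g' : Gen) (pre post : List Slice) (D D' : Diagram)
      (htop : D.top = D'.top)
      (h : D.slices = pre ++ [⟨l, g, m ++ g'.src ++ r⟩, ⟨l ++ g.tgt ++ m, g', r⟩] ++ post)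
      (h' : D'.slices = pre ++ [⟨l ++ g.src ++ m, g', r⟩, ⟨l, g, m ++ g'.tgt ++ r⟩] ++ post) :
      DiagramStep false true D D' pre.length 2 2

/-- Corresponding levels outside of a move. -/
def SameLevel (p q q' : ℕ) (i j : ℕ) : Prop :=
  (i ≤ p ∧ j = i) ∨ ∃ m, i = p + q + m ∧ j = p + q' + m

/-- Corresponding slices which are not involved in a move. -/
def SameSlice (keep : Bool) (p q q' : ℕ) (i j : ℕ) : Prop :=
  (i < p ∧ j = i) ∨ (∃ m, i = p + q + m ∧ j = p + q' + m) ∨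
    (keep = true ∧ ((i = p ∧ j = p + 1) ∨ (i = p + 1 ∧ j = p)))

/-- Two colored diagrams are related by a move, which preserves the numbering of the components. -/
def CD.Step {n : ℕ} {μ ν : Fin n → Bool} (e keep : Bool) (Z Z' : CD μ ν) (p q q' : ℕ) : Prop :=
  DiagramStep e keep Z.toDiagram Z'.toDiagram p q q' ∧
    ∀ (x : Z.Node) (x' : Z'.Node), SameLevel p q q' x.1.1 x'.1.1 → x.1.2 = x'.1.2 →
      Z.comp x = Z'.comp x'

/-! ### Colored cell complexes and colored singular triangulations -/

namespace Diagram

variable (D : Diagram)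

/-- Two nodes are joined by a part of a strand which does not traverse a crossing. -/
def SameArc : ℕ × ℕ → ℕ × ℕ → Prop :=
  Relation.EqvGen fun x y => D.next x = some y ∧ D.visit x = none

variable {D}

/-- The 2-face of the tetrahedron of a crossing which is pierced by an end of one of its strands,
named by the opposite vertex. After reversing the orientation of the thick strands, the under-strand
goes from face 2 to face 3 and the over-strand from face 0 to face 1 if the crossing is positive,
and the other way round if it is negative. -/
def Crossing.face (c : D.Crossing) (under bot : Bool) : Fin 4 :=
  let other := c.strand (!under)
  if (c.gen.positive != (other.up != other.thick)) = bot
  then (if under then 3 else 1) else (if under then 2 else 0)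

variable (D)

/-- The points of the disjoint union of the tetrahedra of the crossings. -/
abbrev TetraPoint : Type := D.Crossing × stdSimplex ℝ (Fin 4)

/-- The tetrahedra form a discrete family. -/
instance : TopologicalSpace D.Crossing := ⊥

/-- Two faces which are adjacent along the diagram are glued by the affine isomorphism that
preserves the order of the vertices. -/
inductive Glue : D.TetraPoint → D.TetraPoint → Prop where
  | mk (c c' : D.Crossing) (under under' bot bot' : Bool)
      (h : D.SameArc (c.leg under bot) (c'.leg under' bot')) (t : stdSimplex ℝ (Fin 3)) :
      Glue (c, stdSimplex.map (Fin.succAbove (c.face under bot)) t)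
        (c', stdSimplex.map (Fin.succAbove (c'.face under' bot')) t)

/-- The colored cell complex `C(Z)`, with the quotient topology. -/
def CellComplex : Type := Quotient (Relation.EqvGen.setoid D.Glue)

instance : TopologicalSpace D.CellComplex :=
  inferInstanceAs (TopologicalSpace (Quotient (Relation.EqvGen.setoid D.Glue)))

variable {D}

/-- The characteristic map of a tetrahedron. -/
def cell (c : D.Crossing) (x : stdSimplex ℝ (Fin 4)) : D.CellComplex :=
  Quotient.mk (Relation.EqvGen.setoid D.Glue) (c, x)

variable (D)

/-- The oriented edges of the tetrahedra. -/
abbrev Edge : Type := D.Crossing × (Fin 2 ↪ Fin 4)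

/-- The vertices of the tetrahedra. -/
abbrev Vertex : Type := D.Crossing × Fin 4

/-- The identification of pairs of edges (by affine isomorphisms) and of pairs of vertices. -/
inductive Ident (E : Set (D.Edge × D.Edge)) (V : Set (D.Vertex × D.Vertex)) :
    D.CellComplex → D.CellComplex → Prop where
  | edge (e e' : D.Edge) (h : (e, e') ∈ E) (t : stdSimplex ℝ (Fin 2)) :
      Ident E V (cell e.1 (stdSimplex.map e.2 t)) (cell e'.1 (stdSimplex.map e'.2 t))
  | vertex (v v' : D.Vertex) (h : (v, v') ∈ V) :
      Ident E V (cell v.1 (stdSimplex.vertex v.2)) (cell v'.1 (stdSimplex.vertex v'.2))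

end Diagram

/-- Colored singular triangulations: quotients of colored cell complexes by the identification of
some pairs of edges and some pairs of vertices, in which the open faces of the tetrahedra are
still embedded. -/
structure CT {n : ℕ} (μ ν : Fin n → Bool) where
  /-- The type of the triangulation. -/
  type : CD μ ν
  /-- The kernel of the projection from the colored cell complex. -/
  rel : Setoid type.CellComplex
  rel_eq : ∃ E V, rel = Relation.EqvGen.setoid (type.Ident E V)
  embedded : ∀ (c : type.Crossing) (x y : stdSimplex ℝ (Fin 4)), (∀ i, x i = 0 ↔ y i = 0) →
    rel (Diagram.cell c x) (Diagram.cell c y) → x = y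

namespace CT

variable {n : ℕ} {μ ν : Fin n → Bool}

/-- The triangulated space. -/
abbrev Space (X : CT μ ν) : Type := Quotient X.rel

/-- The projection `ψ` from the colored cell complex. -/
def proj (X : CT μ ν) (x : X.type.CellComplex) : X.Space := Quotient.mk X.rel x

/-- The underlying colored diagram. -/
def diagram (X : CT μ ν) : CD μ ν := X.type

/-- A point of the colored cell complex is on a tetrahedron of a crossing which is involved in a
move, that is, of a crossing in a slice which is not in the set `I`. -/
def Inside {D : Diagram} (I : Set ℕ) (x : D.CellComplex) : Prop :=
  ∃ (c : D.Crossing) (y : stdSimplex ℝ (Fin 4)), (c.1 : ℕ) ∉ I ∧ x = Diagram.cell c y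

/-- Two colored singular triangulations are related by a move: their types are, and the
two projections agree on the exterior of the tetrahedra which are involved in the move. -/
def Step (e : Bool) (X X' : CT μ ν) : Prop :=
  ∃ (keep : Bool) (p q q' : ℕ), X.type.Step e keep X'.type p q q' ∧
    ∀ (c d : X.type.Crossing) (c' d' : X'.type.Crossing) (x y : stdSimplex ℝ (Fin 4)),
      SameSlice keep p q q' c.1 c'.1 → SameSlice keep p q q' d.1 d'.1 →
      (∀ z ∈ [Diagram.cell c x, Diagram.cell d y],
        ¬ Inside {i | ∃ j, SameSlice keep p q q' i j} z) →
      (∀ z ∈ [Diagram.cell c' x, Diagram.cell d' y],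
        ¬ Inside {j | ∃ i, SameSlice keep p q q' i j} z) →
      (X.proj (Diagram.cell c x) = X.proj (Diagram.cell d y) ↔
        X'.proj (Diagram.cell c' x) = X'.proj (Diagram.cell d' y))

/-- The equivalence relation generated by all colored moves. -/
def Equiv : CT μ ν → CT μ ν → Prop := Relation.EqvGen fun X X' => ∃ e, Step e X X'

/-- The equivalence relation generated by the colored moves which are not excluded. -/
def Equiv' : CT μ ν → CT μ ν → Prop := Relation.EqvGen (Step false)

end CT

end ColTri

/-! All labels come from one tensor. The maps `x ↦ 1 ⊗ x` and `f ↦ f ⊗ 1` embed `A` and `A^*` in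
`H(A)`. If a strand is thick, and likewise if it is directed upwards, its labels get one more `γ`
(under-strand) or one more `(γ⁻¹)^*` (over-strand), and the order in which its labels are multiplied
is reversed. As `γ` and `(γ⁻¹)^*` reverse products, the two effects match: two labels from `A` on a
strand merge by the product of `A`, and two labels from `A^*` by the product of `A^*`, by formulas
that are the same for all colours and directions (`strandProd_lower`, `strandProd_upper`). With
`crossLabel_eq` every move becomes an identity for the canonical element `∑ e_a ⊗ e^a`.

For the (0,2) move this is its inverse `∑ γ(e_a) ⊗ e^a` (`sum_inverse_left`, `sum_inverse_right`).
In a Pachner move only the middle strand carries both a label from `A` and one from `A^*`, so only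
there the commutation relation of `H(A)` enters. An untwisted middle strand gives the pentagon
equation `S₁₂ S₁₃ S₂₃ = S₂₃ S₁₂` or its inverse (`pentagon`, `pentagon_inverse`). A middle strand
twisted once gives reversed versions, valid for every bijective `γ` (`pentagon_reversed`,
`pentagon_reversed_inverse`). A thick middle strand directed upwards is twisted twice, and is
reduced to the first case by `γ² = 1`. Slides and half turns rest on `∑ γ(e_a) ⊗ (γ⁻¹)^*(e^a) = ∑
e_a ⊗ e^a`; the excluded ones compare labels which differ by `γ²`.

It remains to see that `J'` is local. The strands of a diagram are the orbits of the partial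
injection `next`. If every strand inside the part that a move replaces is contracted to a single
point, both diagrams give the same partial injection, so their components pass through the outside
points and the inside strands in the same order (`IsExpansion`, `exists_next`). With the labels
outside fixed, `J'` is a multilinear function of the products of labels along the inside strands, so
it suffices to compare the sums of these over the states inside (`J_eq_of_sameSum`). Base points do
not matter: rotating a closed word changes its value by a commutator (`J_eq_orbits`).

For each move the inside strands are finite lists which are checked by evaluation, and vertical
strands are then added on both sides (`J_eq_of_arcs`). The exchange of heights involves arbitrary
elementary diagrams and is instead assembled from five juxtaposed columns. All this is collected in
`J_eq_of_step`, which suffices because `J'` of a triangulation depends on its type only. -/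

namespace ColTri

/-! ### The antipode reverses the coproduct -/

section Antipode

variable {k A : Type*} [Field k] [Ring A] [HopfAlgebra k A]

open Coalgebra HopfAlgebra

/-- Coassociativity, evaluated on a trilinear map. -/
lemma coassoc_trilinear {W κ : Type*} {ρ σ : κ → Type*} [AddCommGroup W] [Module k W]
    (B : A →ₗ[k] A →ₗ[k] A →ₗ[k] W)
    {x : A} (r : Coalgebra.Repr k x κ) (r₁ : ∀ i, Coalgebra.Repr k (r.left i) (ρ i))
    (r₂ : ∀ i, Coalgebra.Repr k (r.right i) (σ i)) :
    ∑ i ∈ r.index, ∑ j ∈ (r₁ i).index, B ((r₁ i).left j) ((r₁ i).right j) (r.right i) =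
      ∑ i ∈ r.index, ∑ j ∈ (r₂ i).index, B (r.left i) ((r₂ i).left j) ((r₂ i).right j) := by
  have key := Coalgebra.sum_tmul_tmul_eq r r₁ r₂
  apply_fun (TensorProduct.lift (TensorProduct.uncurry (RingHom.id k) A A W ∘ₗ B)) at key
  simpa only [map_sum, TensorProduct.lift.tmul, LinearMap.comp_apply,
    TensorProduct.uncurry_apply] using key

/-- The flipped comultiplication of the antipodes, as a linear map. -/
noncomputable def antipodeComul : A →ₗ[k] A ⊗[k] A :=
  TensorProduct.map (antipode k) (antipode k) ∘ₗ
    (TensorProduct.comm k A A).toLinearMap ∘ₗ comul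

lemma antipodeComul_apply {κ : Type*} (x : A) (r : Coalgebra.Repr k x κ) :
    antipodeComul (k := k) x = ∑ i ∈ r.index, antipode k (r.right i) ⊗ₜ antipode k (r.left i) := by
  rw [antipodeComul, LinearMap.comp_apply, LinearMap.comp_apply, ← r.eq]
  simp

/-- At `x` the convolution product is `∑ γ(x₂) x₃ ⊗ γ(x₁) x₄`. The inner pair `γ(x₂) x₃` collapses
first, and then `γ(x₁) x₂`. This is the half of the uniqueness of convolution inverses that
`comul_antipode` needs. -/
lemma antipodeComul_conv_comul :
    WithConv.toConv (antipodeComul (k := k) (A := A)) * WithConv.toConv comul = 1 := by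
  ext x
  let r := Repr.arbitrary k x
  let B : A →ₗ[k] A →ₗ[k] A →ₗ[k] A ⊗[k] A := LinearMap.mk₂ k
    (fun a b => LinearMap.mulLeft k (antipode k b ⊗ₜ antipode k a : A ⊗[k] A) ∘ₗ comul)
    (fun _ _ _ => by ext; simp [TensorProduct.tmul_add, add_mul])
    (fun _ _ _ => by ext; simp)
    (fun _ _ _ => by ext; simp [TensorProduct.add_tmul, add_mul])
    (fun _ _ _ => by ext; simp [← smul_mul_assoc, TensorProduct.smul_tmul'])
  let C (a : A) : A →ₗ[k] A →ₗ[k] A →ₗ[k] A ⊗[k] A := LinearMap.mk₂ k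
    (fun u v => TensorProduct.mk k A A (antipode k u * v) ∘ₗ LinearMap.mulLeft k (antipode k a))
    (fun _ _ _ => by ext; simp [add_mul])
    (fun _ _ _ => by ext; simp)
    (fun _ _ _ => by ext; simp [mul_add])
    (fun _ _ _ => by ext; simp)
  -- Here `a` stands for `x₁` and `y` for the remaining leg. After one more splitting the sum is `∑
  -- γ(y₁) y₂ ⊗ γ(a) y₃`, and coassociativity brings `y₁` and `y₂` together.
  have h2 (a y : A) (s : Repr k y (A × A)) :
      ∑ j ∈ s.index, B a (s.left j) (s.right j) = 1 ⊗ₜ (antipode k a * y) := by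
    have h := coassoc_trilinear (C a) s (fun i => Repr.arbitrary k (s.left i))
      (fun i => Repr.arbitrary k (s.right i))
    have h3 : ∀ j, B a (s.left j) (s.right j) = ∑ m ∈ (Repr.arbitrary k (s.right j)).index,
        C a (s.left j) ((Repr.arbitrary k (s.right j)).left m)
          ((Repr.arbitrary k (s.right j)).right m) := fun j => by
      simp only [B, C, LinearMap.mk₂_apply, LinearMap.comp_apply, LinearMap.mulLeft_apply,
        TensorProduct.mk_apply]
      conv_lhs => rw [← (Repr.arbitrary k (s.right j)).eq]
      simp [Finset.mul_sum]
    rw [Finset.sum_congr rfl fun j _ => h3 j, ← h]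
    simp only [C, LinearMap.mk₂_apply, LinearMap.comp_apply, LinearMap.mulLeft_apply,
        TensorProduct.mk_apply, ← TensorProduct.sum_tmul, sum_antipode_mul_eq_smul]
    simp only [TensorProduct.smul_tmul, ← TensorProduct.tmul_sum, ← mul_smul_comm,
      ← Finset.mul_sum, sum_counit_smul]
  rw [r.convMul_apply]
  have h1 : ∀ i, antipodeComul (k := k) (r.left i) * comul (R := k) (r.right i) =
      ∑ j ∈ (Repr.arbitrary k (r.left i)).index, B ((Repr.arbitrary k (r.left i)).left j)
        ((Repr.arbitrary k (r.left i)).right j) (r.right i) := fun i => by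
    rw [antipodeComul_apply _ (Repr.arbitrary k (r.left i)), Finset.sum_mul]
    rfl
  change ∑ i ∈ r.index, antipodeComul (k := k) (r.left i) * comul (R := k) (r.right i) = _
  rw [Finset.sum_congr rfl fun i _ => h1 i, coassoc_trilinear B r _
    (fun i => Repr.arbitrary k (r.right i)), Finset.sum_congr rfl fun i _ => h2 _ _ _]
  rw [← TensorProduct.tmul_sum, sum_antipode_mul_eq_algebraMap_counit, LinearMap.convOne_apply]
  rw [Algebra.algebraMap_eq_smul_one, TensorProduct.tmul_smul, Algebra.algebraMap_eq_smul_one,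
    Algebra.TensorProduct.one_def]

/-- The antipode reverses the coproduct. -/
lemma comul_antipode (x : A) :
    comul (R := k) (antipode k x) = antipodeComul (k := k) x := by
  -- A left and a right convolution inverse of `comul` coincide; the right one is `comul ∘ γ`.
  have := left_inv_eq_right_inv (antipodeComul_conv_comul (k := k) (A := A))
    LinearMap.comul_right_inv
  exact (LinearMap.congr_fun (congrArg WithConv.ofConv this) x).symm

/-- The product of `A^*` is the transposed coproduct, so this is `comul_antipode` dualized. -/
lemma dmul_antipode (f g : Module.Dual k A) :
    (antipode k (A := A)).dualMap (dmul k A f g) =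
      dmul k A ((antipode k (A := A)).dualMap g) ((antipode k (A := A)).dualMap f) := by
  ext x
  let r := Repr.arbitrary k x
  change TensorProduct.dualDistrib k A A (f ⊗ₜ g) (comul (antipode k x)) = _
  rw [comul_antipode, antipodeComul_apply _ r, dmul_eq _ _ _ r]
  simp [mul_comm]

end Antipode

/-! ### Calculus in the Heisenberg double -/

section HeisCalculus

variable {k A : Type*} [Field k] [Ring A] [HopfAlgebra k A]

open Coalgebra HopfAlgebra

/-- The inclusion `x ↦ 1 ⊗ x`. -/
noncomputable def iota : A →ₗ[k] Heis k A :=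
  (TensorProduct.mk k (Module.Dual k A) A Coalgebra.counit :)

/-- The inclusion `f ↦ f ⊗ 1`. -/
noncomputable def kappa : Module.Dual k A →ₗ[k] Heis k A :=
  ((TensorProduct.mk k (Module.Dual k A) A).flip 1 :)

lemma iota_apply (x : A) : iota x = Heis.mk k A Coalgebra.counit x := rfl

lemma kappa_apply (f : Module.Dual k A) : kappa f = Heis.mk k A f 1 := rfl

lemma iota_one : iota (1 : A) = (1 : Heis k A) := rfl

lemma kappa_counit : kappa (Coalgebra.counit : Module.Dual k A) = 1 := rfl

lemma kappa_mul_iota (f : Module.Dual k A) (x : A) : kappa f * iota x = Heis.mk k A f x := by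
  rw [kappa_apply, iota_apply, Heis.mul_def, hmul_mk, act_one, dact_mk, dmul_one]

lemma kappa_mul (f g : Module.Dual k A) : kappa (dmul k A f g) = kappa f * kappa g := by
  rw [kappa_apply, kappa_apply, kappa_apply, Heis.mul_def, hmul_mk, act_one, dact_mk]

/-- The commutation relation of `H(A)`, the only rule which mixes labels from `A` with labels from
`A^*`. Every pentagon identity comes from it. -/
lemma iota_mul_kappa {κ : Type*} (x : A) (r : Repr k x κ) (f : Module.Dual k A) :
    iota x * kappa f = ∑ i ∈ r.index, kappa (shift k A (r.left i) f) * iota (r.right i) := by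
  simp only [kappa_mul_iota]
  rw [kappa_apply, iota_apply, Heis.mul_def, hmul_mk, dact_one, act_mk _ r]
  simp

/-- Since `ε(? x') = ε(x') ε`, the first leg of the coproduct of `x` reduces to a scalar and
disappears by the counit axiom. -/
lemma iota_mul (x y : A) : iota (x * y) = (iota x * iota y : Heis k A) := by
  let r := Repr.arbitrary k x
  rw [iota_apply y, iota_apply x, Heis.mul_def, hmul_mk, dact_one, act_mk _ r]
  have : ∀ i, Heis.mk k A (shift k A (r.left i) counit) (r.right i * y) =
      iota ((counit (R := k) (r.left i) • r.right i) * y) := fun i => by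
    rw [shift_counit, iota_apply, smul_mul_assoc]
    exact TensorProduct.smul_tmul _ _ _
  rw [Finset.sum_congr rfl fun i _ => this i, ← map_sum, ← Finset.sum_mul, sum_counit_smul]

variable (hγ : Function.Bijective (antipode k : A →ₗ[k] A))

include hγ

lemma gamBar_gam (x : A) : gamBar k A (gam k A x) = x :=
  LinearMap.congr_fun (Ring.inverse_mul_cancel (antipode k : Module.End k A)
    ((Module.End.isUnit_iff _).2 hγ)) x

lemma gam_gamBar (x : A) : gam k A (gamBar k A x) = x :=
  LinearMap.congr_fun (Ring.mul_inverse_cancel (antipode k : Module.End k A)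
    ((Module.End.isUnit_iff _).2 hγ)) x

/-- The map `(γ⁻¹)^*` inverts `γ^*`, which reverses products by `dmul_antipode`. -/
lemma dmul_gamBar (f g : Module.Dual k A) :
    (gamBar k A).dualMap (dmul k A f g) =
      dmul k A ((gamBar k A).dualMap g) ((gamBar k A).dualMap f) := by
  have h (f : Module.Dual k A) : (gam k A).dualMap ((gamBar k A).dualMap f) = f := by
    ext x; simp [gamBar_gam hγ]
  have h' (f : Module.Dual k A) : (gamBar k A).dualMap ((gam k A).dualMap f) = f := by
    ext x; simp [gam_gamBar hγ]
  conv_lhs => rw [← h f, ← h g]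
  exact (congrArg _ (dmul_antipode _ _).symm).trans (h' _)

lemma gamBar_mul (x y : A) : gamBar k A (x * y) = gamBar k A y * gamBar k A x := by
  apply hγ.1
  change gam k A _ = antipode k _
  rw [gam_gamBar hγ, antipode_mul_antidistrib]
  change _ = gam k A _ * gam k A _
  rw [gam_gamBar hγ, gam_gamBar hγ]

end HeisCalculus

/-! ### The canonical element of `A ⊗ A^*` -/

section DualBasis

variable {k A : Type*} [Field k] [Ring A] [HopfAlgebra k A] {ι : Type*} [Fintype ι]
  (e : Module.Basis ι k A) {W : Type*} [AddCommGroup W] [Module k W]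

open Coalgebra HopfAlgebra

lemma sum_dual_coord (f : Module.Dual k A) : ∑ a, f (e a) • e.coord a = f := by
  classical
  exact e.sum_dual_apply_smul_coord f

/-- A linear map can be moved across the canonical element. -/
lemma sum_canonical_comp (B : A →ₗ[k] Module.Dual k A →ₗ[k] W) (T : A →ₗ[k] A) :
    ∑ a, B (T (e a)) (e.coord a) = ∑ a, B (e a) (T.dualMap (e.coord a)) := by
  have h1 (a : ι) : B (T (e a)) (e.coord a) =
      ∑ c, e.coord c (T (e a)) • B (e c) (e.coord a) := by
    conv_lhs => rw [← e.sum_repr (T (e a))]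
    simp [-Module.Basis.sum_repr]
  have h2 (c : ι) : B (e c) (T.dualMap (e.coord c)) =
      ∑ a, e.coord c (T (e a)) • B (e c) (e.coord a) := by
    conv_lhs => rw [← sum_dual_coord e (T.dualMap (e.coord c))]
    simp
  rw [Finset.sum_congr rfl fun a _ => h1 a, Finset.sum_congr rfl fun a _ => h2 a, Finset.sum_comm]

/-- The product of two canonical elements in the second factor is the coproduct in the first. -/
lemma sum_canonical_dmul (B : A →ₗ[k] A →ₗ[k] Module.Dual k A →ₗ[k] W) :
    ∑ a, ∑ c, B (e a) (e c) (dmul k A (e.coord a) (e.coord c)) =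
      ∑ m, ∑ i ∈ (Repr.arbitrary k (e m)).index, B ((Repr.arbitrary k (e m)).left i)
        ((Repr.arbitrary k (e m)).right i) (e.coord m) := by
  -- The coefficient of `e^m` in a covector is its value at `e_m`; for the product `e^a e^c` this
  -- value is read off from the coproduct of `e_m`.
  have h1 (a c : ι) : B (e a) (e c) (dmul k A (e.coord a) (e.coord c)) =
      ∑ m, ∑ i ∈ (Repr.arbitrary k (e m)).index,
        (e.coord a ((Repr.arbitrary k (e m)).left i) * e.coord c ((Repr.arbitrary k (e m)).right i))
          • B (e a) (e c) (e.coord m) := by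
    conv_lhs => rw [← sum_dual_coord e (dmul k A (e.coord a) (e.coord c))]
    rw [map_sum]
    refine Finset.sum_congr rfl fun m _ => ?_
    rw [map_smul, dmul_eq _ _ _ (Repr.arbitrary k (e m)), Finset.sum_smul]
  -- Conversely the legs of the coproduct are expanded in the basis, which produces the same
  -- coefficients.
  have h2 (x y : A) (f : Module.Dual k A) :
      B x y f = ∑ a, ∑ c, (e.coord a x * e.coord c y) • B (e a) (e c) f := by
    conv_lhs => rw [← e.sum_repr x, ← e.sum_repr y]
    simp only [map_sum, map_smul, LinearMap.sum_apply, LinearMap.smul_apply, Finset.smul_sum,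
      Module.Basis.coord_apply, mul_smul]
    rw [Finset.sum_comm]
    exact Finset.sum_congr rfl fun _ _ => Finset.sum_congr rfl fun _ _ => smul_comm _ _ _
  simp_rw [h1, h2 (Repr.left _ _) (Repr.right _ _) (e.coord _)]
  rw [Finset.sum_congr rfl fun a _ => Finset.sum_comm, Finset.sum_comm]
  refine Finset.sum_congr rfl fun m _ => ?_
  rw [Finset.sum_congr rfl fun a _ => Finset.sum_comm, Finset.sum_comm]

/-- Right multiplication moved across the canonical element. -/
lemma sum_canonical_mul_right (B : A →ₗ[k] Module.Dual k A →ₗ[k] W) (x : A) :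
    ∑ a, B (e a) (shift k A x (e.coord a)) = ∑ a, B (e a * x) (e.coord a) :=
  (sum_canonical_comp e B (LinearMap.mulRight k x)).symm

end DualBasis

/-! ### Inverse of the canonical element and pentagon equations -/

section CanonicalIdentities

variable {k A : Type*} [Field k] [Ring A] [HopfAlgebra k A] {ι : Type*} [Fintype ι]
  (e : Module.Basis ι k A) {W : Type*} [AddCommGroup W] [Module k W]

open Coalgebra HopfAlgebra

/-- A decomposition of the coproduct of `γ(x)`. -/
noncomputable def reprGam {κ : Type*} {x : A} (r : Repr k x κ) : Repr k (gam k A x) κ where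
  index := r.index
  left i := gam k A (r.right i)
  right i := gam k A (r.left i)
  eq := ((comul_antipode x).trans (antipodeComul_apply x r)).symm

lemma sum_smul_counit {κ : Type*} {x : A} (r : Repr k x κ) :
    ∑ i ∈ r.index, counit (R := k) (r.right i) • r.left i = x := by
  have h := congrArg (TensorProduct.rid k A) (sum_tmul_counit_eq r)
  simpa [-sum_tmul_counit_eq] using h

lemma sum_counit_coord (G : Module.Dual k A →ₗ[k] W) :
    ∑ m, counit (R := k) (e m) • G (e.coord m) = G counit := by
  conv_rhs => rw [← sum_dual_coord e counit, map_sum]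
  simp only [map_smul]

/-- Merging the two covectors replaces `e_i` and `e_j` by the legs of the coproduct of `e_m`; the
antipode axiom leaves `ε(e_m)`, and `∑ ε(e_m) e^m = ε`. Like the other identities for the canonical
element, it is tested on an arbitrary multilinear map, so that it can be used inside any product of
labels. -/
lemma sum_inverse_left (G : A →ₗ[k] Module.Dual k A →ₗ[k] W) :
    ∑ i, ∑ j, G (gam k A (e i) * e j) (dmul k A (e.coord i) (e.coord j)) = G 1 counit := by
  refine (sum_canonical_dmul e (LinearMap.mk₂ k (fun x y => G (gam k A x * y))
    (by intros; simp [add_mul]) (by intros; simp) (by intros; simp [mul_add])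
    (by intros; simp))).trans ?_
  rw [← sum_counit_coord e]
  refine Finset.sum_congr rfl fun m _ => ?_
  simp only [LinearMap.mk₂_apply, ← LinearMap.sum_apply, ← map_sum]
  erw [sum_antipode_mul_eq_smul]
  simp

lemma sum_inverse_right (G : A →ₗ[k] Module.Dual k A →ₗ[k] W) :
    ∑ i, ∑ j, G (e i * gam k A (e j)) (dmul k A (e.coord i) (e.coord j)) = G 1 counit := by
  refine (sum_canonical_dmul e (LinearMap.mk₂ k (fun x y => G (x * gam k A y))
    (by intros; simp [add_mul]) (by intros; simp) (by intros; simp [mul_add])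
    (by intros; simp))).trans ?_
  rw [← sum_counit_coord e]
  refine Finset.sum_congr rfl fun m _ => ?_
  simp only [LinearMap.mk₂_apply, ← LinearMap.sum_apply, ← map_sum]
  erw [sum_mul_antipode_eq_smul]
  simp

/-- In leg notation, `S₁₂ S₁₃ S₂₃ = S₂₃ S₁₂`; only the second leg has to lie in `H(A)`. Merging
`e^j` and `e^l` produces the legs of the coproduct of `e_m`. Right multiplication of `e_i` by the
first leg moves over to `e^i`, where it is the shift that occurs in `iota_mul_kappa`. -/
lemma pentagon (G : A →ₗ[k] Heis k A →ₗ[k] Module.Dual k A →ₗ[k] W) :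
    ∑ j, ∑ l, ∑ i, G (e i * e j) (kappa (e.coord i) * iota (e l)) (dmul k A (e.coord j) (e.coord l))
      = ∑ l, ∑ i, G (e i) (iota (e l) * kappa (e.coord i)) (e.coord l) := by
  have h := sum_canonical_dmul e (∑ i, LinearMap.mk₂ k
    (fun x y => G (e i * x) (kappa (e.coord i) * iota y))
    (by intros; simp [mul_add]) (by intros; simp) (by intros; simp [mul_add])
    (by intros; simp))
  simp only [LinearMap.sum_apply, LinearMap.mk₂_apply] at h
  rw [h]
  refine Finset.sum_congr rfl fun m _ => ?_
  let r := Repr.arbitrary k (e m)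
  have h1 (i : ι) : G (e i) (iota (e m) * kappa (e.coord i)) (e.coord m) = ∑ t ∈ r.index,
      G (e i) (kappa (shift k A (r.left t) (e.coord i)) * iota (r.right t)) (e.coord m) := by
    rw [iota_mul_kappa _ r, map_sum, LinearMap.sum_apply]
  rw [Finset.sum_congr rfl fun i _ => h1 i]
  conv_rhs => rw [Finset.sum_comm]
  refine Finset.sum_congr rfl fun t _ => ?_
  exact (sum_canonical_mul_right e (LinearMap.mk₂ k
    (fun x f => G x (kappa f * iota (r.right t)) (e.coord m))
    (by intros; simp) (by intros; simp) (by intros; simp [add_mul])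
    (by intros; simp)) (r.left t)).symm

/-- The inverted pentagon equation with the legs numbered backwards, `S₂₁⁻¹ S₃₁⁻¹ S₃₂⁻¹ = S₃₂⁻¹
S₂₁⁻¹`, for `S⁻¹ = ∑ γ(e_a) ⊗ e^a`. After the covectors have been merged and the middle leg has been
commuted, the last leg is `γ(e_l γ(m₂) m₃)`, and the antipode axiom applies to its last two factors.
-/
lemma pentagon_inverse (G : Module.Dual k A →ₗ[k] Heis k A →ₗ[k] A →ₗ[k] W) :
    ∑ i, ∑ j, ∑ l, G (dmul k A (e.coord i) (e.coord j))
        (iota (gam k A (e i)) * kappa (e.coord l)) (gam k A (e j) * gam k A (e l))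
      = ∑ i, ∑ l, G (e.coord i) (kappa (e.coord l) * iota (gam k A (e i))) (gam k A (e l)) := by
  have h := sum_canonical_dmul e (∑ l, LinearMap.mk₂ k
    (fun x y => (G.flip (iota (gam k A x) * kappa (e.coord l))).flip (gam k A y * gam k A (e l)))
    (by intros; ext; simp [add_mul]) (by intros; ext; simp) (by intros; ext; simp [add_mul])
    (by intros; ext; simp))
  simp only [LinearMap.sum_apply, LinearMap.mk₂_apply, LinearMap.flip_apply] at h
  rw [h]
  refine Finset.sum_congr rfl fun m _ => ?_
  let r := Repr.arbitrary k (e m)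
  -- The form `T u v w` has `e^l γ(u)` on the middle leg and `γ(e_l γ(v) w)` on the last one. Making
  -- it trilinear allows coassociativity to regroup the three legs of `e_m`.
  let T : A →ₗ[k] A →ₗ[k] A →ₗ[k] W := ∑ l, LinearMap.mk₂ k
    (fun u v => (G (e.coord m) (kappa (e.coord l) * iota (gam k A u))) ∘ₗ gam k A ∘ₗ
      LinearMap.mulLeft k (e l) ∘ₗ LinearMap.mulLeft k (gam k A v))
    (by intros; ext; simp [mul_add]) (by intros; ext; simp) (by intros; ext; simp [mul_add, add_mul])
    (by intros; ext; simp)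
  have h1 (t) : ∑ l, G (e.coord m) (iota (gam k A (r.left t)) * kappa (e.coord l))
      (gam k A (r.right t) * gam k A (e l)) = ∑ s ∈ (Repr.arbitrary k (r.left t)).index,
        T ((Repr.arbitrary k (r.left t)).left s) ((Repr.arbitrary k (r.left t)).right s)
          (r.right t) := by
    have h2 (l : ι) := iota_mul_kappa _ (reprGam (Repr.arbitrary k (r.left t))) (e.coord l)
    simp only [h2, map_sum, LinearMap.sum_apply]
    rw [Finset.sum_comm]
    refine Finset.sum_congr rfl fun s _ => ?_
    refine (sum_canonical_mul_right e (LinearMap.mk₂ k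
      (fun x f => G (e.coord m) (kappa f * iota ((reprGam (Repr.arbitrary k (r.left t))).right s))
        (gam k A (r.right t) * gam k A x))
      (by intros; simp [mul_add]) (by intros; simp) (by intros; simp [add_mul])
      (by intros; simp)) _).trans ?_
    simp only [T, LinearMap.sum_apply, LinearMap.mk₂_apply, LinearMap.comp_apply,
      LinearMap.mulLeft_apply]
    refine Finset.sum_congr rfl fun l _ => ?_
    rw [← mul_assoc]
    congr 1
    exact (antipode_mul_antidistrib _ _).symm
  rw [Finset.sum_congr rfl fun t _ => h1 t, coassoc_trilinear T r _
    (fun i => Repr.arbitrary k (r.right i))]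
  have h3 (t) : ∑ s ∈ (Repr.arbitrary k (r.right t)).index,
        T (r.left t) ((Repr.arbitrary k (r.right t)).left s)
          ((Repr.arbitrary k (r.right t)).right s) = ∑ l, G (e.coord m) (kappa (e.coord l) *
            iota (gam k A (counit (R := k) (r.right t) • r.left t))) (gam k A (e l)) := by
    simp only [T, LinearMap.sum_apply, LinearMap.mk₂_apply, LinearMap.comp_apply,
      LinearMap.mulLeft_apply]
    rw [Finset.sum_comm]
    refine Finset.sum_congr rfl fun l _ => ?_
    simp only [← map_sum, ← Finset.mul_sum]
    erw [sum_antipode_mul_eq_smul]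
    simp
  rw [Finset.sum_congr rfl fun t _ => h3 t, Finset.sum_comm]
  refine Finset.sum_congr rfl fun l _ => ?_
  simp only [← LinearMap.sum_apply, ← map_sum, ← Finset.mul_sum]
  rw [sum_smul_counit]

/-- The pentagon equation for a middle strand whose labels are twisted once, so that the products on
the outer legs appear in the opposite order. The map `γ⁻¹` is moved from `e^i` to `e_i` for the
commutation and moved back afterwards; in between, `γ⁻¹(e_i γ(m'')) = m'' γ⁻¹(e_i)`. -/
lemma pentagon_reversed (hγ : Function.Bijective (antipode k : A →ₗ[k] A))
    (G : A →ₗ[k] Heis k A →ₗ[k] Module.Dual k A →ₗ[k] W) :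
    ∑ l, ∑ j, ∑ i, G (e j * e i)
        (kappa ((gamBar k A).dualMap (e.coord i)) * iota (gam k A (e l)))
        (dmul k A (e.coord l) (e.coord j))
      = ∑ l, ∑ i, G (e i) (iota (gam k A (e l)) * kappa ((gamBar k A).dualMap (e.coord i)))
          (e.coord l) := by
  have h := sum_canonical_dmul e (∑ i, LinearMap.mk₂ k
    (fun x y => G (y * e i) (kappa ((gamBar k A).dualMap (e.coord i)) * iota (gam k A x)))
    (by intros; simp [mul_add]) (by intros; simp) (by intros; simp [add_mul])
    (by intros; simp))
  simp only [LinearMap.sum_apply, LinearMap.mk₂_apply] at h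
  rw [h]
  refine Finset.sum_congr rfl fun m _ => ?_
  let r := Repr.arbitrary k (e m)
  -- This frees the covector of `(γ⁻¹)^*`, so that a shift of it can be moved to the vector.
  have h1 := sum_canonical_comp e (LinearMap.mk₂ k
    (fun x f => G x (iota (gam k A (e m)) * kappa f) (e.coord m))
    (by intros; simp) (by intros; simp) (by intros; simp [mul_add])
    (by intros; simp)) (gamBar k A)
  simp only [LinearMap.mk₂_apply] at h1
  rw [← h1]
  have h2 (i : ι) : G (gamBar k A (e i)) (iota (gam k A (e m)) * kappa (e.coord i)) (e.coord m) =
      ∑ t ∈ r.index, G (gamBar k A (e i)) (kappa (shift k A (gam k A (r.right t)) (e.coord i)) *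
        iota (gam k A (r.left t))) (e.coord m) := by
    rw [iota_mul_kappa _ (reprGam r), map_sum, LinearMap.sum_apply]
    rfl
  rw [Finset.sum_congr rfl fun i _ => h2 i]
  conv_rhs => rw [Finset.sum_comm]
  refine Finset.sum_congr rfl fun t _ => ?_
  have h3 := sum_canonical_mul_right e (LinearMap.mk₂ k
    (fun x f => G (gamBar k A x) (kappa f * iota (gam k A (r.left t))) (e.coord m))
    (by intros; simp) (by intros; simp) (by intros; simp [add_mul])
    (by intros; simp)) (gam k A (r.right t))
  simp only [LinearMap.mk₂_apply, gamBar_mul hγ, gamBar_gam hγ] at h3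
  rw [h3]
  exact (sum_canonical_comp e (LinearMap.mk₂ k
    (fun x f => G (r.right t * x) (kappa f * iota (gam k A (r.left t))) (e.coord m))
    (by intros; simp [mul_add]) (by intros; simp) (by intros; simp [add_mul])
    (by intros; simp)) (gamBar k A)).symm

/-- The case of crossings of negative kind, where the under-label on the once twisted middle strand
is `γ(γ(e_i))`. Moving `(γ⁻¹)^*` from `e^l` to `e_l` cancels the `γ` there. As `γ²` preserves the
order of the coproduct, the commutation leaves `e_l γ(m₁ γ(m₂))` on the last leg, and the antipode
axiom applies. -/
lemma pentagon_reversed_inverse (hγ : Function.Bijective (antipode k : A →ₗ[k] A))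
    (G : Module.Dual k A →ₗ[k] Heis k A →ₗ[k] A →ₗ[k] W) :
    ∑ j, ∑ i, ∑ l, G (dmul k A (e.coord j) (e.coord i))
        (iota (gam k A (gam k A (e i))) * kappa ((gamBar k A).dualMap (e.coord l)))
        (gam k A (e l) * gam k A (e j))
      = ∑ i, ∑ l, G (e.coord i) (kappa ((gamBar k A).dualMap (e.coord l)) *
          iota (gam k A (gam k A (e i)))) (gam k A (e l)) := by
  have hl (m : ι) (y : A) (z : A) : ∑ l, G (e.coord m)
      (iota y * kappa ((gamBar k A).dualMap (e.coord l))) (gam k A (e l) * z) =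
      ∑ l, G (e.coord m) (iota y * kappa (e.coord l)) (e l * z) := by
    have := sum_canonical_comp e (LinearMap.mk₂ k
      (fun x f => G (e.coord m) (iota y * kappa f) (gam k A x * z))
      (by intros; simp [add_mul]) (by intros; simp) (by intros; simp [mul_add])
      (by intros; simp)) (gamBar k A)
    simp only [LinearMap.mk₂_apply, gam_gamBar hγ] at this
    exact this.symm
  have hr (m : ι) (y : A) : ∑ l, G (e.coord m)
      (kappa ((gamBar k A).dualMap (e.coord l)) * iota y) (gam k A (e l)) =
      ∑ l, G (e.coord m) (kappa (e.coord l) * iota y) (e l) := by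
    have := sum_canonical_comp e (LinearMap.mk₂ k
      (fun x f => G (e.coord m) (kappa f * iota y) (gam k A x))
      (by intros; simp) (by intros; simp) (by intros; simp [add_mul])
      (by intros; simp)) (gamBar k A)
    simp only [LinearMap.mk₂_apply, gam_gamBar hγ] at this
    exact this.symm
  have h := sum_canonical_dmul e (∑ l, LinearMap.mk₂ k
    (fun x y => (G.flip (iota (gam k A (gam k A y)) *
      kappa ((gamBar k A).dualMap (e.coord l)))).flip (gam k A (e l) * gam k A x))
    (by intros; ext; simp [mul_add]) (by intros; ext; simp) (by intros; ext; simp [add_mul])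
    (by intros; ext; simp))
  simp only [LinearMap.sum_apply, LinearMap.mk₂_apply, LinearMap.flip_apply] at h
  rw [h]
  refine Finset.sum_congr rfl fun m _ => ?_
  let r := Repr.arbitrary k (e m)
  simp only [hl, hr]
  -- The form `T u v w` has `e^l γ²(w)` on the middle leg and `e_l γ(u γ(v))` on the last one. Here
  -- it is the first two legs that cancel, so coassociativity is used in the other direction.
  let T : A →ₗ[k] A →ₗ[k] A →ₗ[k] W := ∑ l, LinearMap.mk₂ k
    (fun u v => (G (e.coord m)).flip (e l * gam k A (u * gam k A v)) ∘ₗ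
      LinearMap.mulLeft k (kappa (e.coord l)) ∘ₗ iota ∘ₗ gam k A ∘ₗ gam k A)
    (by intros; ext; simp [mul_add, add_mul]) (by intros; ext; simp)
    (by intros; ext; simp [mul_add]) (by intros; ext; simp)
  have h1 (t) : ∑ l, G (e.coord m) (iota (gam k A (gam k A (r.right t))) * kappa (e.coord l))
      (e l * gam k A (r.left t)) = ∑ s ∈ (Repr.arbitrary k (r.right t)).index,
        T (r.left t) ((Repr.arbitrary k (r.right t)).left s)
          ((Repr.arbitrary k (r.right t)).right s) := by
    have h2 (l : ι) := iota_mul_kappa _ (reprGam (reprGam (Repr.arbitrary k (r.right t))))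
      (e.coord l)
    simp only [h2, map_sum, LinearMap.sum_apply]
    rw [Finset.sum_comm]
    refine Finset.sum_congr rfl fun s _ => ?_
    refine (sum_canonical_mul_right e (LinearMap.mk₂ k
      (fun x f => G (e.coord m)
        (kappa f * iota ((reprGam (reprGam (Repr.arbitrary k (r.right t)))).right s))
        (x * gam k A (r.left t)))
      (by intros; simp [add_mul]) (by intros; simp) (by intros; simp [add_mul])
      (by intros; simp)) _).trans ?_
    simp only [T, LinearMap.sum_apply, LinearMap.mk₂_apply, LinearMap.comp_apply,
      LinearMap.mulLeft_apply, LinearMap.flip_apply]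
    refine Finset.sum_congr rfl fun l _ => ?_
    rw [mul_assoc]
    congr 2
    exact (antipode_mul_antidistrib _ _).symm
  rw [Finset.sum_congr rfl fun t _ => h1 t, ← coassoc_trilinear T r
    (fun i => Repr.arbitrary k (r.left i)) _]
  have h3 (t) : ∑ s ∈ (Repr.arbitrary k (r.left t)).index,
        T ((Repr.arbitrary k (r.left t)).left s)
          ((Repr.arbitrary k (r.left t)).right s) (r.right t) = ∑ l, G (e.coord m)
            (kappa (e.coord l) * iota (gam k A (gam k A
              (counit (R := k) (r.left t) • r.right t)))) (e l) := by
    simp only [T, LinearMap.sum_apply, LinearMap.mk₂_apply, LinearMap.comp_apply,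
      LinearMap.mulLeft_apply, LinearMap.flip_apply]
    rw [Finset.sum_comm]
    refine Finset.sum_congr rfl fun l _ => ?_
    simp only [← map_sum, ← Finset.mul_sum]
    erw [sum_mul_antipode_eq_smul]
    simp only [map_smul, mul_smul_comm, LinearMap.smul_apply]
    erw [antipode_one]
    rw [mul_one]
  rw [Finset.sum_congr rfl fun t _ => h3 t, Finset.sum_comm]
  refine Finset.sum_congr rfl fun l _ => ?_
  simp only [← LinearMap.sum_apply, ← map_sum, ← Finset.mul_sum]
  rw [sum_counit_smul]

end CanonicalIdentities

/-! ### Labels on a strand of given colour and direction -/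

section StrandLabels

variable {k A : Type*} [Field k] [Ring A] [HopfAlgebra k A]

open Coalgebra HopfAlgebra

lemma HC.of_mul_false (x y : Heis k A) :
    HC.of k A false x * HC.of k A false y = HC.of k A false (x * y) := rfl

lemma HC.of_mul_true (x y : Heis k A) :
    HC.of k A true x * HC.of k A true y = HC.of k A true (y * x) := rfl

lemma HC.of_one (c : Bool) : HC.of k A c 1 = 1 := by cases c <;> rfl

/-- The number of applications of the antipode to the label of a strand. -/
def Pt.twist (P : Pt) : ℕ := P.thick.toNat + P.up.toNat

variable (k A) in
/-- The label of an under-strand. -/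
noncomputable def lower (P : Pt) : A →ₗ[k] Heis k A :=
  iota ∘ₗ (gam k A ^ P.twist : Module.End k A)

variable (k A) in
/-- The label of an over-strand. -/
noncomputable def upper (P : Pt) : Module.Dual k A →ₗ[k] Heis k A :=
  kappa ∘ₗ ((gamBar k A).dualMap ^ P.twist : Module.End k (Module.Dual k A))

/-- The product of the labels on a strand, which are listed in the order in which they are met when
the strand is followed as if it were directed downwards. -/
noncomputable def strandProd (P : Pt) (l : List (Heis k A)) : Heis k A :=
  if P.thick = P.up then l.reverse.prod else l.prod

@[simp] lemma strandProd_nil (P : Pt) : strandProd P ([] : List (Heis k A)) = 1 := by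
  simp [strandProd]

@[simp] lemma strandProd_singleton (P : Pt) (x : Heis k A) : strandProd P [x] = x := by
  simp [strandProd]

lemma gam_mul (x y : A) : gam k A (x * y) = gam k A y * gam k A x :=
  antipode_mul_antidistrib _ _

lemma gam_one : gam k A 1 = 1 := antipode_one

lemma lower_one (P : Pt) : lower k A P 1 = 1 := by
  rcases P with ⟨_ | _, _ | _⟩ <;>
    simp [lower, Pt.twist, pow_two, gam_one, iota_one]

/-- The power `γ ^ twist` reverses products exactly if the twist is odd, that is, if exactly one of
`thick` and `up` holds; and exactly then `strandProd` does not reverse the list. So one formula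
covers all four sorts of strands. -/
lemma strandProd_lower (P : Pt) (x y : A) :
    strandProd P [lower k A P x, lower k A P y] = lower k A P (y * x) := by
  rcases P with ⟨_ | _, _ | _⟩ <;>
    simp [strandProd, lower, Pt.twist, pow_two, gam_mul, iota_mul]

lemma upper_counit (P : Pt) (hγ : Function.Bijective (antipode k : A →ₗ[k] A)) :
    upper k A P counit = 1 := by
  have h : (gamBar k A).dualMap counit = counit := by
    ext x
    rw [LinearMap.dualMap_apply, ← counit_antipode (R := k) (gamBar k A x)]
    exact congrArg _ (gam_gamBar hγ x)
  rcases P with ⟨_ | _, _ | _⟩ <;>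
    simp [upper, Pt.twist, pow_two, h, kappa_counit]

/-- The same parity argument, with `(γ⁻¹)^*` reversing the products of `A^*`. -/
lemma strandProd_upper (hγ : Function.Bijective (antipode k : A →ₗ[k] A)) (P : Pt)
    (f g : Module.Dual k A) :
    strandProd P [upper k A P f, upper k A P g] = upper k A P (dmul k A g f) := by
  rcases P with ⟨_ | _, _ | _⟩ <;>
    simp [strandProd, upper, Pt.twist, pow_two, dmul_gamBar hγ, kappa_mul]

end StrandLabels

/-! ### A uniform formula for the labels of crossings -/

section CrossLabel

variable {k A : Type*} [Field k] [Ring A] [HopfAlgebra k A] {ι : Type*} [Fintype ι]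
  (e : Module.Basis ι k A)

open Coalgebra HopfAlgebra

/-- On a thick strand the antimultiplicativity of `γ` makes up for the opposite product. Labelling
is therefore multiplicative for both colours, and the four tensors are images of the same canonical
element. -/
lemma of_lower_mul (c : Bool) (x y : A) :
    HC.of k A c (lower k A ⟨c, false⟩ x) * HC.of k A c (lower k A ⟨c, false⟩ y) =
      HC.of k A c (lower k A ⟨c, false⟩ (x * y)) := by
  rw [← strandProd_lower]
  cases c
  · rw [HC.of_mul_false]; simp [strandProd]
  · rw [HC.of_mul_true]; simp [strandProd]

lemma of_upper_mul (hγ : Function.Bijective (antipode k : A →ₗ[k] A)) (c : Bool)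
    (f g : Module.Dual k A) :
    HC.of k A c (upper k A ⟨c, false⟩ f) * HC.of k A c (upper k A ⟨c, false⟩ g) =
      HC.of k A c (upper k A ⟨c, false⟩ (dmul k A f g)) := by
  rw [← strandProd_upper hγ]
  cases c
  · rw [HC.of_mul_false]; simp [strandProd]
  · rw [HC.of_mul_true]; simp [strandProd]

omit [Fintype ι] in
lemma lowerE_eq (c : Bool) (a : ι) :
    lowerE e c a = HC.of k A c (lower k A ⟨c, false⟩ (e a)) := by
  cases c <;> simp [lowerE, lower, Pt.twist, iota_apply]

omit [Fintype ι] in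
lemma upperE_eq (c : Bool) (a : ι) :
    upperE e c a = HC.of k A c (upper k A ⟨c, false⟩ (e.coord a)) := by
  cases c <;> simp [upperE, upper, Pt.twist, kappa_apply]

/-- The tensor `∑ T(e_a) ⊗ e^a`, with the labels of strands directed downwards. -/
noncomputable def twistedTensor (c c' : Bool) (T : A →ₗ[k] A) : HC k A c ⊗[k] HC k A c' :=
  ∑ a, HC.of k A c (lower k A ⟨c, false⟩ (T (e a))) ⊗ₜ
    HC.of k A c' (upper k A ⟨c', false⟩ (e.coord a))

/-- The bilinear map which labels two strands directed downwards. -/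
noncomputable def labelMap (c c' : Bool) :
    A →ₗ[k] Module.Dual k A →ₗ[k] HC k A c ⊗[k] HC k A c' :=
  (TensorProduct.mk k (HC k A c) (HC k A c')).compl₁₂
    ((HC.of k A c).toLinearMap ∘ₗ lower k A ⟨c, false⟩)
    ((HC.of k A c').toLinearMap ∘ₗ upper k A ⟨c', false⟩)

variable (hγ : Function.Bijective (antipode k : A →ₗ[k] A))
include hγ

lemma twistedTensor_mul (c c' : Bool) (T T' : A →ₗ[k] A) :
    twistedTensor e c c' T * twistedTensor e c c' T' =
      ∑ i, ∑ j, labelMap c c' (T (e i) * T' (e j)) (dmul k A (e.coord i) (e.coord j)) := by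
  rw [twistedTensor, twistedTensor, Finset.sum_mul_sum]
  refine Finset.sum_congr rfl fun i _ => Finset.sum_congr rfl fun j _ => ?_
  rw [Algebra.TensorProduct.tmul_mul_tmul, of_lower_mul, of_upper_mul hγ]
  rfl

lemma labelMap_one (c c' : Bool) : labelMap c c' (1 : A) (counit : Module.Dual k A) = 1 := by
  simp only [labelMap, LinearMap.compl₁₂_apply, LinearMap.comp_apply, lower_one,
    upper_counit _ hγ, LinearEquiv.coe_coe, HC.of_one]
  rfl

/-- Labelling is multiplicative on both legs and respects the units, so it carries the inverse `∑
γ(e_a) ⊗ e^a` of the canonical element to the inverse of each of the four tensors. -/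
lemma inverse_STensor (c c' : Bool) :
    Ring.inverse (STensor e c c') = twistedTensor e c c' (gam k A) := by
  have h : STensor e c c' = twistedTensor e c c' LinearMap.id := by
    simp [STensor, twistedTensor, lowerE_eq, upperE_eq]
  have h1 : twistedTensor e c c' LinearMap.id * twistedTensor e c c' (gam k A) = 1 := by
    rw [twistedTensor_mul e hγ, ← labelMap_one hγ]
    exact sum_inverse_right e (labelMap c c')
  have h2 : twistedTensor e c c' (gam k A) * twistedTensor e c c' LinearMap.id = 1 := by
    rw [twistedTensor_mul e hγ, ← labelMap_one hγ]
    exact sum_inverse_left e (labelMap c c')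
  rw [h]
  exact Ring.inverse_unit ⟨_, _, h1, h2⟩

omit hγ in
lemma gamH_lower (c up : Bool) (x : A) :
    (if up then gamH k A c else LinearMap.id) (HC.of k A c (lower k A ⟨c, false⟩ x)) =
      HC.of k A c (lower k A ⟨c, up⟩ x) := by
  cases up
  · simp
  · have h (y : A) : (LinearMap.lTensor (Module.Dual k A) (gam k A) :
      Heis k A →ₗ[k] Heis k A) (iota y) = iota (gam k A y) := rfl
    change HC.of k A c ((LinearMap.lTensor (Module.Dual k A) (gam k A) :
      Heis k A →ₗ[k] Heis k A) ((HC.of k A c).symm (HC.of k A c (iota _)))) = _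
    rw [LinearEquiv.symm_apply_apply, h]
    simp [lower, Pt.twist, pow_succ']

omit hγ in
lemma gamBarH_upper (c up : Bool) (f : Module.Dual k A) :
    (if up then gamBarH k A c else LinearMap.id) (HC.of k A c (upper k A ⟨c, false⟩ f)) =
      HC.of k A c (upper k A ⟨c, up⟩ f) := by
  cases up
  · simp
  · have h (f : Module.Dual k A) : (LinearMap.rTensor A (gamBar k A).dualMap :
      Heis k A →ₗ[k] Heis k A) (kappa f) = kappa ((gamBar k A).dualMap f) := rfl
    change HC.of k A c ((LinearMap.rTensor A (gamBar k A).dualMap :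
      Heis k A →ₗ[k] Heis k A) ((HC.of k A c).symm (HC.of k A c (kappa _)))) = _
    rw [LinearEquiv.symm_apply_apply, h]
    simp [upper, Pt.twist, pow_succ']

/-- The element of `A` on the under-strand of a crossing. -/
noncomputable def signedBasis (s : Bool) (a : ι) : A := if s then e a else gam k A (e a)

/-- The maps applied on upward strands only add one to the twist, and the kind of the crossing only
decides between `e_a` and `γ(e_a)`. All labels thus become one sum over a single index `a`. -/
lemma crossLabel_eq (s c up c' up' : Bool) :
    crossLabel e s c up c' up' = ∑ a, HC.of k A c (lower k A ⟨c, up⟩ (signedBasis e s a)) ⊗ₜ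
      HC.of k A c' (upper k A ⟨c', up'⟩ (e.coord a)) := by
  have h : (if s then STensor e c c' else Ring.inverse (STensor e c c')) =
      ∑ a, HC.of k A c (lower k A ⟨c, false⟩ (signedBasis e s a)) ⊗ₜ
        HC.of k A c' (upper k A ⟨c', false⟩ (e.coord a)) := by
    cases s
    · simp only [Bool.false_eq_true, if_false, inverse_STensor e hγ, twistedTensor, signedBasis]
    · simp [STensor, lowerE_eq, upperE_eq, signedBasis]
  rw [crossLabel, h, map_sum]
  refine Finset.sum_congr rfl fun a _ => ?_
  rw [TensorProduct.map_tmul, gamH_lower, gamBarH_upper]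

end CrossLabel

/-! ### Algebraic identities behind the Pachner and (0,2) moves -/

section MoveIdentities

variable {k A : Type*} [Field k] [Ring A] [HopfAlgebra k A] {ι : Type*} [Fintype ι]
  (e : Module.Basis ι k A) {W : Type*} [AddCommGroup W] [Module k W]

open Coalgebra HopfAlgebra

/-- The label of the strand from top left to bottom right of a crossing. -/
noncomputable def leftLabel (s : Bool) (P : Pt) (x : ι) : Heis k A :=
  if s then lower k A P (signedBasis e s x) else upper k A P (e.coord x)

/-- The label of the strand from top right to bottom left of a crossing. -/
noncomputable def rightLabel (s : Bool) (P : Pt) (x : ι) : Heis k A :=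
  if s then upper k A P (e.coord x) else lower k A P (signedBasis e s x)

/-- The square of the antipode acts trivially on the labels of a middle strand for which the
Pachner move is excluded. -/
lemma lower_eq_iota (hγ : Function.Bijective (antipode k : A →ₗ[k] A)) {P : Pt}
    (h : P.thick = P.up) (h2 : P.up = true → ∀ a : A, antipode k (antipode k a) = a) :
    lower k A P = iota ∧ upper k A P = kappa := by
  rcases P with ⟨_ | _, _ | _⟩
  · simp [lower, upper, Pt.twist, Module.End.one_eq_id]
  · simp at h
  · simp at h
  · have h2 := h2 rfl
    have h1 (x : A) : gam k A (gam k A x) = x := h2 x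
    have h3 (x : A) : gamBar k A (gamBar k A x) = x := by
      apply hγ.1
      apply hγ.1
      exact ((congrArg _ (gam_gamBar hγ _)).trans (gam_gamBar hγ x)).trans (h2 x).symm
    constructor
    · ext x; simp [lower, Pt.twist, pow_two, h1]
    · ext x : 1
      have : (gamBar k A).dualMap ((gamBar k A).dualMap x) = x := by ext y; simp [h3]
      simp [upper, Pt.twist, pow_two, this]

lemma lower_eq_iota_gam {P : Pt} (h : P.thick ≠ P.up) :
    lower k A P = iota ∘ₗ gam k A ∧ upper k A P = kappa ∘ₗ (gamBar k A).dualMap := by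
  rcases P with ⟨_ | _, _ | _⟩ <;> simp_all [lower, upper, Pt.twist]

variable (hγ : Function.Bijective (antipode k : A →ₗ[k] A))
include hγ

/-- On each outer strand both labels are of the same type and merge into one, so the colours and
directions of `a` and `c` can be absorbed into the test map. The twist of the middle strand is even
and acts trivially. What is left is `pentagon` for the positive kind and `pentagon_inverse` for the
negative one. -/
lemma pachner₁_identity (G : Heis k A →ₗ[k] Heis k A →ₗ[k] Heis k A →ₗ[k] W) (s : Bool)
    (a b c : Pt) (h : b.thick = b.up)
    (h2 : b.up = true → ∀ a : A, antipode k (antipode k a) = a) :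
    ∑ x, ∑ y, ∑ z, G (strandProd a [leftLabel e s a y, leftLabel e s a z])
        (strandProd b [leftLabel e s b x, rightLabel e s b z])
        (strandProd c [rightLabel e s c x, rightLabel e s c y]) =
      ∑ x, ∑ z, G (strandProd a [leftLabel e s a x])
        (strandProd b [rightLabel e s b x, leftLabel e s b z])
        (strandProd c [rightLabel e s c z]) := by
  obtain ⟨hl, hu⟩ := lower_eq_iota hγ h h2
  cases s
  · simp only [leftLabel, rightLabel, Bool.false_eq_true, if_false, signedBasis,
      strandProd_lower, strandProd_upper hγ, strandProd_singleton, hl, hu]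
    simp only [strandProd, h, if_true, List.reverse_cons, List.reverse_nil, List.nil_append,
      List.cons_append, List.prod_cons, List.prod_nil, mul_one]
    have := pentagon_inverse e ((G.compr₂ ((LinearMap.lcomp k W (lower k A c)))) ∘ₗ upper k A a)
    simp only [LinearMap.comp_apply, LinearMap.compr₂_apply, LinearMap.lcomp_apply] at this
    rw [← this, Finset.sum_congr rfl fun _ _ => Finset.sum_comm, Finset.sum_comm]
    exact Finset.sum_congr rfl fun _ _ => Finset.sum_comm
  · simp only [leftLabel, rightLabel, if_true, signedBasis,
      strandProd_lower, strandProd_upper hγ, strandProd_singleton, hl, hu]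
    simp only [strandProd, h, if_true, List.reverse_cons, List.reverse_nil, List.nil_append,
      List.cons_append, List.prod_cons, List.prod_nil, mul_one]
    have := pentagon e ((G.compr₂ ((LinearMap.lcomp k W (upper k A c)))) ∘ₗ lower k A a)
    simp only [LinearMap.comp_apply, LinearMap.compr₂_apply, LinearMap.lcomp_apply] at this
    rw [Finset.sum_comm, this, Finset.sum_comm]

/-- The middle strand is twisted exactly once, so no square of the antipode occurs and the reversed
pentagon equations apply, with the outer strands treated as in `pachner₁_identity`. -/
lemma pachner₂_identity (G : Heis k A →ₗ[k] Heis k A →ₗ[k] Heis k A →ₗ[k] W) (s : Bool)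
    (a b c : Pt) (h : b.thick ≠ b.up) :
    ∑ x, ∑ y, ∑ z, G (strandProd a [leftLabel e s a x, leftLabel e s a y])
        (strandProd b [rightLabel e s b x, leftLabel e s b z])
        (strandProd c [rightLabel e s c y, rightLabel e s c z]) =
      ∑ x, ∑ z, G (strandProd a [leftLabel e s a z])
        (strandProd b [leftLabel e s b x, rightLabel e s b z])
        (strandProd c [rightLabel e s c x]) := by
  obtain ⟨hl, hu⟩ := lower_eq_iota_gam (k := k) (A := A) h
  cases s
  · simp only [leftLabel, rightLabel, Bool.false_eq_true, if_false, signedBasis,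
      strandProd_lower, strandProd_upper hγ, strandProd_singleton, hl, hu]
    simp only [strandProd, h, if_false, List.prod_cons, List.prod_nil, mul_one]
    have := pentagon_reversed_inverse e hγ
      ((G.compr₂ ((LinearMap.lcomp k W (lower k A c)))) ∘ₗ upper k A a)
    simp only [LinearMap.comp_apply, LinearMap.compr₂_apply, LinearMap.lcomp_apply] at this ⊢
    rw [Finset.sum_comm, this, Finset.sum_comm]
  · simp only [leftLabel, rightLabel, if_true, signedBasis,
      strandProd_lower, strandProd_upper hγ, strandProd_singleton, hl, hu]
    simp only [strandProd, h, if_false, List.prod_cons, List.prod_nil, mul_one]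
    have := pentagon_reversed e hγ
      ((G.compr₂ ((LinearMap.lcomp k W (upper k A c)))) ∘ₗ lower k A a)
    simp only [LinearMap.comp_apply, LinearMap.compr₂_apply, LinearMap.lcomp_apply] at this ⊢
    rw [← this, Finset.sum_comm, Finset.sum_congr rfl fun _ _ => Finset.sum_comm, Finset.sum_comm]

/-- The same strand is below at both crossings: `a` if `s` holds, and `b` otherwise. Hence the
labels merge on both strands, and the canonical element meets its inverse. -/
lemma zeroTwo_identity (G : Heis k A →ₗ[k] Heis k A →ₗ[k] W) (s : Bool) (a b : Pt) :
    ∑ x, ∑ y, G (strandProd a [leftLabel e s a x, rightLabel e (!s) a y])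
        (strandProd b [rightLabel e s b x, leftLabel e (!s) b y]) = G 1 1 := by
  cases s
  · simp only [leftLabel, rightLabel, Bool.false_eq_true, if_false, signedBasis, Bool.not_false,
      if_true, strandProd_lower, strandProd_upper hγ]
    have := sum_inverse_right e (G.flip.compl₁₂ (lower k A b) (upper k A a))
    simp only [LinearMap.compl₁₂_apply, LinearMap.flip_apply, lower_one, upper_counit _ hγ] at this
    rw [Finset.sum_comm, ← this]
  · simp only [leftLabel, rightLabel, Bool.false_eq_true, if_false, signedBasis, Bool.not_true,
      if_true, strandProd_lower, strandProd_upper hγ]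
    have := sum_inverse_left e (G.compl₁₂ (lower k A a) (upper k A b))
    simp only [LinearMap.compl₁₂_apply, lower_one, upper_counit _ hγ] at this
    rw [Finset.sum_comm, ← this]

end MoveIdentities

/-! ### Orbits of partial injections -/

section Orbits

variable {N : Type*} {f : N → Option N}

/-- A complete orbit of a partial map, listed from the starting point `x`. -/
structure IsOrbit (f : N → Option N) (x : N) (l : List N) : Prop where
  chain : (x :: l).IsChain (fun a b => f a = some b)
  not_mem : x ∉ l
  ends : (f ((x :: l).getLast (List.cons_ne_nil _ _)) = none ∧ ∀ y, f y ≠ some x) ∨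
    f ((x :: l).getLast (List.cons_ne_nil _ _)) = some x

/-- A partial map which is injective where it is defined. -/
def PInj (f : N → Option N) : Prop := ∀ a b c, f a = some c → f b = some c → a = b

lemma chain_next {l : List N} (h : l.IsChain (fun a b => f a = some b)) {y : N} (hy : y ∈ l) :
    some y = l.getLast? ∨ ∃ z ∈ l.tail, f y = some z := by
  induction l with
  | nil => simp at hy
  | cons a l ih =>
    cases l with
    | nil => simp at hy; simp [hy]
    | cons b l =>
      rw [List.isChain_cons_cons] at h
      rcases List.mem_cons.1 hy with rfl | hy
      · exact Or.inr ⟨b, by simp, h.1⟩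
      · rcases ih h.2 hy with h' | ⟨z, hz, h'⟩
        · left; rw [h']; simp
        · exact Or.inr ⟨z, by simp at hz ⊢; exact Or.inr hz, h'⟩

lemma chain_prev {x : N} {l : List N} (h : (x :: l).IsChain (fun a b => f a = some b)) {y : N}
    (hy : y ∈ l) : ∃ z ∈ x :: l, f z = some y := by
  induction l generalizing x with
  | nil => simp at hy
  | cons a l ih =>
    rw [List.isChain_cons_cons] at h
    rcases List.mem_cons.1 hy with rfl | hy
    · exact ⟨x, by simp, h.1⟩
    · obtain ⟨z, hz, h'⟩ := ih h.2 hy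
      exact ⟨z, List.mem_cons_of_mem _ hz, h'⟩

/-- By injectivity a repetition can be pulled back along the chain until it involves the starting
point, which is not in the tail. -/
lemma chain_nodup (hf : PInj f) {x : N} {l : List N}
    (h : (x :: l).IsChain (fun a b => f a = some b)) (hx : x ∉ l) : (x :: l).Nodup := by
  rw [List.Nodup, List.pairwise_iff_getElem]
  rw [List.isChain_iff_getElem] at h
  intro i
  induction i with
  | zero =>
    intro j hi hj hij heq
    obtain ⟨j, rfl⟩ : ∃ m, j = m + 1 := ⟨j - 1, by omega⟩
    apply hx
    simp only [List.getElem_cons_zero, List.getElem_cons_succ] at heq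
    rw [heq]
    exact List.getElem_mem _
  | succ i ih =>
    intro j hi hj hij heq
    obtain ⟨j, rfl⟩ : ∃ m, j = m + 1 := ⟨j - 1, by omega⟩
    refine ih j (by omega) (by omega) (by omega) (hf _ _ _ (h i (by omega)) ?_)
    rw [heq]
    exact h j (by omega)

namespace IsOrbit

variable {x : N} {l : List N}

lemma nodup (hf : PInj f) (h : IsOrbit f x l) : (x :: l).Nodup := chain_nodup hf h.chain h.not_mem

lemma mem_next (h : IsOrbit f x l) {y z : N} (hy : y ∈ x :: l) (hz : f y = some z) :
    z ∈ x :: l := by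
  rcases chain_next h.chain hy with h' | ⟨w, hw, h'⟩
  · rw [List.getLast?_eq_getLast_of_ne_nil (List.cons_ne_nil _ _), Option.some_inj] at h'
    rw [h'] at hz
    rcases h.ends with h1 | h1
    · rw [h1.1] at hz; simp at hz
    · rw [h1, Option.some_inj] at hz; simp [hz]
  · rw [hz, Option.some_inj] at h'
    exact List.mem_cons_of_mem _ (h' ▸ hw)

lemma mem_prev (hf : PInj f) (h : IsOrbit f x l) {y z : N} (hy : y ∈ x :: l) (hz : f z = some y) :
    z ∈ x :: l := by
  rcases List.mem_cons.1 hy with rfl | hy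
  · rcases h.ends with h1 | h1
    · exact absurd hz (h1.2 z)
    · rw [hf _ _ _ hz h1]; exact List.getLast_mem _
  · obtain ⟨w, hw, h'⟩ := chain_prev h.chain hy
    rwa [hf _ _ _ hz h']

lemma mem_connected (hf : PInj f) (h : IsOrbit f x l) {y z : N}
    (hyz : Relation.EqvGen (fun a b => f a = some b) y z) : y ∈ x :: l ↔ z ∈ x :: l := by
  induction hyz with
  | rel a b hab => exact ⟨fun ha => h.mem_next ha hab, fun hb => h.mem_prev hf hb hab⟩
  | refl => rfl
  | symm _ _ _ ih => exact ih.symm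
  | trans _ _ _ _ _ ih ih' => exact ih.trans ih'

/-- A closed orbit can be listed from any of its elements. -/
lemma rotate (hf : PInj f) (h : IsOrbit f x l)
    (hclosed : f ((x :: l).getLast (List.cons_ne_nil _ _)) = some x) {y : N} (hy : y ∈ x :: l) :
    ∃ l', IsOrbit f y l' ∧ (x :: l) ~r (y :: l') := by
  rcases List.mem_cons.1 hy with rfl | hy
  · exact ⟨l, h, List.IsRotated.refl _⟩
  · obtain ⟨u, v, rfl⟩ := List.append_of_mem hy
    have hn := h.nodup hf
    have hc := h.chain
    rw [← List.cons_append, List.isChain_append] at hc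
    refine ⟨v ++ x :: u, ⟨?_, ?_, ?_⟩, ?_⟩
    · rw [← List.cons_append, List.isChain_append]
      refine ⟨hc.2.1, hc.1, fun a ha b hb => ?_⟩
      simp only [List.head?_cons, Option.mem_some_iff] at hb
      subst hb
      rw [← hclosed]
      congr 1
      have : (x :: (u ++ y :: v)).getLast? = some a := by
        rw [← List.cons_append, List.getLast?_append]
        simp [Option.mem_def.1 ha]
      rw [List.getLast?_eq_getLast_of_ne_nil (List.cons_ne_nil _ _), Option.some_inj] at this
      exact this.symm
    · intro hm
      simp only [List.nodup_cons, List.mem_append, List.mem_cons, List.nodup_append] at hn hm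
      grind
    · right
      have h2 := hc.2.2 ((x :: u).getLast (List.cons_ne_nil _ _))
        (by rw [List.getLast?_eq_getLast_of_ne_nil (List.cons_ne_nil _ _)]; rfl) y (by simp)
      rw [← h2]
      congr 1
      rw [List.getLast_cons (by simp), List.getLast_append_of_ne_nil _ (List.cons_ne_nil _ _)]
    · have := List.isRotated_append (l := x :: u) (l' := y :: v)
      simpa using this

end IsOrbit

/-- A chain through `y` without repetitions which is not yet a complete orbit can be prolonged: at
its head if the map stops at its end, and at its end otherwise. Finiteness bounds the length of such
chains. -/
lemma exists_orbit [Finite N] (hf : PInj f) (y : N) :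
    ∃ x l, IsOrbit f x l ∧ y ∈ x :: l := by
  by_contra hno
  push Not at hno
  have hlong : ∀ n : ℕ, ∃ x l, (x :: l).IsChain (fun a b => f a = some b) ∧ (x :: l).Nodup ∧
      y ∈ x :: l ∧ n ≤ (x :: l).length := by
    intro n
    induction n with
    | zero => exact ⟨y, [], by simp, by simp, by simp, by simp⟩
    | succ n ih =>
      obtain ⟨x, l, hc, hn, hy, hl⟩ := ih
      by_contra hcon
      refine hno x l ⟨hc, (List.nodup_cons.1 hn).1, ?_⟩ hy
      rcases hlast : f ((x :: l).getLast (List.cons_ne_nil _ _)) with _ | z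
      · refine Or.inl ⟨rfl, fun w hw => hcon ?_⟩
        have hwl : w ∉ x :: l := by
          intro hm
          rcases chain_next hc hm with h' | ⟨z, hz, h'⟩
          · rw [List.getLast?_eq_getLast_of_ne_nil (List.cons_ne_nil _ _), Option.some_inj] at h'
            rw [← h', hw] at hlast; simp at hlast
          · rw [hw, Option.some_inj] at h'
            exact (List.nodup_cons.1 hn).1 (h' ▸ hz)
        exact ⟨w, x :: l, by rw [List.isChain_cons_cons]; exact ⟨hw, hc⟩,
          List.nodup_cons.2 ⟨hwl, hn⟩, List.mem_cons_of_mem _ hy, by simp at hl ⊢; omega⟩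
      · right
        rw [Option.some_inj]
        by_contra hzx
        -- A return to a point of the tail would give this point two predecessors, one of which is
        -- the last point; the other one lies before it in the chain.
        have hzl : z ∉ x :: l := by
          intro hm
          rcases List.mem_cons.1 hm with h' | hm
          · exact hzx h'
          · obtain ⟨p, q, rfl⟩ := List.append_of_mem hm
            rw [← List.cons_append, List.isChain_append] at hc
            have h2 := hc.2.2 ((x :: p).getLast (List.cons_ne_nil _ _))
              (by rw [List.getLast?_eq_getLast_of_ne_nil (List.cons_ne_nil _ _)]; rfl) z (by simp)
            have h3 := hf _ _ _ h2 hlast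
            rw [← List.cons_append, List.nodup_append] at hn
            refine hn.2.2 _ (List.getLast_mem (List.cons_ne_nil x p)) _
              (List.getLast_mem (List.cons_ne_nil z q)) ?_
            rw [h3, List.getLast_cons (by simp), List.getLast_append_of_ne_nil _ (by simp)]
        refine hcon ⟨x, l ++ [z], ?_, ?_, by simp at hy ⊢; tauto, by simp at hl ⊢; omega⟩
        · rw [← List.cons_append, List.isChain_append]
          refine ⟨hc, by simp, fun a ha b hb => ?_⟩
          rw [List.getLast?_eq_getLast_of_ne_nil (List.cons_ne_nil _ _)] at ha
          simp only [List.head?_cons, Option.mem_def, Option.some_inj] at ha hb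
          rw [← ha, hlast, hb]
        · rw [← List.cons_append, List.nodup_append]
          refine ⟨hn, by simp, fun a ha b hb => ?_⟩
          simp only [List.mem_singleton] at hb
          rintro rfl
          exact hzl (hb ▸ ha)
  have := Fintype.ofFinite N
  obtain ⟨x, l, _, hn, _, hl⟩ := hlong (Fintype.card N + 1)
  exact absurd (hn.length_le_card) (by omega)

/-- A partial map `f` on `N` arises from a partial map `g` on `O` by replacing every element of `O`
by a chain of elements of `N`. -/
structure IsExpansion {O : Type*} (g : O → Option O) (f : N → Option N) (hd : O → N)
    (tl : O → List N) : Prop where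
  chain : ∀ o, (hd o :: tl o).IsChain (fun a b => f a = some b)
  last : ∀ o, f ((hd o :: tl o).getLast (List.cons_ne_nil _ _)) = (g o).map hd
  inj : Function.Injective hd
  tail : ∀ o o', hd o ∉ tl o'
  cover : ∀ o y, f y = some (hd o) → ∃ o', y ∈ hd o' :: tl o'

namespace IsExpansion

variable {O : Type*} {g : O → Option O} {hd : O → N} {tl : O → List N}

lemma getLast_expand (o : O) (l : List O) :
    (hd o :: (tl o ++ l.flatMap fun o => hd o :: tl o)).getLast (List.cons_ne_nil _ _) =
      (hd ((o :: l).getLast (List.cons_ne_nil _ _)) ::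
        tl ((o :: l).getLast (List.cons_ne_nil _ _))).getLast (List.cons_ne_nil _ _) := by
  induction l generalizing o with
  | nil => simp
  | cons a l ih =>
    have := ih a
    rw [List.getLast_cons (by simp), List.getLast_append_of_ne_nil _ (by simp)]
    simp only [List.flatMap_cons, List.cons_append]
    rw [this]
    simp

lemma expand_chain (h : IsExpansion g f hd tl) (o : O) (l : List O)
    (hl : (o :: l).IsChain (fun a b => g a = some b)) :
    (hd o :: (tl o ++ l.flatMap fun o => hd o :: tl o)).IsChain (fun a b => f a = some b) := by
  induction l generalizing o with
  | nil => simpa using h.chain o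
  | cons a l ih =>
    rw [List.isChain_cons_cons] at hl
    rw [← List.cons_append, List.isChain_append]
    refine ⟨h.chain o, ?_, fun x hx y hy => ?_⟩
    · simpa using ih a hl.2
    · rw [List.getLast?_eq_getLast_of_ne_nil (List.cons_ne_nil _ _)] at hx
      simp only [List.flatMap_cons, List.cons_append, List.head?_cons, Option.mem_def,
        Option.some_inj] at hx hy
      rw [← hx, h.last, hl.1, ← hy]
      rfl

/-- The field `last` makes consecutive chains fit together. For open orbits `cover` is essential: a
predecessor of the first point would be in some chain, necessarily at its end, and so would come
from a predecessor under `g`. -/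
lemma isOrbit (h : IsExpansion g f hd tl) {o : O} {l : List O}
    (ho : IsOrbit g o l) : IsOrbit f (hd o) (tl o ++ l.flatMap fun o => hd o :: tl o) := by
  refine ⟨h.expand_chain o l ho.chain, ?_, ?_⟩
  · intro hm
    simp only [List.mem_append, List.mem_flatMap, List.mem_cons] at hm
    rcases hm with hm | ⟨o', ho', hm | hm⟩
    · exact h.tail _ _ hm
    · exact ho.not_mem (h.inj hm ▸ ho')
    · exact h.tail _ _ hm
  · rw [getLast_expand, h.last]
    rcases ho.ends with h1 | h1
    · left
      rw [h1.1]
      refine ⟨rfl, fun y hy => ?_⟩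
      obtain ⟨o', ho'⟩ := h.cover o y hy
      rcases chain_next (h.chain o') ho' with h2 | ⟨z, hz, h2⟩
      · rw [List.getLast?_eq_getLast_of_ne_nil (List.cons_ne_nil _ _), Option.some_inj] at h2
        rw [h2, h.last, Option.map_eq_some_iff] at hy
        obtain ⟨o₂, h3, h4⟩ := hy
        exact h1.2 o' (h.inj h4 ▸ h3)
      · rw [hy, Option.some_inj] at h2
        exact h.tail o o' (by rw [h2]; exact hz)
    · right
      rw [h1]
      rfl

end IsExpansion

end Orbits

/-! ### Words of labels and multilinearity -/

section Words

variable {k A : Type*} [Field k] [Ring A] [HopfAlgebra k A]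

/-- The product of labels which are listed in the order of the orientation, read against the
orientation. -/
noncomputable def evalWord (c : Bool) (l : List (Heis k A)) : HC k A c :=
  (l.reverse.map (HC.of k A c)).prod

@[simp] lemma evalWord_nil (c : Bool) : evalWord c ([] : List (Heis k A)) = 1 := by
  simp [evalWord]

lemma evalWord_append (c : Bool) (l l' : List (Heis k A)) :
    evalWord c (l ++ l') = evalWord c l' * evalWord c l := by
  simp [evalWord]

lemma evalWord_cons (c : Bool) (x : Heis k A) (l : List (Heis k A)) :
    evalWord c (x :: l) = evalWord c l * HC.of k A c x := by
  simp [evalWord]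

/-- The reading convention, an upward direction and the opposite multiplication each reverse the
order; `strandProd` records the net effect in `H(A)`. -/
lemma evalWord_orient (P : Pt) (l : List (Heis k A)) :
    evalWord P.thick (if P.up then l.reverse else l) = HC.of k A P.thick (strandProd P l) := by
  have h0 (l : List (Heis k A)) :
      (l.map (HC.of k A false)).prod = HC.of k A false l.prod := by
    induction l with
    | nil => simp [HC.of_one]
    | cons a l ih => rw [List.map_cons, List.prod_cons, ih, HC.of_mul_false, List.prod_cons]
  have h1 (l : List (Heis k A)) :
      (l.map (HC.of k A true)).prod = HC.of k A true l.reverse.prod := by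
    induction l with
    | nil => simp [HC.of_one]
    | cons a l ih => rw [List.map_cons, List.prod_cons, ih, HC.of_mul_true]; simp
  rcases P with ⟨_ | _, _ | _⟩ <;> simp [evalWord, strandProd, h0, h1, -List.map_reverse]

variable {n : ℕ} (μ ν : Fin n → Bool) {T : Type*}

/-- The tensor of the products of labels along the given words. -/
noncomputable def wordTensor (os : Fin n → List T) (y : T → Heis k A) :
    ⨂[k] i, Factor k A (μ i) (ν i) :=
  PiTensorProduct.tprod k fun i =>
    Factor.proj k A (μ i) (ν i) (evalWord (μ i) ((os i).map y))

/-- Every letter occurs exactly once in the given words. -/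
structure OccursOnce (os : Fin n → List T) : Prop where
  nodup : ∀ i, (os i).Nodup
  mem : ∀ t, ∃ i, t ∈ os i
  unique : ∀ t i j, t ∈ os i → t ∈ os j → i = j

variable {μ ν}

/-- The letter `t` occurs in one word only, and only once there, so its label enters a single tensor
factor, between two fixed elements. -/
lemma wordTensor_update [DecidableEq T] {os : Fin n → List T} (hos : OccursOnce os)
    (y : T → Heis k A) (t : T) :
    ∃ Φ : Heis k A →ₗ[k] ⨂[k] i, Factor k A (μ i) (ν i),
      ∀ x, wordTensor μ ν os (Function.update y t x) = Φ x := by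
  obtain ⟨i, hi⟩ := hos.mem t
  have hn := hos.nodup i
  obtain ⟨u, v, huv⟩ := List.append_of_mem hi
  rw [huv, List.nodup_append, List.nodup_cons] at hn
  have hu : t ∉ u := fun h => hn.2.2 t h t (by simp) rfl
  have hv : t ∉ v := hn.2.1.1
  have hmap (l : List T) (hl : t ∉ l) (x : Heis k A) :
      l.map (Function.update y t x) = l.map y := by
    refine List.map_congr_left fun a ha => ?_
    rw [Function.update_of_ne]
    rintro rfl
    exact hl ha
  let φ : Heis k A →ₗ[k] Factor k A (μ i) (ν i) := Factor.proj k A (μ i) (ν i) ∘ₗ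
    LinearMap.mulRight k (evalWord (μ i) (u.map y)) ∘ₗ
    LinearMap.mulLeft k (evalWord (μ i) (v.map y)) ∘ₗ (HC.of k A (μ i)).toLinearMap
  refine ⟨(PiTensorProduct.tprod k).toLinearMap (fun j =>
    Factor.proj k A (μ j) (ν j) (evalWord (μ j) ((os j).map y))) i ∘ₗ φ, fun x => ?_⟩
  rw [wordTensor, LinearMap.comp_apply, MultilinearMap.toLinearMap_apply]
  congr 1
  funext j
  by_cases hj : j = i
  · subst hj
    rw [Function.update_self, huv]
    simp only [List.map_append, List.map_cons, Function.update_self, hmap u hu, hmap v hv,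
      evalWord_append, evalWord_cons]
    rfl
  · rw [Function.update_of_ne hj, hmap _ fun h => hj (hos.unique t j i h hi)]

variable (k A μ ν) in
/-- The tensor of the products of labels, as a multilinear map. -/
noncomputable def wordMap (os : Fin n → List T) (hos : OccursOnce os) :
    MultilinearMap k (fun _ : T => Heis k A) (⨂[k] i, Factor k A (μ i) (ν i)) where
  toFun := wordTensor μ ν os
  map_update_add' y t x x' := by
    obtain ⟨Φ, hΦ⟩ := wordTensor_update (μ := μ) (ν := ν) hos y t
    rw [hΦ, hΦ, hΦ, map_add]
  map_update_smul' y t c x := by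
    obtain ⟨Φ, hΦ⟩ := wordTensor_update (μ := μ) (ν := ν) hos y t
    rw [hΦ, hΦ, map_smul]

end Words

/-! ### From basis expansions to one index per crossing -/

section States

variable {k : Type*} [Field k] {M W : Type*} [AddCommGroup M] [Module k M] [AddCommGroup W]
  [Module k W]

/-- Expansion of the labels of all crossings in a basis. -/
lemma sum_states {C J ι : Type*} [Fintype C] [DecidableEq C] [Fintype J] [Fintype ι]
    (F : MultilinearMap k (fun _ : C × Bool => M) W) (β : Module.Basis J k M)
    (lo up : C → ι → M) (coef : C → J → J → k)
    (hcoef : ∀ c p q, coef c p q = ∑ a, β.repr (lo c a) p * β.repr (up c a) q) :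
    ∑ p : C × Bool → J, (∏ c, coef c (p (c, true)) (p (c, false))) • F (fun v => β (p v)) =
      ∑ s : C → ι, F (fun v => if v.2 then lo v.1 (s v.1) else up v.1 (s v.1)) := by
  have h (s : C → ι) : F (fun v => if v.2 then lo v.1 (s v.1) else up v.1 (s v.1)) =
      ∑ p : C × Bool → J, (∏ c, (β.repr (lo c (s c)) (p (c, true)) *
        β.repr (up c (s c)) (p (c, false)))) • F (fun v => β (p v)) := by
    have h1 (v : C × Bool) : (if v.2 then lo v.1 (s v.1) else up v.1 (s v.1)) =
        ∑ j, β.repr (if v.2 then lo v.1 (s v.1) else up v.1 (s v.1)) j • β j :=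
      (β.sum_repr _).symm
    rw [funext h1, F.map_sum]
    refine Finset.sum_congr rfl fun p _ => ?_
    rw [F.map_smul_univ, Fintype.prod_prod_type]
    simp
  rw [Finset.sum_congr rfl fun s _ => h s, Finset.sum_comm]
  refine Finset.sum_congr rfl fun p _ => ?_
  rw [← Finset.sum_smul]
  congr 1
  -- A product over the crossings of sums over `a` is a sum over the states.
  simp only [hcoef, Finset.prod_univ_sum, Fintype.piFinset_univ]

end States

section StateSum

variable {k A : Type*} [Field k] [Ring A] [HopfAlgebra k A] {ι : Type*} [Fintype ι]
  (e : Module.Basis ι k A)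

open Classical in
/-- The basis of `A^* ⊗ A`. -/
noncomputable def heisBasis : Module.Basis (ι × ι) k (Heis k A) :=
  (e.dualBasis.tensorProduct e : Module.Basis (ι × ι) k (Heis k A))

lemma HC.basis_apply (c : Bool) (p : ι × ι) :
    HC.basis e c p = HC.of k A c (heisBasis e p) := by
  exact Module.Basis.map_apply (heisBasis e) _ _

lemma HC.basis_repr (c : Bool) (x : Heis k A) :
    (HC.basis e c).repr (HC.of k A c x) = (heisBasis e).repr x := by
  change (heisBasis e).repr ((HC.of k A c).symm (HC.of k A c x)) = _
  rw [LinearEquiv.symm_apply_apply]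

lemma crossCoeff_eq (hγ : Function.Bijective (HopfAlgebra.antipode k : A →ₗ[k] A))
    (s : Bool) (P Q : Pt) (p q : ι × ι) :
    crossCoeff e s P.thick P.up Q.thick Q.up p q = ∑ a,
      (heisBasis e).repr (lower k A P (signedBasis e s a)) p *
        (heisBasis e).repr (upper k A Q (e.coord a)) q := by
  rw [crossCoeff, crossLabel_eq e hγ, map_sum, Finsupp.finsetSum_apply]
  refine Finset.sum_congr rfl fun a _ => ?_
  rw [Module.Basis.tensorProduct_repr_tmul_apply, HC.basis_repr, HC.basis_repr, smul_eq_mul,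
    mul_comm]

variable {n : ℕ} {μ ν : Fin n → Bool}

/-- By `crossLabel_eq` each label is a sum of pure tensors, so the expansion of both legs in a basis
can be undone by multilinearity. A state then chooses one index per crossing instead of two basis
elements. -/
lemma J_eq_sum (hγ : Function.Bijective (HopfAlgebra.antipode k : A →ₗ[k] A)) (Z : CD μ ν)
    (hZ : OccursOnce Z.visits) :
    Z.J e = ∑ s : Z.Crossing → ι, wordTensor μ ν Z.visits fun v =>
      if v.2 then lower k A v.1.gen.under (signedBasis e v.1.gen.positive (s v.1))
      else upper k A v.1.gen.over (e.coord (s v.1)) := by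
  rw [CD.J]
  refine Eq.trans ?_ (sum_states (wordMap k A μ ν Z.visits hZ) (heisBasis e)
    (fun c a => lower k A c.gen.under (signedBasis e c.gen.positive a))
    (fun c a => upper k A c.gen.over (e.coord a)) _
    (fun c p q => crossCoeff_eq e hγ c.gen.positive c.gen.under c.gen.over p q))
  refine Finset.sum_congr rfl fun p _ => ?_
  congr 1
  change _ = wordTensor μ ν Z.visits _
  rw [wordTensor]
  congr 1
  funext i
  rw [evalWord, ← List.map_reverse, List.map_map]
  exact congrArg _ (congrArg List.prod (List.map_congr_left fun v _ => HC.basis_apply e _ _))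

end StateSum

/-! ### Strands as orbits of `next` -/

section SliceFacts

lemma getElem?_append_two {α : Type*} (l r : List α) (a b : α) (i : ℕ) :
    (l ++ [a, b] ++ r)[i]? = if i < l.length then l[i]? else if i = l.length then some a
      else if i = l.length + 1 then some b else r[i - l.length - 2]? := by
  rw [List.append_assoc]
  by_cases h : i < l.length
  · rw [List.getElem?_append_left h, if_pos h]
  · rw [List.getElem?_append_right (by omega), if_neg h]
    by_cases h1 : i = l.length
    · simp [h1]
    · by_cases h2 : i = l.length + 1
      · simp [h2]
      · rw [if_neg h1, if_neg h2]
        obtain ⟨m, rfl⟩ : ∃ m, i = l.length + (m + 2) := ⟨i - l.length - 2, by omega⟩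
        simp only [List.cons_append, List.nil_append, add_tsub_cancel_left,
          Nat.add_sub_cancel, List.getElem?_cons_succ]

lemma getElem?_append_nil {α : Type*} (l r : List α) (i : ℕ) :
    (l ++ [] ++ r)[i]? = if i < l.length then l[i]? else r[i - l.length]? := by
  rw [List.append_nil]
  by_cases h : i < l.length
  · rw [List.getElem?_append_left h, if_pos h]
  · rw [List.getElem?_append_right (by omega), if_neg h]

lemma Pt.flip_flip (P : Pt) : P.flip.flip = P := by simp [Pt.flip]

/-- A slice matches its boundary points in pairs. The four lemmas of this form record that following
a strand is reversible, and that the direction is kept when the strand passes through (`inl`) and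
flipped when it turns (`inr`). -/
lemma Slice.down_inl (L : Slice) {i j : ℕ} (hij : L.down i = .inl j) :
    L.tgt[j]? = L.src[i]? ∧ L.up j = .inl i := by
  obtain ⟨l, g, r⟩ := L
  cases g <;> simp only [Slice.down, Slice.up, Slice.src, Slice.tgt, Gen.src, Gen.tgt,
    getElem?_append_two, getElem?_append_nil] at hij ⊢ <;> split_ifs at hij <;>
    simp only [Sum.inl.injEq] at hij <;> grind

lemma Slice.up_inl (L : Slice) {i j : ℕ} (hij : L.up i = .inl j) :
    L.src[j]? = L.tgt[i]? ∧ L.down j = .inl i := by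
  obtain ⟨l, g, r⟩ := L
  cases g <;> simp only [Slice.down, Slice.up, Slice.src, Slice.tgt, Gen.src, Gen.tgt,
    getElem?_append_two, getElem?_append_nil] at hij ⊢ <;> split_ifs at hij <;>
    simp only [Sum.inl.injEq] at hij <;> grind

lemma Slice.down_inr (L : Slice) {i j : ℕ} (hij : L.down i = .inr j) :
    L.src[j]? = (L.src[i]?).map Pt.flip ∧ L.down j = .inr i := by
  obtain ⟨l, g, r⟩ := L
  cases g <;> simp only [Slice.down, Slice.src, Gen.src,
    getElem?_append_two, getElem?_append_nil] at hij ⊢ <;> split_ifs at hij <;>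
    simp only [Sum.inr.injEq] at hij <;> grind [Pt.flip_flip]

lemma Slice.up_inr (L : Slice) {i j : ℕ} (hij : L.up i = .inr j) :
    L.tgt[j]? = (L.tgt[i]?).map Pt.flip ∧ L.up j = .inr i := by
  obtain ⟨l, g, r⟩ := L
  cases g <;> simp only [Slice.up, Slice.tgt, Gen.tgt,
    getElem?_append_two, getElem?_append_nil] at hij ⊢ <;> split_ifs at hij <;>
    simp only [Sum.inr.injEq] at hij <;> grind [Pt.flip_flip]

end SliceFacts

namespace Diagram

variable (D : Diagram)

lemma composable_src {w : List Pt} {Ls : List Slice} (h : Composable w Ls) {m : ℕ} {L : Slice}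
    (hL : Ls[m]? = some L) :
    (match m with | 0 => w | m + 1 => ((Ls[m]?).map Slice.tgt).getD []) = L.src := by
  induction Ls generalizing w m with
  | nil => simp at hL
  | cons a Ls ih =>
    cases m with
    | zero => simp at hL; subst hL; exact h.1
    | succ m =>
      simp only [List.getElem?_cons_succ] at hL
      have := ih h.2 hL
      cases m with
      | zero => simpa using this
      | succ m => simpa using this

lemma word_eq_src {h : ℕ} {L : Slice} (hL : D.slices[h]? = some L) : D.word h = L.src := by
  have := composable_src D.composable hL
  cases h <;> exact this

lemma word_succ_eq_tgt {h : ℕ} {L : Slice} (hL : D.slices[h]? = some L) :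
    D.word (h + 1) = L.tgt := by
  simp [word, hL]

/-- The strand at a point of a level. -/
def ptAt (x : ℕ × ℕ) : Option Pt := (D.word x.1)[x.2]?

lemma ptAt_isSome_iff (x : ℕ × ℕ) : (∃ P, D.ptAt x = some P) ↔ x.2 < (D.word x.1).length := by
  rw [ptAt, ← Option.isSome_iff_exists, isSome_getElem?]

lemma next_of_down {h i : ℕ} {P : Pt} (hP : D.ptAt (h, i) = some P) (hu : P.up = false) :
    D.next (h, i) = (D.slices[h]?).map fun L => match L.down i with
      | .inl j => (h + 1, j)
      | .inr j => (h, j) := by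
  obtain ⟨t, u⟩ := P
  subst hu
  simp only [ptAt] at hP
  simp only [next, hP]

lemma next_of_up {h i : ℕ} {P : Pt} (hP : D.ptAt (h + 1, i) = some P) (hu : P.up = true) :
    D.next (h + 1, i) = (D.slices[h]?).map fun L => match L.up i with
      | .inl j => (h, j)
      | .inr j => (h + 1, j) := by
  obtain ⟨t, u⟩ := P
  subst hu
  simp only [ptAt] at hP
  simp only [next, hP]

lemma next_of_up_zero {i : ℕ} {P : Pt} (hP : D.ptAt (0, i) = some P) (hu : P.up = true) :
    D.next (0, i) = none := by
  obtain ⟨t, u⟩ := P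
  subst hu
  simp only [ptAt] at hP
  simp only [next, hP]

lemma next_of_none {x : ℕ × ℕ} (hP : D.ptAt x = none) : D.next x = none := by
  obtain ⟨h, i⟩ := x
  simp only [ptAt] at hP
  simp only [next, hP]

/-- The slice through which one passes from a point to the next one. -/
lemma next_spec {x y : ℕ × ℕ} (hxy : D.next x = some y) :
    ∃ h L P P', D.slices[h]? = some L ∧ D.ptAt x = some P ∧ D.ptAt y = some P' ∧
      P'.thick = P.thick ∧ ((P.up = false ∧ x.1 = h) ∨ (P.up = true ∧ x.1 = h + 1)) ∧
      ((P'.up = false ∧ y.1 = h + 1 ∧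
          L.up y.2 = if x.1 = h then .inl x.2 else .inr x.2) ∨
        (P'.up = true ∧ y.1 = h ∧
          L.down y.2 = if x.1 = h then .inr x.2 else .inl x.2)) := by
  obtain ⟨h, i⟩ := x
  rcases hP : D.ptAt (h, i) with _ | P
  · rw [D.next_of_none hP] at hxy; simp at hxy
  · rcases hu : P.up with _ | _
    · rw [D.next_of_down hP hu, Option.map_eq_some_iff] at hxy
      obtain ⟨L, hL, hy⟩ := hxy
      have hs := D.word_eq_src hL
      have ht := D.word_succ_eq_tgt hL
      simp only [ptAt, hs] at hP
      rcases hd : L.down i with j | j <;> rw [hd] at hy <;> subst hy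
      · have := L.down_inl hd
        exact ⟨h, L, P, P, hL, rfl, by simp only [ptAt, ht, this.1, hP], rfl, by simp [hu],
          Or.inl ⟨hu, rfl, by simp [this.2]⟩⟩
      · have := L.down_inr hd
        exact ⟨h, L, P, P.flip, hL, rfl, by simp only [ptAt, hs, this.1, hP]; rfl, rfl,
          by simp [hu], Or.inr ⟨by simp [Pt.flip, hu], rfl, by simp [this.2]⟩⟩
    · cases h with
      | zero => rw [D.next_of_up_zero hP hu] at hxy; simp at hxy
      | succ h =>
        rw [D.next_of_up hP hu, Option.map_eq_some_iff] at hxy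
        obtain ⟨L, hL, hy⟩ := hxy
        have hs := D.word_eq_src hL
        have ht := D.word_succ_eq_tgt hL
        simp only [ptAt, ht] at hP
        rcases hd : L.up i with j | j <;> rw [hd] at hy <;> subst hy
        · have := L.up_inl hd
          exact ⟨h, L, P, P, hL, rfl, by simp only [ptAt, hs, this.1, hP], rfl, by simp [hu],
            Or.inr ⟨hu, rfl, by simp [this.2]⟩⟩
        · have := L.up_inr hd
          exact ⟨h, L, P, P.flip, hL, rfl, by simp only [ptAt, ht, this.1, hP]; rfl, rfl,
            by simp [hu], Or.inl ⟨by simp [Pt.flip, hu], rfl, by simp [this.2]⟩⟩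

/-- The direction of the strand at the target tells through which slice the target was reached, and
following the strand back through this slice recovers the source. -/
lemma next_pInj : PInj D.next := by
  intro a b c ha hb
  obtain ⟨h, L, P, P', hL, hP, hP', -, h1, h2⟩ := D.next_spec ha
  obtain ⟨h', L', Q, Q', hL', hQ, hQ', -, h1', h2'⟩ := D.next_spec hb
  obtain rfl : P' = Q' := by rw [← Option.some_inj, ← hP', hQ']
  have hh : h = h' := by
    rcases h2 with h2 | h2 <;> rcases h2' with h2' | h2' <;> simp_all
  subst hh
  obtain rfl : L = L' := by rw [← Option.some_inj, ← hL, hL']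
  have key : (a.1 = h ↔ b.1 = h) ∧ a.2 = b.2 := by
    rcases h2 with h2 | h2 <;> rcases h2' with h2' | h2'
    · have := h2.2.2.symm.trans h2'.2.2
      split_ifs at this with h3 h4 <;> simp_all
    · rw [h2.1] at h2'; simp at h2'
    · rw [h2.1] at h2'; simp at h2'
    · have := h2.2.2.symm.trans h2'.2.2
      split_ifs at this with h3 h4 <;> simp_all
  have h3 : a.1 = b.1 := by
    rcases h1 with h1 | h1 <;> rcases h1' with h1' | h1' <;> omega
  exact Prod.ext h3 key.2

end Diagram

/-- The strand of a crossing (`true` for under) which is met at the top of a slice. -/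
def Slice.tokDown (L : Slice) (i : ℕ) : Option Bool :=
  match L.gen with
  | .cross s _ _ => if i = L.left.length then some s else
      if i = L.left.length + 1 then some (!s) else none
  | _ => none

/-- The strand of a crossing (`true` for under) which is met at the bottom of a slice. -/
def Slice.tokUp (L : Slice) (i : ℕ) : Option Bool :=
  match L.gen with
  | .cross s _ _ => if i = L.left.length then some (!s) else
      if i = L.left.length + 1 then some s else none
  | _ => none

namespace Diagram

variable (D : Diagram)

/-- The strand of a crossing which is traversed between a point and the next one: the index of the
slice, and whether it is the under-strand. -/
def tok (x : ℕ × ℕ) : Option (ℕ × Bool) :=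
  match (D.word x.1)[x.2]?, x with
  | none, _ => none
  | some ⟨_, true⟩, (0, _) => none
  | some ⟨_, true⟩, (h + 1, i) => (D.slices[h]?).bind fun L => (L.tokUp i).map fun u => (h, u)
  | some ⟨_, false⟩, (h, i) => (D.slices[h]?).bind fun L => (L.tokDown i).map fun u => (h, u)

lemma tok_of_down {h i : ℕ} {P : Pt} (hP : D.ptAt (h, i) = some P) (hu : P.up = false) :
    D.tok (h, i) = (D.slices[h]?).bind fun L => (L.tokDown i).map fun u => (h, u) := by
  obtain ⟨t, u⟩ := P
  subst hu
  simp only [ptAt] at hP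
  simp only [tok, hP]

lemma tok_of_up {h i : ℕ} {P : Pt} (hP : D.ptAt (h + 1, i) = some P) (hu : P.up = true) :
    D.tok (h + 1, i) = (D.slices[h]?).bind fun L => (L.tokUp i).map fun u => (h, u) := by
  obtain ⟨t, u⟩ := P
  subst hu
  simp only [ptAt] at hP
  simp only [tok, hP]

lemma tok_of_up_zero {i : ℕ} {P : Pt} (hP : D.ptAt (0, i) = some P) (hu : P.up = true) :
    D.tok (0, i) = none := by
  obtain ⟨t, u⟩ := P
  subst hu
  simp only [ptAt] at hP
  simp only [tok, hP]

lemma tok_of_none {x : ℕ × ℕ} (hP : D.ptAt x = none) : D.tok x = none := by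
  obtain ⟨h, i⟩ := x
  simp only [ptAt] at hP
  simp only [tok, hP]

variable {D}

lemma Crossing.slice_eq (c : D.Crossing) : D.slices[c.1.1]? = some D.slices[c.1] :=
  List.getElem?_eq_getElem c.1.2

lemma tok_leg (c : D.Crossing) (u : Bool) :
    D.tok (c.leg u (c.strand u).up) = some (c.1.1, u) ∧
      D.ptAt (c.leg u (c.strand u).up) = some (c.strand u) := by
  have hL := c.slice_eq
  have hc := c.2
  have hs := D.word_eq_src hL
  have ht := D.word_succ_eq_tgt hL
  obtain ⟨l, g, r, hLL⟩ : ∃ l g r, D.slices[c.1] = ⟨l, g, r⟩ := ⟨_, _, _, rfl⟩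
  simp only [Fin.getElem_fin] at hLL
  simp only [Fin.getElem_fin, hLL] at hL hc hs ht
  simp only [Crossing.leg, Crossing.strand, Crossing.gen, Crossing.pos, Fin.getElem_fin, hLL]
  cases g with
  | cross s a b =>
    simp only [Gen.positive, Gen.under, Gen.over]
    simp only [Slice.src, Gen.src] at hs
    simp only [Slice.tgt, Gen.tgt] at ht
    have key : ∀ (up : Bool) (P : Pt) (i : ℕ), P.up = up →
        (D.word (c.1.1 + up.toNat))[i]? = some P →
        (up = false → (Slice.mk l (.cross s a b) r).tokDown i = some u) →
        (up = true → (Slice.mk l (.cross s a b) r).tokUp i = some u) →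
        D.tok (c.1.1 + up.toNat, i) = some (c.1.1, u) ∧ D.ptAt (c.1.1 + up.toNat, i) = some P := by
      intro up P i hu hP h1 h2
      refine ⟨?_, hP⟩
      cases up
      · refine (D.tok_of_down hP hu).trans ?_
        rw [Bool.toNat_false, add_zero, hL]
        simp [h1]
      · refine (D.tok_of_up hP hu).trans ?_
        rw [hL]
        simp [h2]
    have e0 (a b : Pt) : (l ++ [a, b] ++ r)[l.length]? = some a := by simp
    have e1 (a b : Pt) : (l ++ [a, b] ++ r)[l.length + 1]? = some b := by
      simp
    cases u <;> cases s <;> simp only [if_true, Bool.false_eq_true, if_false] <;>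
      rcases a with ⟨ta, _ | _⟩ <;> rcases b with ⟨tb, _ | _⟩ <;>
      first
      | exact key _ _ _ rfl (by simp only [Bool.toNat_false, add_zero, hs]; first | exact e0 _ _ | exact e1 _ _)
          (by simp [Slice.tokDown]) (by simp)
      | exact key _ _ _ rfl (by simp only [Bool.toNat_true, ht]; first | exact e0 _ _ | exact e1 _ _)
          (by simp) (by simp [Slice.tokUp])
  | virt a b => simp [Gen.isCross] at hc
  | mini a => simp [Gen.isCross] at hc
  | maxi a => simp [Gen.isCross] at hc

lemma exists_leg_of_tok {x : ℕ × ℕ} {h : ℕ} {u : Bool} (hx : D.tok x = some (h, u)) :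
    ∃ c : D.Crossing, c.1.1 = h ∧ x = c.leg u (c.strand u).up := by
  obtain ⟨m, i⟩ := x
  rcases hP : D.ptAt (m, i) with _ | P
  · rw [D.tok_of_none hP] at hx; simp at hx
  rcases hu : P.up with _ | _
  · rw [D.tok_of_down hP hu] at hx
    simp only [Option.bind_eq_some_iff, Option.map_eq_some_iff, Prod.mk.injEq] at hx
    obtain ⟨L, hL, u', hu', rfl, rfl⟩ := hx
    obtain ⟨hlt, hL'⟩ := List.getElem?_eq_some_iff.1 hL
    have hs := D.word_eq_src hL
    simp only [ptAt, hs] at hP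
    obtain ⟨l, g, r⟩ := L
    cases g with
    | cross s a b =>
      refine ⟨⟨⟨m, hlt⟩, by simp [hL', Gen.isCross]⟩, rfl, ?_⟩
      simp only [Slice.src, Gen.src, getElem?_append_two] at hP
      simp only [Slice.tokDown] at hu'
      simp only [Crossing.leg, Crossing.strand, Crossing.gen, Crossing.pos, hL', Fin.getElem_fin,
        Gen.positive, Gen.under, Gen.over]
      cases s <;> cases u' <;> grind
    | _ => simp [Slice.tokDown] at hu'
  · cases m with
    | zero => rw [D.tok_of_up_zero hP hu] at hx; simp at hx
    | succ m =>
    rw [D.tok_of_up hP hu] at hx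
    simp only [Option.bind_eq_some_iff, Option.map_eq_some_iff, Prod.mk.injEq] at hx
    obtain ⟨L, hL, u', hu', rfl, rfl⟩ := hx
    obtain ⟨hlt, hL'⟩ := List.getElem?_eq_some_iff.1 hL
    have hs := D.word_succ_eq_tgt hL
    simp only [ptAt, hs] at hP
    obtain ⟨l, g, r⟩ := L
    cases g with
    | cross s a b =>
      refine ⟨⟨⟨m, hlt⟩, by simp [hL', Gen.isCross]⟩, rfl, ?_⟩
      simp only [Slice.tgt, Gen.tgt, getElem?_append_two] at hP
      simp only [Slice.tokUp] at hu'
      simp only [Crossing.leg, Crossing.strand, Crossing.gen, Crossing.pos, hL', Fin.getElem_fin,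
        Gen.positive, Gen.under, Gen.over]
      cases s <;> cases u' <;> grind
    | _ => simp [Slice.tokUp] at hu'

/-- The crossing in `visit` is picked by choice, whereas `tok` reads it off from the slice and the
position. Their agreement shows that the choice is unique and makes the crossings met by explicit
strands computable. -/
lemma visit_eq_some_iff {x : ℕ × ℕ} {v : D.Crossing × Bool} :
    D.visit x = some v ↔ D.tok x = some (v.1.1.1, v.2) := by
  constructor
  · intro h
    unfold visit at h
    split_ifs at h with hx
    rw [Option.some_inj] at h
    rw [← h, ← (tok_leg _ _).1, ← hx.choose_spec]
  · intro h
    obtain ⟨c, hc, hx⟩ := exists_leg_of_tok h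
    have hx' : ∃ v : D.Crossing × Bool, x = v.1.leg v.2 (v.1.strand v.2).up := ⟨(c, v.2), hx⟩
    unfold visit
    rw [dif_pos hx', Option.some_inj]
    have := (tok_leg hx'.choose.1 hx'.choose.2).1
    rw [← hx'.choose_spec, h, Option.some_inj, Prod.mk.injEq] at this
    exact Prod.ext (Subtype.ext (Fin.ext this.1.symm)) this.2.symm

lemma visit_eq_none_iff {x : ℕ × ℕ} : D.visit x = none ↔ D.tok x = none := by
  constructor
  · intro h
    rcases ht : D.tok x with _ | ⟨m, u⟩
    · rfl
    · obtain ⟨c, rfl, -⟩ := exists_leg_of_tok ht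
      rw [(visit_eq_some_iff (v := (c, u))).2 ht] at h
      simp at h
  · intro h
    rcases hv : D.visit x with _ | v
    · rfl
    · rw [visit_eq_some_iff.1 hv] at h; simp at h

lemma visit_inj {x y : ℕ × ℕ} {v : D.Crossing × Bool} (hx : D.visit x = some v)
    (hy : D.visit y = some v) : x = y := by
  obtain ⟨c, hc, rfl⟩ := exists_leg_of_tok (visit_eq_some_iff.1 hx)
  obtain ⟨c', hc', rfl⟩ := exists_leg_of_tok (visit_eq_some_iff.1 hy)
  obtain rfl : c = c' := Subtype.ext (Fin.ext (hc.trans hc'.symm))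
  rfl

lemma trace_eq (x₀ : ℕ × ℕ) (l : List (ℕ × ℕ)) (x : ℕ × ℕ) (m : ℕ)
    (hc : (x :: l).IsChain (fun a b => D.next a = some b)) (h0 : x₀ ∉ l)
    (hl : ∀ y, D.next ((x :: l).getLast (List.cons_ne_nil _ _)) = some y → y = x₀)
    (hm : (x :: l).length ≤ m) : D.trace x₀ m x = x :: l := by
  induction l generalizing x m with
  | nil =>
    obtain ⟨m, rfl⟩ : ∃ j, m = j + 1 := ⟨m - 1, by simp at hm; omega⟩
    rw [trace]
    congr 1
    simp only [List.getLast_singleton] at hl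
    rcases hn : D.next x with _ | y
    · rfl
    · simp [hl y hn]
  | cons b l ih =>
    obtain ⟨m, rfl⟩ : ∃ j, m = j + 1 := ⟨m - 1, by simp at hm; omega⟩
    rw [List.isChain_cons_cons] at hc
    rw [trace]
    congr 1
    simp only [hc.1]
    simp only [List.mem_cons, not_or] at h0
    rw [if_neg (Ne.symm h0.1)]
    exact ih b m hc.2 h0.2 (by simpa using hl) (by simp at hm ⊢; omega)

/-- An orbit has no repetitions, so the bound `size` in `trace` is never exhausted before the orbit
has been listed. -/
lemma length_le_size (l : List (ℕ × ℕ)) (hn : l.Nodup)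
    (hl : ∀ x ∈ l, x.2 < (D.word x.1).length) : l.length ≤ D.size := by
  let S : Finset (ℕ × ℕ) := (Finset.range (D.slices.length + 1)).biUnion fun h =>
    (Finset.range (D.word h).length).image fun i => (h, i)
  have h1 : l.toFinset ⊆ S := by
    intro x hx
    have hx' := hl x (List.mem_toFinset.1 hx)
    simp only [S, Finset.mem_biUnion, Finset.mem_range, Finset.mem_image]
    refine ⟨x.1, ?_, x.2, hx', rfl⟩
    -- Beyond the last level the words are empty, by the default value in `word`.
    by_contra hcon
    obtain ⟨m, hm⟩ : ∃ m, x.1 = m + 1 := ⟨x.1 - 1, by omega⟩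
    rw [hm] at hx'
    have : D.slices[m]? = none := List.getElem?_eq_none (by omega)
    simp [word, this] at hx'
  have h2 : S.card ≤ ∑ h ∈ Finset.range (D.slices.length + 1), (D.word h).length := by
    refine Finset.card_biUnion_le.trans (Finset.sum_le_sum fun h _ => ?_)
    exact Finset.card_image_le.trans (by simp)
  have h3 (f : ℕ → ℕ) (m : ℕ) : ((List.range m).map f).sum = ∑ h ∈ Finset.range m, f h := by
    induction m with
    | zero => simp
    | succ m ih => rw [List.range_succ, Finset.sum_range_succ, ← ih]; simp
  rw [← List.toFinset_card_of_nodup hn, size, h3]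
  exact (Finset.card_le_card h1).trans h2

end Diagram

/-! ### Components, base points and orbits -/

section Rotation

variable {k A : Type*} [Field k] [Ring A] [HopfAlgebra k A]

/-- A rotation turns a product `xy` into `yx`, and the difference is a commutator. -/
lemma proj_evalWord_rotated (c : Bool) {l l' : List (Heis k A)} (h : l ~r l') :
    Factor.proj k A c true (evalWord c l) = Factor.proj k A c true (evalWord c l') := by
  obtain ⟨m, hm, rfl⟩ := List.isRotated_iff_mod.1 h
  rw [List.rotate_eq_drop_append_take hm]
  conv_lhs => rw [← List.take_append_drop m l]
  rw [evalWord_append, evalWord_append]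
  exact (Submodule.Quotient.eq _).2 (Submodule.subset_span ⟨_, _, rfl⟩)

end Rotation

namespace CD

variable {n : ℕ} {μ ν : Fin n → Bool} (Z : CD μ ν)

lemma comp_next {x y : ℕ × ℕ} (hxy : Z.next x = some y) (hx : x.2 < (Z.word x.1).length) :
    ∃ hy : y.2 < (Z.word y.1).length, Z.comp ⟨y, hy⟩ = Z.comp ⟨x, hx⟩ := by
  obtain ⟨h, L, P, P', hL, hP, hP', -⟩ := Z.toDiagram.next_spec hxy
  have hy := (Z.toDiagram.ptAt_isSome_iff y).1 ⟨P', hP'⟩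
  exact ⟨hy, ((Z.comp_eq_iff _ _).2 (.rel ⟨x, hx⟩ ⟨y, hy⟩ hxy)).symm⟩

lemma comp_chain {x : ℕ × ℕ} {l : List (ℕ × ℕ)}
    (hc : (x :: l).IsChain (fun a b => Z.next a = some b)) (hx : x.2 < (Z.word x.1).length)
    {y : ℕ × ℕ} (hy : y ∈ x :: l) :
    ∃ hy : y.2 < (Z.word y.1).length, Z.comp ⟨y, hy⟩ = Z.comp ⟨x, hx⟩ := by
  induction l generalizing x with
  | nil => simp at hy; subst hy; exact ⟨hx, rfl⟩
  | cons a l ih =>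
    rw [List.isChain_cons_cons] at hc
    rcases List.mem_cons.1 hy with rfl | hy
    · exact ⟨hx, rfl⟩
    · obtain ⟨ha, h1⟩ := Z.comp_next hc.1 hx
      obtain ⟨hy, h2⟩ := ih hc.2 ha hy
      exact ⟨hy, h2.trans h1⟩

lemma orbit_mem_iff {x : ℕ × ℕ} {l : List (ℕ × ℕ)} (h : IsOrbit Z.next x l)
    (hx : x.2 < (Z.word x.1).length) (y : Z.Node) :
    y.1 ∈ x :: l ↔ Z.comp y = Z.comp ⟨x, hx⟩ := by
  constructor
  · intro hy
    exact (Z.comp_chain h.chain hx hy).2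
  · intro hy
    have hconn := (Z.comp_eq_iff _ _).1 hy
    have key (a b : Z.Node) (hab : Z.Connected a b) :
        Relation.EqvGen (fun a b => Z.next a = some b) a.1 b.1 := by
      induction hab with
      | rel a b hab => exact .rel _ _ hab
      | refl => exact .refl _
      | symm _ _ _ ih => exact ih.symm
      | trans _ _ _ _ _ ih ih' => exact ih.trans _ _ _ ih'
    have := key _ _ hconn
    exact (h.mem_connected Z.next_pInj this).2 (by simp)

/-- On a cyclic orbit every node has a successor and a predecessor, hence a slice on both sides; a
node on the first or last level lacks one of the two. -/
lemma closed_of_orbit {x : ℕ × ℕ} {l : List (ℕ × ℕ)} (h : IsOrbit Z.next x l)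
    (hx : x.2 < (Z.word x.1).length)
    (hclosed : Z.next ((x :: l).getLast (List.cons_ne_nil _ _)) = some x) :
    ν (Z.comp ⟨x, hx⟩) = true := by
  rw [Z.closed_iff]
  intro y hy
  have hmem := (Z.orbit_mem_iff h hx y).2 hy
  obtain ⟨z, hz⟩ : ∃ z, Z.next y.1 = some z := by
    rcases chain_next h.chain hmem with h' | ⟨z, _, h'⟩
    · rw [List.getLast?_eq_getLast_of_ne_nil (List.cons_ne_nil _ _), Option.some_inj] at h'
      exact ⟨x, h' ▸ hclosed⟩
    · exact ⟨z, h'⟩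
  obtain ⟨w, hw⟩ : ∃ w, Z.next w = some y.1 := by
    rcases List.mem_cons.1 hmem with h' | h'
    · exact ⟨_, h' ▸ hclosed⟩
    · obtain ⟨w, _, hw⟩ := chain_prev h.chain h'
      exact ⟨w, hw⟩
  obtain ⟨m, L, P, P', hL, hP, hP', -, h1, h2⟩ := Z.toDiagram.next_spec hz
  obtain ⟨m', L', Q, Q', hL', hQ, hQ', -, h1', h2'⟩ := Z.toDiagram.next_spec hw
  obtain rfl : P = Q' := by rw [← Option.some_inj, ← hP, hQ']
  have hm := (List.getElem?_eq_some_iff.1 hL).1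
  have hm' := (List.getElem?_eq_some_iff.1 hL').1
  rcases h1 with ⟨h1, h3⟩ | ⟨h1, h3⟩ <;> rcases h2' with ⟨h2', h4, -⟩ | ⟨h2', h4, -⟩ <;>
    simp_all <;> omega

lemma base_spec (i : Fin n) : ∃ h : (Z.base i).2 < (Z.word (Z.base i).1).length,
    Z.comp ⟨Z.base i, h⟩ = i := by
  unfold base
  split_ifs with h
  · exact ⟨h.choose.2, h.choose_spec.1⟩
  · exact ⟨(Z.comp_surjective i).choose.2, (Z.comp_surjective i).choose_spec⟩

/-- The base point is a choice. In an open orbit only the head has no predecessor, so the base point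
is the head and the list is the same. A cyclic orbit can be listed from any of its nodes, which
merely rotates it. -/
lemma trace_base {x : ℕ × ℕ} {l : List (ℕ × ℕ)} (h : IsOrbit Z.next x l)
    (hx : x.2 < (Z.word x.1).length) {i : Fin n} (hi : Z.comp ⟨x, hx⟩ = i) :
    ∃ l', IsOrbit Z.next (Z.base i) l' ∧ Z.trace (Z.base i) Z.size (Z.base i) = Z.base i :: l' ∧
      (x :: l) ~r (Z.base i :: l') ∧ (ν i = false → x :: l = Z.base i :: l') := by
  obtain ⟨hb, hbi⟩ := Z.base_spec i
  have hmem : Z.base i ∈ x :: l := (Z.orbit_mem_iff h hx ⟨_, hb⟩).2 (hbi.trans hi.symm)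
  have hex : ∃ l', IsOrbit Z.next (Z.base i) l' ∧ (x :: l) ~r (Z.base i :: l') ∧
      (ν i = false → x :: l = Z.base i :: l') := by
    rcases h.ends with h1 | h1
    · have hbase : ∀ y : Z.Node, Z.next y.1 ≠ some (Z.base i) := by
        have hex : ∃ x : Z.Node, Z.comp x = i ∧ ∀ y : Z.Node, Z.next y.1 ≠ some x.1 :=
          ⟨⟨x, hx⟩, hi, fun y => h1.2 y.1⟩
        have : Z.base i = hex.choose.1 := by unfold base; rw [dif_pos hex]
        rw [this]
        exact hex.choose_spec.2
      have hbx : Z.base i = x := by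
        rcases List.mem_cons.1 hmem with h2 | h2
        · exact h2
        · obtain ⟨z, hz, hzb⟩ := chain_prev h.chain h2
          obtain ⟨hz', -⟩ := Z.comp_chain h.chain hx hz
          exact absurd hzb (hbase ⟨z, hz'⟩)
      rw [hbx]
      exact ⟨l, h, List.IsRotated.refl _, fun _ => rfl⟩
    · obtain ⟨l', h2, h3⟩ := h.rotate Z.next_pInj h1 hmem
      refine ⟨l', h2, h3, fun h4 => ?_⟩
      have := Z.closed_of_orbit h hx h1
      rw [hi, h4] at this
      simp at this
  obtain ⟨l', h1, h2, h3⟩ := hex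
  refine ⟨l', h1, ?_, h2, h3⟩
  refine Diagram.trace_eq _ l' _ _ h1.chain h1.not_mem (fun y hy => ?_) ?_
  · rcases h1.ends with h4 | h4
    · rw [h4.1] at hy; simp at hy
    · rw [h4, Option.some_inj] at hy; exact hy.symm
  · exact Diagram.length_le_size _ (h1.nodup Z.next_pInj) fun y hy =>
      (Z.comp_chain h1.chain hb hy).1

/-- A choice of an orbit through every component. -/
structure IsOrbitFamily (hd : Fin n → ℕ × ℕ) (tl : Fin n → List (ℕ × ℕ)) : Prop where
  orbit : ∀ i, IsOrbit Z.next (hd i) (tl i)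
  comp : ∀ i, ∃ h : (hd i).2 < (Z.word (hd i).1).length, Z.comp ⟨hd i, h⟩ = i

variable {Z} {hd : Fin n → ℕ × ℕ} {tl : Fin n → List (ℕ × ℕ)}

/-- A strand of a crossing is traversed from exactly one node, its incoming end. This node is on one
component, and the trace of this component lists it once. -/
lemma IsOrbitFamily.occursOnce (h : Z.IsOrbitFamily hd tl) : OccursOnce Z.visits := by
  have key (i : Fin n) (v : Z.Crossing × Bool) : v ∈ Z.visits i ↔
      Z.comp ⟨v.1.leg v.2 (v.1.strand v.2).up,
        (Z.toDiagram.ptAt_isSome_iff _).1 ⟨_, (Diagram.tok_leg v.1 v.2).2⟩⟩ = i := by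
    obtain ⟨hx, hi⟩ := h.comp i
    obtain ⟨l', h1, h2, -⟩ := Z.trace_base (h.orbit i) hx hi
    obtain ⟨hb, hbi⟩ := Z.base_spec i
    have hv : Z.visit (v.1.leg v.2 (v.1.strand v.2).up) = some v :=
      Diagram.visit_eq_some_iff.2 (Diagram.tok_leg v.1 v.2).1
    rw [visits, h2, List.mem_filterMap]
    constructor
    · rintro ⟨y, hy, hyv⟩
      have := Diagram.visit_inj hyv hv
      subst this
      exact ((Z.orbit_mem_iff h1 hb ⟨_, _⟩).1 hy).trans hbi
    · intro hi
      exact ⟨_, (Z.orbit_mem_iff h1 hb ⟨_, _⟩).2 (hi.trans hbi.symm), hv⟩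
  refine ⟨fun i => ?_, fun v => ⟨_, (key _ v).2 rfl⟩, fun v i j hi hj =>
    ((key i v).1 hi).symm.trans ((key j v).1 hj)⟩
  obtain ⟨hx, hi⟩ := h.comp i
  obtain ⟨l', h1, h2, -⟩ := Z.trace_base (h.orbit i) hx hi
  rw [visits, h2]
  exact (h1.nodup Z.next_pInj).filterMap fun a a' v ha ha' => Diagram.visit_inj ha ha'

end CD

/-! ### Labels at all nodes -/

section NodeLabels

variable {k A : Type*} [Field k] [Ring A] [HopfAlgebra k A] {ι : Type*}
  (e : Module.Basis ι k A)

/-- The label of a strand of an elementary diagram. -/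
noncomputable def genLabel (g : Gen) (u : Bool) (a : ι) : Heis k A :=
  if u then lower k A g.under (signedBasis e g.positive a) else upper k A g.over (e.coord a)

/-- The label of a strand of a slice, in the given state. -/
noncomputable def tokLabel (Ls : List Slice) (t : List (Option ι)) (v : ℕ × Bool) : Heis k A :=
  match Ls[v.1]?, t[v.1]? with
  | some L, some (some a) => genLabel e L.gen v.2 a
  | _, _ => 1

/-- The label of a point of a diagram, in the given state. -/
noncomputable def nodeLabel (D : Diagram) (t : List (Option ι)) (x : ℕ × ℕ) : Heis k A :=
  match D.tok x with
  | none => 1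
  | some v => tokLabel e D.slices t v

/-- The list of the labels of the slices. -/
def stateList {D : Diagram} (s : D.Crossing → ι) : List (Option ι) :=
  List.ofFn fun h : Fin D.slices.length =>
    if hc : D.slices[h].gen.isCross = true then some (s ⟨h, hc⟩) else none

variable [Fintype ι] {n : ℕ} {μ ν : Fin n → Bool}

/-- Nodes from which no crossing is traversed get the label `1`, so `J'` may be computed from all
nodes instead of the visits. Moreover any family of orbits will do: for open components the lists
agree, and for closed ones they differ by a rotation, which the quotient by commutators does not
see. -/
theorem J_eq_orbits (hγ : Function.Bijective (HopfAlgebra.antipode k : A →ₗ[k] A)) (Z : CD μ ν)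
    {hd : Fin n → ℕ × ℕ} {tl : Fin n → List (ℕ × ℕ)} (h : Z.IsOrbitFamily hd tl) :
    Z.J e = ∑ s : Z.Crossing → ι, wordTensor μ ν (fun i => hd i :: tl i)
      (nodeLabel e Z.toDiagram (stateList s)) := by
  rw [J_eq_sum e hγ Z h.occursOnce]
  refine Finset.sum_congr rfl fun s _ => ?_
  rw [wordTensor, wordTensor]
  congr 1
  funext i
  obtain ⟨hx, hi⟩ := h.comp i
  obtain ⟨l', h1, h2, h3, h4⟩ := Z.trace_base (h.orbit i) hx hi
  have hlab (l : List (ℕ × ℕ)) : evalWord (μ i) ((l.filterMap Z.visit).map fun v =>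
      if v.2 then lower k A v.1.gen.under (signedBasis e v.1.gen.positive (s v.1))
      else upper k A v.1.gen.over (e.coord (s v.1))) =
      evalWord (μ i) (l.map (nodeLabel e Z.toDiagram (stateList s))) := by
    induction l with
    | nil => rfl
    | cons x l ih =>
      rw [List.map_cons, evalWord_cons, ← ih]
      rcases hv : Z.visit x with _ | v
      · rw [List.filterMap_cons_none hv]
        have ht := Diagram.visit_eq_none_iff.1 hv
        simp only [nodeLabel, ht, HC.of_one, mul_one]
      · rw [List.filterMap_cons_some hv, List.map_cons, evalWord_cons]
        have ht := Diagram.visit_eq_some_iff.1 hv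
        have hs := v.1.slice_eq
        have hst : (stateList s)[v.1.1.1]? = some (some (s v.1)) := by
          rw [stateList, List.getElem?_ofFn, dif_pos v.1.1.2]
          simp only [Option.some_inj]
          exact dif_pos v.1.2
        simp only [nodeLabel, ht, tokLabel, hs, hst]
        rfl
  rw [CD.visits, h2, hlab]
  rcases hν : ν i with _ | _
  · rw [h4 hν]
  · exact proj_evalWord_rotated _ (h3.symm.map _)

end NodeLabels

/-! ### Sums over states, slice by slice -/

section StateSums

variable {ι : Type*} [Fintype ι] {W : Type*} [AddCommMonoid W]

/-- The sum over all states of a list of slices. -/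
def stateSum : List Slice → (List (Option ι) → W) → W
  | [], G => G []
  | L :: Ls, G =>
    if L.gen.isCross then ∑ a, stateSum Ls fun t => G (some a :: t)
    else stateSum Ls fun t => G (none :: t)

lemma stateSum_append (Ls Ls' : List Slice) (G : List (Option ι) → W) :
    stateSum (Ls ++ Ls') G = stateSum Ls fun t => stateSum Ls' fun t' => G (t ++ t') := by
  induction Ls generalizing G with
  | nil => rfl
  | cons L Ls ih => simp only [List.cons_append, stateSum, ih]

lemma stateSum_congr (Ls : List Slice) {G G' : List (Option ι) → W}
    (h : ∀ t, t.length = Ls.length → G t = G' t) : stateSum Ls G = stateSum Ls G' := by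
  induction Ls generalizing G G' with
  | nil => exact h [] rfl
  | cons L Ls ih =>
    have h1 (a : Option ι) : stateSum Ls (fun t => G (a :: t)) = stateSum Ls fun t => G' (a :: t) :=
      ih fun t ht => h _ (by simp [ht])
    simp only [stateSum, h1]

lemma stateSum_sum {κ : Type*} (s : Finset κ) (Ls : List Slice) (G : κ → List (Option ι) → W) :
    stateSum Ls (fun t => ∑ a ∈ s, G a t) = ∑ a ∈ s, stateSum Ls (G a) := by
  induction Ls generalizing G with
  | nil => rfl
  | cons L Ls ih =>
    simp only [stateSum, ih]
    split_ifs
    · exact Finset.sum_comm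
    · rfl

lemma stateSum_comm (Ls Ls' : List Slice) (G : List (Option ι) → List (Option ι) → W) :
    stateSum Ls (fun t => stateSum Ls' (G t)) =
      stateSum Ls' fun t' => stateSum Ls fun t => G t t' := by
  induction Ls generalizing G with
  | nil => rfl
  | cons L Ls ih =>
    simp only [stateSum, ih]
    split_ifs
    · rw [stateSum_sum]
    · rfl

lemma stateSum_whisker (l r : List Pt) (Ls : List Slice) (G : List (Option ι) → W) :
    stateSum (Ls.map (Slice.whisker l r)) G = stateSum Ls G := by
  induction Ls generalizing G with
  | nil => rfl
  | cons L Ls ih => simp only [List.map_cons, stateSum, ih, Slice.whisker]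

/-- The states of a list of slices, as a list. -/
lemma sum_stateList_aux (Ls : List Slice) (G : List (Option ι) → W) :
    ∑ s : {h : Fin Ls.length // Ls[h].gen.isCross = true} → ι,
      G (List.ofFn fun h : Fin Ls.length =>
        if hc : Ls[h].gen.isCross = true then some (s ⟨h, hc⟩) else none) = stateSum Ls G := by
  induction Ls generalizing G with
  | nil =>
    simp only [stateSum, List.length_nil, List.ofFn_zero, Finset.sum_const, Finset.card_univ]
    have : IsEmpty {h : Fin ([] : List Slice).length // ([] : List Slice)[h].gen.isCross = true} :=
      ⟨fun h => h.1.elim0⟩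
    rw [Fintype.card_unique, one_smul]
  | cons L Ls ih =>
    by_cases hL : L.gen.isCross = true
    · rw [stateSum, if_pos hL]
      simp only [← ih]
      rw [← Fintype.sum_prod_type']
      refine Fintype.sum_equiv
        { toFun := fun s => (s ⟨(⟨0, Nat.succ_pos _⟩ : Fin (Ls.length + 1)), hL⟩, fun h => s ⟨h.1.succ, h.2⟩)
          invFun := fun s h => Fin.cases (motive := fun m : Fin (Ls.length + 1) =>
            (L :: Ls)[m].gen.isCross = true → ι) (fun _ => s.1) (fun m hm => s.2 ⟨m, hm⟩) h.1 h.2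
          left_inv := fun s => by
            funext ⟨h, hc⟩
            cases h using Fin.cases with
            | zero => rfl
            | succ m => rfl
          right_inv := fun s => rfl } _ _ fun s => ?_
      simp only [List.length_cons, List.ofFn_succ]
      congr 2
      exact dif_pos hL
    · rw [stateSum, if_neg hL, ← ih]
      refine Fintype.sum_equiv
        { toFun := fun s h => s ⟨h.1.succ, h.2⟩
          invFun := fun s h => Fin.cases (motive := fun m : Fin (Ls.length + 1) =>
            (L :: Ls)[m].gen.isCross = true → ι) (fun h => absurd h hL) (fun m hm => s ⟨m, hm⟩) h.1 h.2
          left_inv := fun s => by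
            funext ⟨h, hc⟩
            cases h using Fin.cases with
            | zero => exact absurd hc hL
            | succ m => rfl
          right_inv := fun s => rfl } _ _ fun s => ?_
      simp only [List.length_cons, List.ofFn_succ]
      congr 2
      exact dif_neg hL

lemma sum_stateList (D : Diagram) (G : List (Option ι) → W) :
    ∑ s : D.Crossing → ι, G (stateList s) = stateSum D.slices G :=
  sum_stateList_aux D.slices G

end StateSums

/-! ### Columns, their embeddings and their strands -/

/-- A column of a diagram: the strands at the top and a list of rows, each of which is either a
slice or consists of vertical strands only (`none`). -/
structure Col where
  top : List Pt
  rows : List (Option Slice)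

/-- Following a strand downwards into a row. -/
def rowDown : Option Slice → ℕ → ℕ ⊕ ℕ
  | none, i => .inl i
  | some L, i => L.down i

/-- Following a strand upwards into a row. -/
def rowUp : Option Slice → ℕ → ℕ ⊕ ℕ
  | none, i => .inl i
  | some L, i => L.up i

/-- The strand of a crossing which is met at the top of a row. -/
def rowTokDown : Option Slice → ℕ → Option Bool
  | none, _ => none
  | some L, i => L.tokDown i

/-- The strand of a crossing which is met at the bottom of a row. -/
def rowTokUp : Option Slice → ℕ → Option Bool
  | none, _ => none
  | some L, i => L.tokUp i

namespace Col

/-- The strands at the `h`-th level. -/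
def word (C : Col) : ℕ → List Pt
  | 0 => C.top
  | h + 1 => match C.rows[h]? with
    | none => []
    | some none => C.word h
    | some (some L) => L.tgt

/-- The next point along the orientation. -/
def next (C : Col) (x : ℕ × ℕ) : Option (ℕ × ℕ) :=
  match (C.word x.1)[x.2]?, x with
  | none, _ => none
  | some ⟨_, true⟩, (0, _) => none
  | some ⟨_, true⟩, (h + 1, i) =>
    (C.rows[h]?).map fun L => match rowUp L i with
      | .inl j => (h, j)
      | .inr j => (h + 1, j)
  | some ⟨_, false⟩, (h, i) =>
    (C.rows[h]?).map fun L => match rowDown L i with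
      | .inl j => (h + 1, j)
      | .inr j => (h, j)

/-- The strand of a crossing which is traversed between a point and the next one. -/
def tok (C : Col) (x : ℕ × ℕ) : Option (ℕ × Bool) :=
  match (C.word x.1)[x.2]?, x with
  | none, _ => none
  | some ⟨_, true⟩, (0, _) => none
  | some ⟨_, true⟩, (h + 1, i) =>
    (C.rows[h]?).bind fun L => (rowTokUp L i).map fun u => (h, u)
  | some ⟨_, false⟩, (h, i) =>
    (C.rows[h]?).bind fun L => (rowTokDown L i).map fun u => (h, u)

variable (C : Col)

lemma next_of_down {h i : ℕ} {P : Pt} (hP : (C.word h)[i]? = some P) (hu : P.up = false) :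
    C.next (h, i) = (C.rows[h]?).map fun L => match rowDown L i with
      | .inl j => (h + 1, j)
      | .inr j => (h, j) := by
  obtain ⟨t, u⟩ := P
  subst hu
  simp only [next, hP]

lemma next_of_up {h i : ℕ} {P : Pt} (hP : (C.word (h + 1))[i]? = some P) (hu : P.up = true) :
    C.next (h + 1, i) = (C.rows[h]?).map fun L => match rowUp L i with
      | .inl j => (h, j)
      | .inr j => (h + 1, j) := by
  obtain ⟨t, u⟩ := P
  subst hu
  simp only [next, hP]

lemma next_of_up_zero {i : ℕ} {P : Pt} (hP : (C.word 0)[i]? = some P) (hu : P.up = true) :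
    C.next (0, i) = none := by
  obtain ⟨t, u⟩ := P
  subst hu
  simp only [next, hP]

lemma next_of_none {x : ℕ × ℕ} (hP : (C.word x.1)[x.2]? = none) : C.next x = none := by
  obtain ⟨h, i⟩ := x
  simp only [next, hP]

lemma tok_of_down {h i : ℕ} {P : Pt} (hP : (C.word h)[i]? = some P) (hu : P.up = false) :
    C.tok (h, i) = (C.rows[h]?).bind fun L => (rowTokDown L i).map fun u => (h, u) := by
  obtain ⟨t, u⟩ := P
  subst hu
  simp only [tok, hP]

lemma tok_of_up {h i : ℕ} {P : Pt} (hP : (C.word (h + 1))[i]? = some P) (hu : P.up = true) :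
    C.tok (h + 1, i) = (C.rows[h]?).bind fun L => (rowTokUp L i).map fun u => (h, u) := by
  obtain ⟨t, u⟩ := P
  subst hu
  simp only [tok, hP]

lemma tok_of_up_zero {i : ℕ} {P : Pt} (hP : (C.word 0)[i]? = some P) (hu : P.up = true) :
    C.tok (0, i) = none := by
  obtain ⟨t, u⟩ := P
  subst hu
  simp only [tok, hP]

end Col

namespace Diagram

/-- A diagram as a column. -/
def col (D : Diagram) : Col := ⟨D.top, D.slices.map some⟩

variable (D : Diagram)

lemma col_word (h : ℕ) : D.col.word h = D.word h := by
  cases h with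
  | zero => rfl
  | succ h =>
    simp only [Col.word, word, col, List.getElem?_map]
    rcases D.slices[h]? with _ | L <;> rfl

lemma col_next (x : ℕ × ℕ) : D.col.next x = D.next x := by
  obtain ⟨h, i⟩ := x
  rcases hP : (D.word h)[i]? with _ | P
  · rw [D.next_of_none (x := (h, i)) hP, D.col.next_of_none (by rw [col_word]; exact hP)]
  have hP' : (D.col.word h)[i]? = some P := by rw [col_word]; exact hP
  rcases hu : P.up with _ | _
  · rw [D.next_of_down hP hu, D.col.next_of_down hP' hu, col, List.getElem?_map, Option.map_map]
    rfl
  · cases h with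
    | zero => rw [D.next_of_up_zero hP hu, D.col.next_of_up_zero hP' hu]
    | succ h =>
      rw [D.next_of_up hP hu, D.col.next_of_up hP' hu, col, List.getElem?_map, Option.map_map]
      rfl

lemma col_tok (x : ℕ × ℕ) : D.col.tok x = D.tok x := by
  obtain ⟨h, i⟩ := x
  rcases hP : (D.word h)[i]? with _ | P
  · rw [D.tok_of_none (x := (h, i)) hP]
    have hP' : (D.col.word h)[i]? = none := by rw [col_word]; exact hP
    simp only [Col.tok, hP']
  have hP' : (D.col.word h)[i]? = some P := by rw [col_word]; exact hP
  rcases hu : P.up with _ | _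
  · rw [D.tok_of_down hP hu, D.col.tok_of_down hP' hu, col, List.getElem?_map, Option.bind_map]
    rfl
  · cases h with
    | zero => rw [D.tok_of_up_zero hP hu, D.col.tok_of_up_zero hP' hu]
    | succ h =>
      rw [D.tok_of_up hP hu, D.col.tok_of_up hP' hu, col, List.getElem?_map, Option.bind_map]
      rfl

end Diagram

/-- The column `C` is a part of the column `C'`, from the level `p` on and at the positions from
`o j` on in the `j`-th level of `C`. -/
structure Col.Emb (C C' : Col) (p : ℕ) (o : ℕ → ℕ) : Prop where
  word : ∀ j ≤ C.rows.length, ∀ i < (C.word j).length,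
    (C'.word (p + j))[o j + i]? = (C.word j)[i]?
  row : ∀ j r, C.rows[j]? = some r → ∃ r', C'.rows[p + j]? = some r' ∧
    (∀ i < (C.word j).length,
      rowDown r' (o j + i) = Sum.map (o (j + 1) + ·) (o j + ·) (rowDown r i) ∧
      rowTokDown r' (o j + i) = rowTokDown r i) ∧
    (∀ i < (C.word (j + 1)).length,
      rowUp r' (o (j + 1) + i) = Sum.map (o j + ·) (o (j + 1) + ·) (rowUp r i) ∧
      rowTokUp r' (o (j + 1) + i) = rowTokUp r i)

namespace Col.Emb

variable {C C' : Col} {p : ℕ} {o : ℕ → ℕ}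

/-- The image of a point. -/
def map (p : ℕ) (o : ℕ → ℕ) (x : ℕ × ℕ) : ℕ × ℕ := (p + x.1, o x.1 + x.2)

/-- A point that has a successor in `C` crosses a row of `C`. This row corresponds to one of `C'`,
so that the step and the crossing traversed carry over. -/
lemma next (h : C.Emb C' p o) {x y : ℕ × ℕ} (hxy : C.next x = some y) :
    C'.next (map p o x) = some (map p o y) ∧
      C'.tok (map p o x) = (C.tok x).map fun v => (p + v.1, v.2) := by
  obtain ⟨m, i⟩ := x
  rcases hP : (C.word m)[i]? with _ | P
  · rw [C.next_of_none hP] at hxy; simp at hxy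
  have hi := (List.getElem?_eq_some_iff.1 hP).1
  rcases hu : P.up with _ | _
  · rw [C.next_of_down hP hu, Option.map_eq_some_iff] at hxy
    obtain ⟨r, hr, hy⟩ := hxy
    obtain ⟨r', hr', h1, -⟩ := h.row m r hr
    have hP' : (C'.word (p + m))[o m + i]? = some P := by
      rw [h.word m (List.getElem?_eq_some_iff.1 hr).1.le i hi, hP]
    rw [map, C'.next_of_down hP' hu, C'.tok_of_down hP' hu, C.tok_of_down hP hu, hr, hr']
    simp only [Option.map_some, Option.bind_some, (h1 i hi).1, (h1 i hi).2, ← hy]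
    constructor
    · rcases rowDown r i with j | j <;> rfl
    · rcases rowTokDown r i with _ | j <;> rfl
  · cases m with
    | zero => rw [C.next_of_up_zero hP hu] at hxy; simp at hxy
    | succ m =>
      rw [C.next_of_up hP hu, Option.map_eq_some_iff] at hxy
      obtain ⟨r, hr, hy⟩ := hxy
      obtain ⟨r', hr', -, h1⟩ := h.row m r hr
      have hP' : (C'.word (p + m + 1))[o (m + 1) + i]? = some P := by
        rw [add_assoc, h.word (m + 1) (List.getElem?_eq_some_iff.1 hr).1 i hi, hP]
      have hm : map p o (m + 1, i) = (p + m + 1, o (m + 1) + i) := rfl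
      rw [hm, C'.next_of_up hP' hu, C'.tok_of_up hP' hu, C.tok_of_up hP hu, hr, hr']
      simp only [Option.map_some, Option.bind_some, (h1 i hi).1, (h1 i hi).2, ← hy]
      constructor
      · rcases rowUp r i with j | j <;> rfl
      · rcases rowTokUp r i with _ | j <;> rfl

end Col.Emb

namespace Col

/-- The points at the top (`b = false`) or at the bottom (`b = true`) of a column. -/
def bd (C : Col) (x : Bool × ℕ) : ℕ × ℕ := (if x.1 then C.rows.length else 0, x.2)

/-- A description of the strands of a column: a strand enters at `ent k`, leaves at `ext k`, has the
color `thk k`, and runs through the points `tl k` after its entry; it traverses the strands `vis k`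
of crossings. -/
structure Strands (C : Col) {K : Type*} (ent ext : K → Bool × ℕ) (thk : K → Bool)
    (tl : K → List (ℕ × ℕ)) (vis : K → List (ℕ × Bool)) : Prop where
  chain : ∀ k, (C.bd (ent k) :: tl k).IsChain fun a b => C.next a = some b
  last : ∀ k, (C.bd (ent k) :: tl k).getLast (List.cons_ne_nil _ _) = C.bd (ext k)
  ent_pt : ∀ k, (C.word (C.bd (ent k)).1)[(C.bd (ent k)).2]? = some ⟨thk k, (ent k).1⟩
  ext_pt : ∀ k, (C.word (C.bd (ext k)).1)[(C.bd (ext k)).2]? = some ⟨thk k, !(ext k).1⟩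
  cover : ∀ j ≤ C.rows.length, ∀ i < (C.word j).length, ∃ k, (j, i) ∈ C.bd (ent k) :: tl k
  ent_inj : Function.Injective ent
  ext_inj : Function.Injective ext
  vis_eq : ∀ k, (C.bd (ent k) :: tl k).filterMap C.tok = vis k

end Col

/-! ### Slices next to vertical strands -/

namespace Slice

variable (L : Slice) (w : List Pt)

lemma src_length : L.src.length = L.left.length + L.gen.src.length + L.right.length := by
  simp only [src, List.length_append]

lemma tgt_length : L.tgt.length = L.left.length + L.gen.tgt.length + L.right.length := by
  simp only [tgt, List.length_append]

lemma down_whisker_right {i : ℕ} : (L.whisker [] w).down i = L.down i := by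
  obtain ⟨l, g, r⟩ := L
  cases g <;> rfl

lemma up_whisker_right {i : ℕ} : (L.whisker [] w).up i = L.up i := by
  obtain ⟨l, g, r⟩ := L
  cases g <;> rfl

lemma tokDown_whisker_right {i : ℕ} : (L.whisker [] w).tokDown i = L.tokDown i := by
  obtain ⟨l, g, r⟩ := L
  cases g <;> rfl

lemma tokUp_whisker_right {i : ℕ} : (L.whisker [] w).tokUp i = L.tokUp i := by
  obtain ⟨l, g, r⟩ := L
  cases g <;> rfl

lemma down_beyond {i : ℕ} : (L.whisker [] w).down (L.src.length + i) = .inl (L.tgt.length + i) ∧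
    (L.whisker [] w).tokDown (L.src.length + i) = none := by
  rw [src_length, tgt_length]
  obtain ⟨l, g, r⟩ := L
  cases g <;> simp [down, tokDown, whisker, Gen.src, Gen.tgt] <;> grind

lemma up_beyond {i : ℕ} : (L.whisker [] w).up (L.tgt.length + i) = .inl (L.src.length + i) ∧
    (L.whisker [] w).tokUp (L.tgt.length + i) = none := by
  rw [src_length, tgt_length]
  obtain ⟨l, g, r⟩ := L
  cases g <;> simp [up, tokUp, whisker, Gen.src, Gen.tgt] <;> grind

lemma down_before {i : ℕ} (hi : i < w.length) : (L.whisker w []).down i = .inl i ∧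
    (L.whisker w []).tokDown i = none := by
  obtain ⟨l, g, r⟩ := L
  cases g <;> simp [down, tokDown, whisker] <;> grind

lemma up_before {i : ℕ} (hi : i < w.length) : (L.whisker w []).up i = .inl i ∧
    (L.whisker w []).tokUp i = none := by
  obtain ⟨l, g, r⟩ := L
  cases g <;> simp [up, tokUp, whisker] <;> grind

lemma down_whisker_left {i : ℕ} : (L.whisker w []).down (w.length + i) =
    Sum.map (w.length + ·) (w.length + ·) (L.down i) ∧
    (L.whisker w []).tokDown (w.length + i) = L.tokDown i := by
  obtain ⟨l, g, r⟩ := L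
  cases g <;> simp only [down, tokDown, whisker, List.length_append] <;> constructor <;>
    (try split_ifs) <;> first | rfl | (exfalso; omega) | (simp [Sum.map]; try omega)

lemma up_whisker_left {i : ℕ} : (L.whisker w []).up (w.length + i) =
    Sum.map (w.length + ·) (w.length + ·) (L.up i) ∧
    (L.whisker w []).tokUp (w.length + i) = L.tokUp i := by
  obtain ⟨l, g, r⟩ := L
  cases g <;> simp only [up, tokUp, whisker, List.length_append] <;> constructor <;>
    (try split_ifs) <;> first | rfl | (exfalso; omega) | (simp [Sum.map]; try omega)

end Slice

/-! ### Juxtaposition of columns -/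

namespace Col

/-- The slices of a column fit together. -/
def Wf (C : Col) : Prop := ∀ (j : ℕ) L, C.rows[j]? = some (some L) → C.word j = L.src

/-- The juxtaposition of two rows between the given words. -/
def hrow (v w : List Pt) : Option Slice → Option Slice → Option Slice
  | some L, _ => some (L.whisker [] w)
  | none, some L => some (L.whisker v [])
  | none, none => none

/-- The juxtaposition of two columns. -/
def hcomp (A B : Col) : Col :=
  ⟨A.top ++ B.top, (List.range A.rows.length).map fun j =>
    hrow (A.word j) (B.word j) (A.rows[j]?).join (B.rows[j]?).join⟩

/-- Two columns of the same height, at most one of which has a slice in each row. -/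
structure Compat (A B : Col) : Prop where
  length : A.rows.length = B.rows.length
  row : ∀ j : ℕ, (A.rows[j]?).join = none ∨ (B.rows[j]?).join = none

variable {A B : Col}

lemma hcomp_length : (A.hcomp B).rows.length = A.rows.length := by simp [hcomp]

/-- The three possibilities for a row of a juxtaposition. -/
lemma Compat.cases (h : A.Compat B) {j : ℕ} (hj : j < A.rows.length) :
    (∃ L, A.rows[j]? = some (some L) ∧ B.rows[j]? = some none ∧
      (A.hcomp B).rows[j]? = some (some (L.whisker [] (B.word j)))) ∨
    (∃ L, A.rows[j]? = some none ∧ B.rows[j]? = some (some L) ∧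
      (A.hcomp B).rows[j]? = some (some (L.whisker (A.word j) []))) ∨
    (A.rows[j]? = some none ∧ B.rows[j]? = some none ∧ (A.hcomp B).rows[j]? = some none) := by
  have hr : (A.hcomp B).rows[j]? = some (hrow (A.word j) (B.word j) (A.rows[j]?).join
      (B.rows[j]?).join) := by
    simp [hcomp, List.getElem?_range hj]
  have h1 := h.row j
  obtain ⟨a, ha⟩ : ∃ a, A.rows[j]? = some a := ⟨_, List.getElem?_eq_getElem hj⟩
  obtain ⟨b, hb⟩ : ∃ b, B.rows[j]? = some b := ⟨_, List.getElem?_eq_getElem (h.length ▸ hj)⟩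
  rw [hr]
  rw [ha, hb] at h1 ⊢
  rcases a with _ | L <;> rcases b with _ | L' <;> simp_all [hrow]

lemma hcomp_word (h : A.Compat B) {j : ℕ} (hj : j ≤ A.rows.length) :
    (A.hcomp B).word j = A.word j ++ B.word j := by
  induction j with
  | zero => rfl
  | succ j ih =>
    specialize ih (by omega)
    rcases h.cases (j := j) hj with ⟨L, h1, h2, h3⟩ | ⟨L, h1, h2, h3⟩ | ⟨h1, h2, h3⟩
    · simp [word, h1, h2, h3, Slice.whisker, Slice.tgt]
    · simp [word, h1, h2, h3, Slice.whisker, Slice.tgt]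
    · simp [word, h1, h2, h3, ih]

lemma hcomp_wf (h : A.Compat B) (hA : A.Wf) (hB : B.Wf) : (A.hcomp B).Wf := by
  intro j L hL
  have hj : j < A.rows.length := by
    rw [← hcomp_length (B := B)]
    exact (List.getElem?_eq_some_iff.1 hL).1
  rw [hcomp_word h hj.le]
  rcases h.cases (j := j) hj with ⟨L', h1, h2, h3⟩ | ⟨L', h1, h2, h3⟩ | ⟨h1, h2, h3⟩
  · rw [hL, Option.some_inj, Option.some_inj] at h3
    rw [hA j L' h1, h3]
    simp [Slice.src, Slice.whisker]
  · rw [hL, Option.some_inj, Option.some_inj] at h3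
    rw [hB j L' h2, h3]
    simp [Slice.src, Slice.whisker]
  · rw [hL] at h3; simp at h3

lemma emb_left (h : A.Compat B) : A.Emb (A.hcomp B) 0 fun _ => 0 := by
  refine ⟨fun j hj i hi => ?_, fun j r hr => ?_⟩
  · rw [zero_add, zero_add, hcomp_word h hj, List.getElem?_append_left hi]
  · have hid (x : ℕ ⊕ ℕ) : Sum.map (0 + ·) (0 + ·) x = x := by
      rcases x with x | x <;> simp
    simp only [zero_add]
    have hid' (x : ℕ ⊕ ℕ) : Sum.map (fun x => x) (fun x => x) x = x := by
      rcases x with x | x <;> simp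
    simp only [hid']
    have hj := (List.getElem?_eq_some_iff.1 hr).1
    rcases h.cases hj with ⟨L, h1, h2, h3⟩ | ⟨L, h1, h2, h3⟩ | ⟨h1, h2, h3⟩ <;>
      rw [hr, Option.some_inj] at h1 <;> subst h1
    · exact ⟨_, h3, fun i _ => ⟨L.down_whisker_right _, L.tokDown_whisker_right _⟩,
        fun i _ => ⟨L.up_whisker_right _, L.tokUp_whisker_right _⟩⟩
    · refine ⟨_, h3, fun i hi => L.down_before _ hi, fun i hi => L.up_before _ ?_⟩
      simpa only [word, hr] using hi
    · exact ⟨_, h3, fun i _ => ⟨rfl, rfl⟩, fun i _ => ⟨rfl, rfl⟩⟩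

/-- The offset of `B` is the width of `A`, which depends on the level. Across a slice of `A` it
changes from the length of the source to that of the target, and well-formedness of `A` identifies
these with the widths of its words. -/
lemma emb_right (h : A.Compat B) (hA : A.Wf) :
    B.Emb (A.hcomp B) 0 fun j => (A.word j).length := by
  refine ⟨fun j hj i hi => ?_, fun j r hr => ?_⟩
  · rw [zero_add, hcomp_word h (h.length ▸ hj), List.getElem?_append_right (by omega)]
    simp
  · simp only [zero_add]
    have hj := (List.getElem?_eq_some_iff.1 hr).1
    rcases h.cases (h.length ▸ hj) with ⟨L, h1, h2, h3⟩ | ⟨L, h1, h2, h3⟩ | ⟨h1, h2, h3⟩ <;>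
      rw [hr, Option.some_inj] at h2 <;> subst h2
    · have e1 := hA j L h1
      have e2 : A.word (j + 1) = L.tgt := by simp only [word, h1]
      rw [e1, e2]
      exact ⟨_, h3, fun i _ => L.down_beyond _, fun i _ => L.up_beyond _⟩
    · have e2 : A.word (j + 1) = A.word j := by simp only [word, h1]
      rw [e2]
      exact ⟨_, h3, fun i _ => L.down_whisker_left _, fun i _ => L.up_whisker_left _⟩
    · have e2 : A.word (j + 1) = A.word j := by simp only [word, h1]
      rw [e2]
      exact ⟨_, h3, fun i _ => ⟨rfl, rfl⟩, fun i _ => ⟨rfl, rfl⟩⟩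

end Col

namespace Col

variable {C C' : Col} {K : Type*} {ent ext : K → Bool × ℕ} {thk : K → Bool}
  {tl : K → List (ℕ × ℕ)} {vis : K → List (ℕ × Bool)}

/-- The row which a strand would enter after its exit point does not belong to the column. -/
lemma tok_exit {x : Bool × ℕ} {c : Bool}
    (h : (C.word (C.bd x).1)[(C.bd x).2]? = some ⟨c, !x.1⟩) : C.tok (C.bd x) = none := by
  obtain ⟨_ | _, i⟩ := x
  · exact C.tok_of_up_zero h rfl
  · refine (C.tok_of_down h rfl).trans ?_
    have : C.rows[(C.bd (true, i)).1]? = none := List.getElem?_eq_none le_rfl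
    rw [this]
    rfl

namespace Strands

lemma emb_chain (S : C.Strands ent ext thk tl vis) {p : ℕ} {o : ℕ → ℕ} (E : C.Emb C' p o) (k : K) :
    ((C.bd (ent k) :: tl k).map (Emb.map p o)).IsChain fun a b => C'.next a = some b :=
  List.isChain_map_of_isChain _ (fun _ _ h => (E.next h).1) (S.chain k)

/-- The exit point is dropped, because in `C'` the strand may continue from there through a crossing
outside of `C`. -/
lemma emb_vis (S : C.Strands ent ext thk tl vis) {p : ℕ} {o : ℕ → ℕ} (E : C.Emb C' p o) (k : K) :
    ((C.bd (ent k) :: tl k).dropLast.map (Emb.map p o)).filterMap C'.tok =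
      (vis k).map fun v => (p + v.1, v.2) := by
  have h1 : (C.bd (ent k) :: tl k).dropLast.filterMap C.tok = vis k := by
    rw [← S.vis_eq k]
    conv_rhs => rw [← List.dropLast_append_getLast (List.cons_ne_nil (C.bd (ent k)) (tl k))]
    rw [List.filterMap_append, S.last k, List.filterMap_cons_none (tok_exit (S.ext_pt k))]
    simp
  rw [← h1, List.filterMap_map, List.map_filterMap]
  refine List.filterMap_congr fun x hx => ?_
  obtain ⟨y, hy⟩ : ∃ y, C.next x = some y := by
    have hc := S.chain k
    have hn : ∀ (l : List (ℕ × ℕ)), l.IsChain (fun a b => C.next a = some b) →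
        ∀ x ∈ l.dropLast, ∃ y, C.next x = some y := by
      intro l
      induction l with
      | nil => simp
      | cons a l ih =>
        cases l with
        | nil => simp
        | cons b l =>
          intro h x hx
          rw [List.isChain_cons_cons] at h
          rw [List.dropLast_cons_cons, List.mem_cons] at hx
          rcases hx with rfl | hx
          · exact ⟨b, h.1⟩
          · exact ih h.2 x hx
    exact hn _ hc x hx
  exact (E.next hy).2

end Strands

/-- The displacement of boundary points by `m₀` at the top and by `m₁` at the bottom. -/
def displace (m₀ m₁ : ℕ) (x : Bool × ℕ) : Bool × ℕ := (x.1, (if x.1 then m₁ else m₀) + x.2)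

variable {A B : Col} {K' : Type*} {ent' ext' : K' → Bool × ℕ} {thk' : K' → Bool}
  {tl' : K' → List (ℕ × ℕ)} {vis' : K' → List (ℕ × Bool)}

lemma map_zero (x : ℕ × ℕ) : Emb.map 0 (fun _ => 0) x = x := by simp [Emb.map]

/-- The strands of a juxtaposition. -/
lemma Strands.hcomp (h : A.Compat B) (hA : A.Wf) (S : A.Strands ent ext thk tl vis)
    (S' : B.Strands ent' ext' thk' tl' vis') {m₀ m₁ : ℕ} (h₀ : A.top.length = m₀)
    (h₁ : (A.word A.rows.length).length = m₁) :
    (A.hcomp B).Strands (Sum.elim ent fun k => displace m₀ m₁ (ent' k))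
      (Sum.elim ext fun k => displace m₀ m₁ (ext' k)) (Sum.elim thk thk')
      (Sum.elim tl fun k => (tl' k).map (Emb.map 0 fun j => (A.word j).length))
      (Sum.elim vis vis') := by
  have el := emb_left h
  have er := emb_right h hA
  have hbd (x : Bool × ℕ) : (A.hcomp B).bd x = A.bd x := by
    rw [bd, hcomp_length]; rfl
  have hlen : A.rows.length = B.rows.length := h.length
  have hbd' (x : Bool × ℕ) : (A.hcomp B).bd (displace m₀ m₁ x) =
      Emb.map 0 (fun j => (A.word j).length) (B.bd x) := by
    rw [hbd]
    obtain ⟨_ | _, i⟩ := x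
    · simp only [displace, bd, Emb.map, Bool.false_eq_true, if_false, ← h₀]
      rfl
    · simp only [displace, bd, Emb.map, if_true, ← h₁, hlen, zero_add]
  have hle (x : Bool × ℕ) : (A.bd x).1 ≤ A.rows.length := by
    rw [bd]; split_ifs <;> simp
  have hle' (x : Bool × ℕ) : (B.bd x).1 ≤ B.rows.length := by
    rw [bd]; split_ifs <;> simp
  have pl (x : Bool × ℕ) (P : Pt) (hP : (A.word (A.bd x).1)[(A.bd x).2]? = some P) :
      ((A.hcomp B).word ((A.hcomp B).bd x).1)[((A.hcomp B).bd x).2]? = some P := by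
    have := el.word _ (hle x) _ (List.getElem?_eq_some_iff.1 hP).1
    rw [hbd, ← hP, ← this, zero_add, zero_add]
  have pr (x : Bool × ℕ) (P : Pt) (hP : (B.word (B.bd x).1)[(B.bd x).2]? = some P) :
      ((A.hcomp B).word ((A.hcomp B).bd (displace m₀ m₁ x)).1)[((A.hcomp B).bd
        (displace m₀ m₁ x)).2]? = some P := by
    rw [hbd', ← hP, ← er.word _ (hle' x) _ (List.getElem?_eq_some_iff.1 hP).1]
    rfl
  have bl (x : Bool × ℕ) (P : Pt) (hP : (A.word (A.bd x).1)[(A.bd x).2]? = some P) :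
      x.2 < if x.1 then m₁ else m₀ := by
    have := (List.getElem?_eq_some_iff.1 hP).1
    obtain ⟨_ | _, i⟩ := x
    · simp only [Bool.false_eq_true, if_false, ← h₀]; exact this
    · simp only [if_true, ← h₁]; exact this
  -- On both levels the ends from `A` are at positions below the width of `A`, and the displaced
  -- ends from `B` are not.
  have inj {e : K → Bool × ℕ} {e' : K' → Bool × ℕ} (he : Function.Injective e)
      (he' : Function.Injective e')
      (hp : ∀ k, ∃ P, (A.word (A.bd (e k)).1)[(A.bd (e k)).2]? = some P) :
      Function.Injective (Sum.elim e fun k => displace m₀ m₁ (e' k)) := by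
    rintro (k | k) (k' | k') hk
    · rw [he hk]
    · exfalso
      obtain ⟨P, hP⟩ := hp k
      have := bl _ _ hP
      simp only [Sum.elim_inl, Sum.elim_inr] at hk
      rw [hk] at this
      exact Nat.not_lt.2 (Nat.le_add_right _ _) this
    · exfalso
      obtain ⟨P, hP⟩ := hp k'
      have := bl _ _ hP
      simp only [Sum.elim_inl, Sum.elim_inr] at hk
      rw [← hk] at this
      exact Nat.not_lt.2 (Nat.le_add_right _ _) this
    · simp only [Sum.elim_inr, displace, Prod.mk.injEq] at hk
      have : e' k = e' k' := by
        refine Prod.ext hk.1 ?_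
        have h2 := hk.2
        rw [hk.1] at h2
        omega
      rw [he' this]
  have pathl (k : K) : (A.hcomp B).bd (ent k) :: tl k = (A.bd (ent k) :: tl k).map
      (Emb.map 0 fun _ => 0) := by
    rw [hbd, List.map_congr_left (g := id) fun x _ => map_zero x, List.map_id]
  have pathr (k : K') : (A.hcomp B).bd (displace m₀ m₁ (ent' k)) ::
      (tl' k).map (Emb.map 0 fun j => (A.word j).length) = (B.bd (ent' k) :: tl' k).map
      (Emb.map 0 fun j => (A.word j).length) := by
    rw [hbd', List.map_cons]
  have hshift (l : List (ℕ × Bool)) : (l.map fun v => (0 + v.1, v.2)) = l := by simp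
  have ext_pt : ∀ k, ((A.hcomp B).word ((A.hcomp B).bd (Sum.elim ext (fun k =>
      displace m₀ m₁ (ext' k)) k)).1)[((A.hcomp B).bd (Sum.elim ext (fun k =>
      displace m₀ m₁ (ext' k)) k)).2]? =
      some ⟨Sum.elim thk thk' k, !(Sum.elim ext (fun k => displace m₀ m₁ (ext' k)) k).1⟩ := by
    rintro (k | k)
    · exact pl _ _ (S.ext_pt k)
    · exact pr _ _ (S'.ext_pt k)
  have last : ∀ k, ((A.hcomp B).bd (Sum.elim ent (fun k => displace m₀ m₁ (ent' k)) k) ::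
      Sum.elim tl (fun k => (tl' k).map (Emb.map 0 fun j => (A.word j).length)) k).getLast
        (List.cons_ne_nil _ _) =
      (A.hcomp B).bd (Sum.elim ext (fun k => displace m₀ m₁ (ext' k)) k) := by
    rintro (k | k)
    · simp only [Sum.elim_inl, pathl]
      rw [List.getLast_map, S.last, map_zero, hbd]
    · simp only [Sum.elim_inr, pathr]
      rw [List.getLast_map, S'.last, hbd']
  refine ⟨?_, last, ?_, ext_pt, ?_, inj S.ent_inj S'.ent_inj fun k => ⟨_, S.ent_pt k⟩,
    inj S.ext_inj S'.ext_inj fun k => ⟨_, S.ext_pt k⟩, ?_⟩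
  · rintro (k | k)
    · simp only [Sum.elim_inl, pathl]
      exact S.emb_chain el k
    · simp only [Sum.elim_inr, pathr]
      exact S'.emb_chain er k
  · rintro (k | k)
    · exact pl _ _ (S.ent_pt k)
    · exact pr _ _ (S'.ent_pt k)
  · intro j hj i hi
    rw [hcomp_length] at hj
    rw [hcomp_word h hj, List.length_append] at hi
    by_cases hi' : i < (A.word j).length
    · obtain ⟨k, hk⟩ := S.cover j hj i hi'
      refine ⟨Sum.inl k, ?_⟩
      simp only [Sum.elim_inl, hbd]
      exact hk
    · obtain ⟨k, hk⟩ := S'.cover j (hlen ▸ hj) (i - (A.word j).length) (by omega)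
      refine ⟨Sum.inr k, ?_⟩
      simp only [Sum.elim_inr, pathr]
      refine List.mem_map.2 ⟨_, hk, ?_⟩
      simp only [Emb.map, Prod.mk.injEq]
      omega
  · intro k
    have h2 := List.dropLast_append_getLast (List.cons_ne_nil
      ((A.hcomp B).bd (Sum.elim ent (fun k => displace m₀ m₁ (ent' k)) k))
      (Sum.elim tl (fun k => (tl' k).map (Emb.map 0 fun j => (A.word j).length)) k))
    rw [← h2, List.filterMap_append, last, List.filterMap_cons_none (tok_exit (ext_pt k)),
      List.filterMap_nil, List.append_nil]
    rcases k with k | k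
    · simp only [Sum.elim_inl, pathl]
      rw [← List.map_dropLast, S.emb_vis el, hshift]
    · simp only [Sum.elim_inr, pathr]
      rw [← List.map_dropLast, S'.emb_vis er, hshift]

end Col

/-! ### The exterior of a replaced part -/

/-- The points outside of a part of a diagram which lies between the levels `p` and `p + q`. -/
def outerPoint (p q : ℕ) (c : Bool × ℕ × ℕ) : ℕ × ℕ := (if c.1 then p + q + c.2.1 else c.2.1, c.2.2)

/-- Two diagrams agree outside of the parts between the levels `p` and `p + q` of the first one and
between the levels `p` and `p + q'` of the second one. -/
structure AgreeOutside (D D' : Diagram) (p q q' : ℕ) : Prop where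
  word_top : ∀ m ≤ p, D.word m = D'.word m
  word_bot : ∀ m, D.word (p + q + m) = D'.word (p + q' + m)
  slice_top : ∀ m < p, D.slices[m]? = D'.slices[m]?
  slice_bot : ∀ m, D.slices[p + q + m]? = D'.slices[p + q' + m]?

/-- The strand at a point leads into the exterior. -/
def Outward (D : Diagram) (p q : ℕ) (c : Bool × ℕ × ℕ) : Prop :=
  if c.1 then c.2.1 = 0 → ∀ P, D.ptAt (outerPoint p q c) = some P → P.up = false
  else c.2.1 ≤ p ∧ (c.2.1 = p → ∀ P, D.ptAt (outerPoint p q c) = some P → P.up = true)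

/-- The strand at a point comes from the exterior. -/
def FromOutside (D : Diagram) (p q : ℕ) (c : Bool × ℕ × ℕ) : Prop :=
  if c.1 then c.2.1 = 0 → ∀ P, D.ptAt (outerPoint p q c) = some P → P.up = true
  else c.2.1 ≤ p ∧ (c.2.1 = p → ∀ P, D.ptAt (outerPoint p q c) = some P → P.up = false)

namespace AgreeOutside

variable {D D' : Diagram} {p q q' : ℕ} (H : AgreeOutside D D' p q q')
include H

lemma ptAt_eq (c : Bool × ℕ × ℕ) (hc : c.1 = false → c.2.1 ≤ p) :
    D.ptAt (outerPoint p q c) = D'.ptAt (outerPoint p q' c) := by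
  obtain ⟨_ | _, m, i⟩ := c
  · simp only [Diagram.ptAt, outerPoint, Bool.false_eq_true, if_false, H.word_top m (hc rfl)]
  · simp only [Diagram.ptAt, outerPoint, if_true, H.word_bot m]

lemma next_top {m i : ℕ} (hm : m ≤ p) (hc : m = p → ∀ P, D.ptAt (m, i) = some P → P.up = true) :
    D.next (m, i) = D'.next (m, i) ∧ ∀ y, D.next (m, i) = some y → y.1 ≤ p ∧
      (y.1 = p → ∀ P, D.ptAt y = some P → P.up = false) := by
  have hpt : D.ptAt (m, i) = D'.ptAt (m, i) := by simp only [Diagram.ptAt, H.word_top m hm]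
  constructor
  · rcases hP : D.ptAt (m, i) with _ | P
    · rw [D.next_of_none hP, D'.next_of_none (hpt ▸ hP)]
    rcases hu : P.up with _ | _
    · have hmp : m ≠ p := fun h => by simp [hc h P hP] at hu
      rw [D.next_of_down hP hu, D'.next_of_down (hpt ▸ hP) hu, H.slice_top m (by omega)]
    · cases m with
      | zero => rw [D.next_of_up_zero hP hu, D'.next_of_up_zero (hpt ▸ hP) hu]
      | succ m => rw [D.next_of_up hP hu, D'.next_of_up (hpt ▸ hP) hu, H.slice_top m (by omega)]
  · intro y hy
    obtain ⟨h, L, P, P', -, hP, hP', -, h1, h2⟩ := D.next_spec hy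
    have hh : h < p := by
      rcases h1 with ⟨h1, h3⟩ | ⟨h1, h3⟩
      · have hmp : m ≠ p := fun h => by simp [hc h P hP] at h1
        simp only at h3
        omega
      · simp only at h3
        omega
    rcases h2 with ⟨h2, h3, -⟩ | ⟨h2, h3, -⟩
    · refine ⟨by omega, fun _ Q hQ => ?_⟩
      rw [hP', Option.some_inj] at hQ
      rw [← hQ, h2]
    · exact ⟨by omega, fun _ => by omega⟩

/-- Below the part, heights are counted from its lower boundary. In these coordinates the successor
`o` is common to both diagrams; if it is on the boundary, its strand is directed upwards into the
part. -/
lemma next_bot {m i : ℕ} (hc : m = 0 → ∀ P, D.ptAt (p + q + m, i) = some P → P.up = false) :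
    ∃ o : Option (ℕ × ℕ), D.next (p + q + m, i) = o.map (fun y => (p + q + y.1, y.2)) ∧
      D'.next (p + q' + m, i) = o.map (fun y => (p + q' + y.1, y.2)) ∧
      ∀ y, o = some y → y.1 = 0 → ∀ P, D.ptAt (p + q + y.1, y.2) = some P → P.up = true := by
  have hpt : D.ptAt (p + q + m, i) = D'.ptAt (p + q' + m, i) := by
    simp only [Diagram.ptAt, H.word_bot m]
  have key (o : Option (ℕ × ℕ)) (ho : D.next (p + q + m, i) = o.map fun y => (p + q + y.1, y.2)) :
      ∀ y, o = some y → y.1 = 0 → ∀ P, D.ptAt (p + q + y.1, y.2) = some P → P.up = true := by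
    intro y hy hy0 Q hQ
    rw [hy, Option.map_some] at ho
    obtain ⟨h, L, P, P', -, hP, hP', -, h1, h2⟩ := D.next_spec ho
    rw [hP', Option.some_inj] at hQ
    subst hQ
    rcases h2 with ⟨h2, h3, -⟩ | ⟨h2, h3, -⟩
    · exfalso
      simp only at h3 h1
      rcases h1 with ⟨h1, h4⟩ | ⟨h1, h4⟩
      · omega
      · obtain rfl : m = 0 := by omega
        simp [hc rfl P hP] at h1
    · exact h2
  rcases hP : D.ptAt (p + q + m, i) with _ | P
  · have h1 := D.next_of_none hP
    exact ⟨none, h1, D'.next_of_none (hpt ▸ hP), key _ h1⟩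
  rcases hu : P.up with _ | _
  · have h1 := D.next_of_down hP hu
    have h2 := D'.next_of_down (hpt ▸ hP) hu
    rw [← H.slice_bot m] at h2
    rcases hL : D.slices[p + q + m]? with _ | L
    · rw [hL] at h1 h2
      exact ⟨none, h1, h2, key _ h1⟩
    · rw [hL] at h1 h2
      simp only [Option.map_some] at h1 h2
      rcases hd : L.down i with j | j <;> rw [hd] at h1 h2
      · exact ⟨some (m + 1, j), h1, h2, key (some (m + 1, j)) h1⟩
      · exact ⟨some (m, j), h1, h2, key (some (m, j)) h1⟩
  · cases m with
    | zero => simp [hc rfl P hP] at hu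
    | succ m =>
      have h1 := D.next_of_up (h := p + q + m) hP hu
      have h2 := D'.next_of_up (h := p + q' + m) (hpt ▸ hP) hu
      rw [← H.slice_bot m] at h2
      rcases hL : D.slices[p + q + m]? with _ | L
      · rw [hL] at h1 h2
        exact ⟨none, h1, h2, key _ h1⟩
      · rw [hL] at h1 h2
        simp only [Option.map_some] at h1 h2
        rcases hd : L.up i with j | j <;> rw [hd] at h1 h2
        · exact ⟨some (m, j), h1, h2, key (some (m, j)) h1⟩
        · exact ⟨some (m + 1, j), h1, h2, key (some (m + 1, j)) h1⟩

/-- An outward step crosses a slice outside of the part, and such slices are the same in both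
diagrams up to a shift of height. -/
lemma next (c : Bool × ℕ × ℕ) (hc : Outward D p q c) :
    (D.next (outerPoint p q c) = none ∧ D'.next (outerPoint p q' c) = none) ∨
    ∃ c', FromOutside D p q c' ∧ D.next (outerPoint p q c) = some (outerPoint p q c') ∧
      D'.next (outerPoint p q' c) = some (outerPoint p q' c') := by
  obtain ⟨_ | _, m, i⟩ := c
  · simp only [Outward, outerPoint, Bool.false_eq_true, if_false] at hc ⊢
    obtain ⟨h1, h2⟩ := H.next_top hc.1 hc.2
    rw [← h1]
    rcases hy : D.next (m, i) with _ | y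
    · exact Or.inl ⟨rfl, rfl⟩
    · refine Or.inr ⟨(false, y), ?_, rfl, rfl⟩
      simpa only [FromOutside, outerPoint, Bool.false_eq_true, if_false] using h2 y hy
  · simp only [Outward, outerPoint, if_true] at hc ⊢
    obtain ⟨_ | y, h1, h2, h3⟩ := H.next_bot hc
    · exact Or.inl ⟨h1, h2⟩
    · refine Or.inr ⟨(true, y), ?_, h1, h2⟩
      simpa only [FromOutside, outerPoint, if_true] using h3 y rfl

lemma tok (c : Bool × ℕ × ℕ) (hc : Outward D p q c) :
    (D.tok (outerPoint p q c) = none ∧ D'.tok (outerPoint p q' c) = none) ∨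
    (∃ m u, m < p ∧ D.tok (outerPoint p q c) = some (m, u) ∧
      D'.tok (outerPoint p q' c) = some (m, u)) ∨
    ∃ m u, D.tok (outerPoint p q c) = some (p + q + m, u) ∧
      D'.tok (outerPoint p q' c) = some (p + q' + m, u) := by
  have hpt := H.ptAt_eq c fun h => by simp only [Outward, h, Bool.false_eq_true, if_false] at hc; exact hc.1
  rcases hP : D.ptAt (outerPoint p q c) with _ | P
  · exact Or.inl ⟨D.tok_of_none hP, D'.tok_of_none (hpt ▸ hP)⟩
  have hP' := hpt ▸ hP
  clear hpt
  obtain ⟨_ | _, m, i⟩ := c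
  · simp only [Outward, outerPoint, Bool.false_eq_true, if_false] at hc hP hP' ⊢
    rcases hu : P.up with _ | _
    · have hmp : m ≠ p := fun h => by simp [hc.2 h P hP] at hu
      rw [D.tok_of_down hP hu, D'.tok_of_down hP' hu, ← H.slice_top m (by omega)]
      rcases D.slices[m]? with _ | L
      · exact Or.inl ⟨rfl, rfl⟩
      · rcases hL : L.tokDown i with _ | u
        · exact Or.inl (by simp [hL])
        · exact Or.inr (Or.inl ⟨m, u, by omega, by simp [hL]⟩)
    · cases m with
      | zero => exact Or.inl ⟨D.tok_of_up_zero hP hu, D'.tok_of_up_zero hP' hu⟩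
      | succ m =>
        rw [D.tok_of_up hP hu, D'.tok_of_up hP' hu, ← H.slice_top m (by omega)]
        rcases D.slices[m]? with _ | L
        · exact Or.inl ⟨rfl, rfl⟩
        · rcases hL : L.tokUp i with _ | u
          · exact Or.inl (by simp [hL])
          · exact Or.inr (Or.inl ⟨m, u, by omega, by simp [hL]⟩)
  · simp only [Outward, outerPoint, if_true] at hc hP hP' ⊢
    rcases hu : P.up with _ | _
    · rw [D.tok_of_down hP hu, D'.tok_of_down hP' hu, ← H.slice_bot m]
      rcases D.slices[p + q + m]? with _ | L
      · exact Or.inl ⟨rfl, rfl⟩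
      · rcases hL : L.tokDown i with _ | u
        · exact Or.inl (by simp [hL])
        · exact Or.inr (Or.inr ⟨m, u, by simp [hL]⟩)
    · cases m with
      | zero => simp [hc rfl P hP] at hu
      | succ m =>
        rw [← add_assoc] at hP hP' ⊢
        rw [← add_assoc, D.tok_of_up hP hu, D'.tok_of_up hP' hu, ← H.slice_bot m]
        rcases D.slices[p + q + m]? with _ | L
        · exact Or.inl ⟨rfl, rfl⟩
        · rcases hL : L.tokUp i with _ | u
          · exact Or.inl (by simp [hL])
          · exact Or.inr (Or.inr ⟨m, u, by simp [hL]⟩)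

end AgreeOutside

lemma Diagram.finite_node (D : Diagram) : Finite D.Node := by
  refine Set.Finite.to_subtype (s := {x : ℕ × ℕ | x.2 < (D.word x.1).length}) ?_
  refine Set.Finite.subset (Finset.finite_toSet ((Finset.range (D.slices.length + 1)).biUnion
    fun h => (Finset.range (D.word h).length).image fun i => (h, i))) fun x hx => ?_
  simp only [Finset.coe_biUnion, Set.mem_iUnion, Finset.coe_image, Set.mem_image, Finset.mem_coe,
    Finset.mem_range]
  refine ⟨x.1, ?_, x.2, hx, rfl⟩
  by_contra hcon
  obtain ⟨m, hm⟩ : ∃ m, x.1 = m + 1 := ⟨x.1 - 1, by omega⟩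
  simp only [Set.mem_ofPred_eq] at hx
  rw [hm] at hx
  have : D.slices[m]? = none := List.getElem?_eq_none (by omega)
  simp [Diagram.word, this] at hx

/-- The column `R` is the part of the diagram `D` below the level `p`. -/
structure Region (D : Diagram) (p : ℕ) (R : Col) : Prop where
  word : ∀ j ≤ R.rows.length, D.word (p + j) = R.word j
  row : ∀ j r, R.rows[j]? = some r → ∃ L, r = some L ∧ D.slices[p + j]? = some L

namespace Region

variable {D : Diagram} {p : ℕ} {R : Col} (h : Region D p R)
include h

lemma emb : R.Emb D.col p fun _ => 0 := by
  have hid (x : ℕ ⊕ ℕ) : Sum.map (fun x => x) (fun x => x) x = x := by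
    rcases x with x | x <;> rfl
  refine ⟨fun j hj i _ => ?_, fun j r hr => ?_⟩
  · rw [D.col_word, h.word j hj, zero_add]
  · obtain ⟨L, rfl, hL⟩ := h.row j r hr
    refine ⟨some L, by simp [Diagram.col, hL], fun i _ => ?_, fun i _ => ?_⟩
    · simp only [hid, zero_add, and_self]
    · simp only [hid, zero_add, and_self]

lemma next {x y : ℕ × ℕ} (hxy : R.next x = some y) : D.next (p + x.1, x.2) = some (p + y.1, y.2) := by
  have := (h.emb.next hxy).1
  simpa only [Col.Emb.map, zero_add, D.col_next] using this

/-- A strand does not come from a part of a diagram at a point where it enters it. -/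
lemma not_next_eq {z : ℕ × ℕ} {b : Bool} {i : ℕ} {c : Bool}
    (hP : (R.word (R.bd (b, i)).1)[(R.bd (b, i)).2]? = some ⟨c, b⟩) :
    R.next z ≠ some (R.bd (b, i)) := by
  intro hz
  have hD := h.next hz
  obtain ⟨m, L, P, P', hL, hP1, hP2, -, h1, h2⟩ := D.next_spec hD
  have hle : (R.bd (b, i)).1 ≤ R.rows.length := by
    rw [Col.bd]; split_ifs <;> simp
  have hP' : P' = ⟨c, b⟩ := by
    rw [← Option.some_inj, ← hP2, ← hP, Diagram.ptAt, h.word _ hle]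
  subst hP'
  obtain ⟨z, j⟩ := z
  rcases hPz : (R.word z)[j]? with _ | Q
  · rw [R.next_of_none hPz] at hz; simp at hz
  have hQ (hle : z ≤ R.rows.length) : Q = P := by
    rw [← Option.some_inj, ← hPz, ← hP1, Diagram.ptAt, h.word _ hle]
  simp only at h1 h2
  cases b
  · simp only [Col.bd, Bool.false_eq_true, if_false, add_zero, false_and, or_false] at h2
    rcases h1 with ⟨-, h1⟩ | ⟨h1, h3⟩
    · omega
    · obtain rfl : z = 0 := by omega
      rw [R.next_of_up_zero hPz (by rw [hQ (Nat.zero_le _), h1])] at hz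
      simp at hz
  · simp only [Col.bd, if_true, Bool.true_eq_false, false_and, false_or, true_and] at h2
    rcases h1 with ⟨h1, h3⟩ | ⟨h1, h3⟩
    · obtain rfl : z = R.rows.length := by omega
      rw [R.next_of_down hPz (by rw [hQ le_rfl, h1]), List.getElem?_eq_none le_rfl] at hz
      simp at hz
    · obtain rfl : z = R.rows.length + 1 := by omega
      simp [Col.word] at hPz

end Region

lemma Col.next_le {C : Col} {x y : ℕ × ℕ} (hxy : C.next x = some y) : y.1 ≤ C.rows.length := by
  obtain ⟨m, i⟩ := x
  rcases hP : (C.word m)[i]? with _ | P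
  · rw [C.next_of_none hP] at hxy; simp at hxy
  rcases hu : P.up with _ | _
  · rw [C.next_of_down hP hu, Option.map_eq_some_iff] at hxy
    obtain ⟨r, hr, rfl⟩ := hxy
    have := (List.getElem?_eq_some_iff.1 hr).1
    rcases rowDown r i with j | j <;> simp only <;> omega
  · cases m with
    | zero => rw [C.next_of_up_zero hP hu] at hxy; simp at hxy
    | succ m =>
      rw [C.next_of_up hP hu, Option.map_eq_some_iff] at hxy
      obtain ⟨r, hr, rfl⟩ := hxy
      have := (List.getElem?_eq_some_iff.1 hr).1
      rcases rowUp r i with j | j <;> simp only <;> omega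

/-! ### Contracting the strands inside a part -/

section Replacement

variable {D D' : Diagram} {p q q' : ℕ} {K : Type*} {ent ext : K → Bool × ℕ} {thk : K → Bool}

/-- The points which are strictly outside of a part of a diagram. -/
abbrev OuterNode (D : Diagram) (p q : ℕ) : Type :=
  {c : Bool × ℕ × ℕ // (if c.1 then 0 < c.2.1 else c.2.1 < p) ∧
    (outerPoint p q c).2 < (D.word (outerPoint p q c).1).length}

/-- The coordinates of a boundary point of a part of a diagram. -/
def boundaryPoint (p : ℕ) (x : Bool × ℕ) : Bool × ℕ × ℕ := (x.1, if x.1 then 0 else p, x.2)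

/-- The coordinates of the outer points and of the ends of the strands inside. -/
def endPoint (D : Diagram) (p q : ℕ) (e : K → Bool × ℕ) : OuterNode D p q ⊕ K → Bool × ℕ × ℕ :=
  Sum.elim (fun u => u.1) fun k => boundaryPoint p (e k)

lemma endPoint_inl (e : K → Bool × ℕ) (u : OuterNode D p q) : endPoint D p q e (.inl u) = u.1 := rfl

lemma endPoint_inr (e : K → Bool × ℕ) (k : K) :
    endPoint D p q e (.inr k) = boundaryPoint p (e k) := rfl

lemma outerPoint_boundaryPoint {R : Col} (hR : R.rows.length = q) (x : Bool × ℕ) :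
    outerPoint p q (boundaryPoint p x) = (p + (R.bd x).1, (R.bd x).2) := by
  obtain ⟨_ | _, i⟩ := x <;> simp [outerPoint, boundaryPoint, Col.bd, hR]

/-- If the part is empty (`q = 0`), its upper and lower boundary are the same level, so positions
alone do not separate the ends; the direction of the strand does. The Boolean `s` covers both
entries (`false`) and exits (`true`). -/
lemma endPoint_injective {e : K → Bool × ℕ} (he : Function.Injective e) (s : Bool)
    (hp : ∀ k, ∃ c, D.ptAt (outerPoint p q (boundaryPoint p (e k))) = some ⟨c, xor s (e k).1⟩) :
    Function.Injective fun o => outerPoint p q (endPoint D p q e o) := by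
  rintro (⟨⟨b, m, i⟩, h1, h2⟩ | k) (⟨⟨b', m', i'⟩, h1', h2'⟩ | k') h
  · replace h : outerPoint p q (b, m, i) = outerPoint p q (b', m', i') := h
    simp only [outerPoint, Prod.mk.injEq] at h
    congr 2
    cases b <;> cases b' <;> simp at h1 h1' h ⊢ <;> omega
  · exfalso
    replace h : outerPoint p q (b, m, i) = outerPoint p q (boundaryPoint p (e k')) := h
    simp only [outerPoint, boundaryPoint, Prod.mk.injEq] at h
    cases b <;> cases hb : (e k').1 <;> simp [hb] at h1 h <;> omega
  · exfalso
    replace h : outerPoint p q (boundaryPoint p (e k)) = outerPoint p q (b', m', i') := h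
    simp only [outerPoint, boundaryPoint, Prod.mk.injEq] at h
    cases b' <;> cases hb : (e k).1 <;> simp [hb] at h1' h <;> omega
  · simp only [endPoint_inr] at h
    obtain ⟨c, hc⟩ := hp k
    obtain ⟨c', hc'⟩ := hp k'
    rw [h, hc', Option.some_inj, Pt.mk.injEq] at hc
    have h1 : (e k).1 = (e k').1 := by
      have := hc.2
      revert this
      cases s <;> cases (e k).1 <;> cases (e k').1 <;> simp
    congr 1
    refine he (Prod.ext h1 ?_)
    simpa [outerPoint, boundaryPoint] using congrArg Prod.snd h

variable {R : Col} {tl : K → List (ℕ × ℕ)} {vis : K → List (ℕ × Bool)}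

/-- The points of a strand after its first one; outside, all strands consist of one point. -/
def tailPoints (D : Diagram) (p q : ℕ) (tl : K → List (ℕ × ℕ)) :
    OuterNode D p q ⊕ K → List (ℕ × ℕ) :=
  Sum.elim (fun _ => []) fun k => (tl k).map fun x => (p + x.1, x.2)

namespace Region

lemma path_inr (hq : R.rows.length = q) (k : K) : outerPoint p q (endPoint D p q ent (.inr k)) ::
    tailPoints D p q tl (.inr k) = (R.bd (ent k) :: tl k).map fun x => (p + x.1, x.2) := by
  rw [List.map_cons]
  exact congrArg (· :: _) (outerPoint_boundaryPoint hq _)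

lemma path_last (S : R.Strands ent ext thk tl vis) (hq : R.rows.length = q)
    (o : OuterNode D p q ⊕ K) : (outerPoint p q (endPoint D p q ent o) ::
    tailPoints D p q tl o).getLast (List.cons_ne_nil _ _) =
      outerPoint p q (endPoint D p q ext o) := by
  rcases o with u | k
  · rfl
  · simp only [path_inr hq]
    rw [List.getLast_map, S.last]
    exact (outerPoint_boundaryPoint hq _).symm

variable (h : Region D p R) (S : R.Strands ent ext thk tl vis) (hq : R.rows.length = q)
include h S hq

lemma ptAt_ent (k : K) : D.ptAt (outerPoint p q (boundaryPoint p (ent k))) =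
    some ⟨thk k, (ent k).1⟩ := by
  rw [outerPoint_boundaryPoint hq, Diagram.ptAt, h.word _ (by rw [Col.bd]; split_ifs <;> simp)]
  exact S.ent_pt k

lemma ptAt_ext (k : K) : D.ptAt (outerPoint p q (boundaryPoint p (ext k))) =
    some ⟨thk k, !(ext k).1⟩ := by
  rw [outerPoint_boundaryPoint hq, Diagram.ptAt, h.word _ (by rw [Col.bd]; split_ifs <;> simp)]
  exact S.ext_pt k

lemma exists_path (y : D.Node) : ∃ o, y.1 ∈ outerPoint p q (endPoint D p q ent o) ::
    tailPoints D p q tl o := by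
  obtain ⟨⟨m, i⟩, hy⟩ := y
  by_cases h1 : m < p
  · exact ⟨.inl ⟨(false, m, i), by simpa using h1, by simpa [outerPoint] using hy⟩,
      List.mem_cons.2 (Or.inl rfl)⟩
  by_cases h2 : p + q < m
  · obtain ⟨j, rfl⟩ : ∃ j, m = p + q + j := ⟨m - (p + q), by omega⟩
    exact ⟨.inl ⟨(true, j, i), by simp; omega, by simpa [outerPoint] using hy⟩,
      List.mem_cons.2 (Or.inl rfl)⟩
  obtain ⟨j, rfl⟩ : ∃ j, m = p + j := ⟨m - p, by omega⟩
  obtain ⟨k, hk⟩ := S.cover j (by omega) i (by rw [← h.word j (by omega)]; exact hy)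
  refine ⟨.inr k, ?_⟩
  rw [path_inr hq]
  exact List.mem_map.2 ⟨_, hk, rfl⟩

lemma outward (o : OuterNode D p q ⊕ K) : Outward D p q (endPoint D p q ext o) := by
  rcases o with ⟨⟨b, m, i⟩, h1, h2⟩ | k
  · cases b
    · simp only [Bool.false_eq_true, if_false] at h1
      simp only [Outward, endPoint_inl, Bool.false_eq_true, if_false]
      exact ⟨by omega, by omega⟩
    · simp only [if_true] at h1
      simp only [Outward, endPoint_inl, if_true]
      omega
  · have := h.ptAt_ext S hq k
    simp only [Outward, endPoint_inr]
    rw [this]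
    cases hb : (ext k).1 <;> simp [boundaryPoint, hb]

/-- A boundary point reached from outside is on some inside strand. By `not_next_eq` it has no
predecessor inside, so it is the first point of this strand. -/
lemma exists_endPoint {c : Bool × ℕ × ℕ} (hc : FromOutside D p q c) {P : Pt}
    (hP : D.ptAt (outerPoint p q c) = some P) : ∃ o, c = endPoint D p q ent o := by
  by_cases h0 : (if c.1 then 0 < c.2.1 else c.2.1 < p)
  · exact ⟨.inl ⟨c, h0, (D.ptAt_isSome_iff _).1 ⟨P, hP⟩⟩, rfl⟩
  obtain ⟨b, m, i⟩ := c
  have hm : m = if b then 0 else p := by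
    cases b <;> simp [FromOutside] at hc h0 ⊢ <;> omega
  have hcb : ((b, m, i) : Bool × ℕ × ℕ) = boundaryPoint p (b, i) := by simp [boundaryPoint, hm]
  have hPb : P.up = b := by
    cases b <;> simp only [FromOutside, if_true, Bool.false_eq_true, if_false] at hc hm
    · exact hc.2 hm P hP
    · exact hc hm P hP
  rw [hcb, outerPoint_boundaryPoint hq] at hP
  have hle : (R.bd (b, i)).1 ≤ R.rows.length := by rw [Col.bd]; split_ifs <;> simp
  rw [Diagram.ptAt, h.word _ hle] at hP
  obtain ⟨k, hk⟩ := S.cover _ hle _ (List.getElem?_eq_some_iff.1 hP).1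
  refine ⟨.inr k, ?_⟩
  have hP' : (R.word (R.bd (b, i)).1)[(R.bd (b, i)).2]? = some ⟨P.thick, b⟩ := by
    rw [hP, ← hPb]
  rcases List.mem_cons.1 hk with hk | hk
  · have h2 := S.ent_pt k
    rw [← hk, hP', Option.some_inj, Pt.mk.injEq] at h2
    rw [hcb, endPoint_inr]
    congr 1
    exact Prod.ext h2.2 (by simpa [Col.bd] using congrArg Prod.snd hk)
  · obtain ⟨z, -, hz⟩ := chain_prev (S.chain k) hk
    exact absurd hz (h.not_next_eq hP')

/-- Every node is an outer node or on an inside strand, and entries have no predecessor inside.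
Contracting the inside strands therefore loses nothing about how the components close up. -/
lemma isExpansion {g : OuterNode D p q ⊕ K → Option (OuterNode D p q ⊕ K)}
    (hg : ∀ o, D.next (outerPoint p q (endPoint D p q ext o)) =
      (g o).map fun o => outerPoint p q (endPoint D p q ent o)) :
    IsExpansion g D.next (fun o => outerPoint p q (endPoint D p q ent o))
      (tailPoints D p q tl) := by
  have hinj := endPoint_injective (D := D) (p := p) (q := q) S.ent_inj false fun k =>
    ⟨_, by rw [Bool.false_xor]; exact h.ptAt_ent S hq k⟩
  refine ⟨?_, fun o => ?_, hinj, ?_, ?_⟩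
  · rintro (u | k)
    · exact List.isChain_singleton _
    · rw [path_inr hq]
      exact List.isChain_map_of_isChain _ (fun _ _ hab => h.next hab) (S.chain k)
  · rw [path_last S hq, hg]
  · intro o o' ho
    rcases o' with u' | k'
    · simp [tailPoints] at ho
    obtain ⟨y, hy, hyo⟩ := List.mem_map.1 ho
    obtain ⟨z, -, hz⟩ := chain_prev (S.chain k') hy
    have hle := Col.next_le hz
    rcases o with ⟨⟨b, m, i⟩, h1, h2⟩ | k
    · replace hyo : (p + y.1, y.2) = outerPoint p q (b, m, i) := hyo
      simp only [outerPoint, Prod.mk.injEq] at hyo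
      cases b <;> simp at h1 hyo <;> omega
    · simp only [endPoint_inr, outerPoint_boundaryPoint hq, Prod.mk.injEq] at hyo
      obtain rfl : y = R.bd (ent k) := Prod.ext (by omega) hyo.2
      exact h.not_next_eq (S.ent_pt k) hz
  · intro o y hy
    obtain ⟨m, L, P, P', -, hP, -⟩ := D.next_spec hy
    exact h.exists_path S hq ⟨y, (D.ptAt_isSome_iff _).1 ⟨P, hP⟩⟩

end Region

end Replacement

/-! ### Labels inside and outside of a part -/

section Labels

variable {k A : Type*} [Field k] [Ring A] [HopfAlgebra k A] {ι : Type*}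
  (e : Module.Basis ι k A)

lemma evalWord_nodeLabel (D : Diagram) (t : List (Option ι)) (c : Bool) (l : List (ℕ × ℕ)) :
    evalWord c (l.map (nodeLabel e D t)) =
      evalWord c ((l.filterMap D.tok).map (tokLabel e D.slices t)) := by
  induction l with
  | nil => rfl
  | cons x l ih =>
    rw [List.map_cons, evalWord_cons, ih]
    rcases hx : D.tok x with _ | v
    · rw [List.filterMap_cons_none hx]
      simp only [nodeLabel, hx, HC.of_one, mul_one]
    · rw [List.filterMap_cons_some hx, List.map_cons, evalWord_cons]
      simp only [nodeLabel, hx]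

variable {pre X post : List Slice} {t₁ t₂ t₃ : List (Option ι)}

lemma tokLabel_pre (h₁ : t₁.length = pre.length) {m : ℕ} (hm : m < pre.length) (u : Bool) :
    tokLabel e (pre ++ (X ++ post)) (t₁ ++ (t₂ ++ t₃)) (m, u) = tokLabel e pre t₁ (m, u) := by
  simp only [tokLabel, List.getElem?_append_left hm, List.getElem?_append_left (h₁ ▸ hm)]

lemma tokLabel_mid (h₁ : t₁.length = pre.length) (h₂ : t₂.length = X.length) {m : ℕ}
    (hm : m < X.length) (u : Bool) :
    tokLabel e (pre ++ (X ++ post)) (t₁ ++ (t₂ ++ t₃)) (pre.length + m, u) =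
      tokLabel e X t₂ (m, u) := by
  have h1 : (pre ++ (X ++ post))[pre.length + m]? = X[m]? := by
    rw [List.getElem?_append_right (by omega), Nat.add_sub_cancel_left,
      List.getElem?_append_left hm]
  have h2 : (t₁ ++ (t₂ ++ t₃))[pre.length + m]? = t₂[m]? := by
    rw [List.getElem?_append_right (by omega), h₁, Nat.add_sub_cancel_left,
      List.getElem?_append_left (h₂ ▸ hm)]
  simp only [tokLabel, h1, h2]

lemma tokLabel_post (h₁ : t₁.length = pre.length) (h₂ : t₂.length = X.length) (m : ℕ) (u : Bool) :
    tokLabel e (pre ++ (X ++ post)) (t₁ ++ (t₂ ++ t₃)) (pre.length + X.length + m, u) =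
      tokLabel e post t₃ (m, u) := by
  have h1 : (pre ++ (X ++ post))[pre.length + X.length + m]? = post[m]? := by
    rw [List.getElem?_append_right (by omega), List.getElem?_append_right (by omega)]
    congr 1; omega
  have h2 : (t₁ ++ (t₂ ++ t₃))[pre.length + X.length + m]? = t₃[m]? := by
    rw [List.getElem?_append_right (by omega), List.getElem?_append_right (by omega)]
    congr 1; omega
  simp only [tokLabel, h1, h2]

/-- From an outward point only crossings of `pre` and `post` are traversed, so the states `t₂` and
`t₂'` of the replaced parts need not be related. -/
lemma AgreeOutside.nodeLabel {D D' : Diagram} {X' : List Slice} {t₂' : List (Option ι)}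
    (H : AgreeOutside D D' pre.length X.length X'.length) (hD : D.slices = pre ++ (X ++ post))
    (hD' : D'.slices = pre ++ (X' ++ post)) (h₁ : t₁.length = pre.length)
    (h₂ : t₂.length = X.length) (h₂' : t₂'.length = X'.length) {c : Bool × ℕ × ℕ}
    (hc : Outward D pre.length X.length c) :
    nodeLabel e D (t₁ ++ (t₂ ++ t₃)) (outerPoint pre.length X.length c) =
      nodeLabel e D' (t₁ ++ (t₂' ++ t₃)) (outerPoint pre.length X'.length c) := by
  rcases H.tok c hc with ⟨h, h'⟩ | ⟨m, u, hm, h, h'⟩ | ⟨m, u, h, h'⟩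
  · simp only [ColTri.nodeLabel, h, h']
  · simp only [ColTri.nodeLabel, h, h', hD, hD', tokLabel_pre e h₁ hm]
  · simp only [ColTri.nodeLabel, h, h', hD, hD', tokLabel_post e h₁ h₂, tokLabel_post e h₁ h₂']

end Labels

section Evaluation

variable {k A : Type*} [Field k] [Ring A] [HopfAlgebra k A] {ι : Type*}
  (e : Module.Basis ι k A) {K : Type*}

/-- The products of the labels along the strands of a part of a diagram. -/
noncomputable def stateVal (thk : K → Bool) (X : List Slice) (vis : K → List (ℕ × Bool))
    (t : List (Option ι)) (j : K) : Heis k A :=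
  (HC.of k A (thk j)).symm (evalWord (thk j) ((vis j).map (tokLabel e X t)))

/-- Two parts of diagrams with the same strands have the same invariants. -/
def SameSum [Fintype ι] (W : Type*) [AddCommGroup W] [Module k W] (thk : K → Bool)
    (X X' : List Slice) (vis vis' : K → List (ℕ × Bool)) : Prop :=
  ∀ G : MultilinearMap k (fun _ : K => Heis k A) W,
    stateSum X (fun t => G (stateVal e thk X vis t)) =
      stateSum X' fun t => G (stateVal e thk X' vis' t)

/-- The product of two elements of `H(A)` or of `H(A)^op`. -/
noncomputable def mulLeftHC (c : Bool) (x : Heis k A) : Heis k A →ₗ[k] Heis k A :=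
  (HC.of k A c).symm.toLinearMap ∘ₗ LinearMap.mulLeft k (HC.of k A c x) ∘ₗ (HC.of k A c).toLinearMap

lemma of_mulLeftHC (c : Bool) (x : Heis k A) (y : HC k A c) :
    HC.of k A c (mulLeftHC c x ((HC.of k A c).symm y)) = HC.of k A c x * y := by
  simp [mulLeftHC]

lemma evalWord_flatMap {O N : Type*} (c : Bool) (l : List O) (path : O → List N) (y : N → Heis k A)
    (Λ : O → Heis k A) (h : ∀ o ∈ l, evalWord c ((path o).map y) = HC.of k A c (Λ o)) :
    evalWord c ((l.flatMap path).map y) = evalWord c (l.map Λ) := by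
  induction l with
  | nil => rfl
  | cons o l ih =>
    rw [List.flatMap_cons, List.map_append, evalWord_append, List.map_cons, evalWord_cons,
      ih fun o ho => h o (List.mem_cons_of_mem _ ho), h o (by simp)]

namespace Region

variable {D : Diagram} {R : Col} {ent ext : K → Bool × ℕ} {thk : K → Bool}
  {tl : K → List (ℕ × ℕ)} {vis : K → List (ℕ × Bool)} {pre X post : List Slice}
  {t₁ t₂ t₃ : List (Option ι)}

/-- All points of an inside strand except the exit point see only crossings of `X`. The label of the
exit point belongs to the exterior; as words are read against the orientation, it becomes a factor
on the left. -/
lemma evalWord_path (h : Region D pre.length R) (S : R.Strands ent ext thk tl vis)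
    (hq : R.rows.length = X.length) (hD : D.slices = pre ++ (X ++ post))
    (h₁ : t₁.length = pre.length) (h₂ : t₂.length = X.length) (j : K) :
    evalWord (thk j) ((outerPoint pre.length X.length (endPoint D pre.length X.length ent (.inr j)) ::
      tailPoints D pre.length X.length tl (.inr j)).map (nodeLabel e D (t₁ ++ (t₂ ++ t₃)))) =
    HC.of k A (thk j) (mulLeftHC (thk j) (nodeLabel e D (t₁ ++ (t₂ ++ t₃))
      (outerPoint pre.length X.length (endPoint D pre.length X.length ext (.inr j))))
        (stateVal e thk X vis t₂ j)) := by
  rw [stateVal, of_mulLeftHC]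
  conv_lhs => rw [← List.dropLast_append_getLast (List.cons_ne_nil (outerPoint pre.length X.length
    (endPoint D pre.length X.length ent (.inr j))) (tailPoints D pre.length X.length tl (.inr j)))]
  rw [path_last S hq, List.map_append, evalWord_append, List.map_singleton, evalWord_cons,
    evalWord_nil, one_mul, path_inr hq]
  congr 1
  rw [evalWord_nodeLabel, ← List.map_dropLast]
  have h3 := S.emb_vis h.emb j
  have hm : (Col.Emb.map pre.length fun _ => 0) = fun x : ℕ × ℕ => (pre.length + x.1, x.2) := by
    funext x; simp [Col.Emb.map]
  have ht : D.col.tok = D.tok := funext D.col_tok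
  rw [hm, ht] at h3
  rw [h3, List.map_map, hD]
  congr 1
  refine List.map_congr_left fun v hv => tokLabel_mid e h₁ h₂ ?_ _
  rw [← S.vis_eq j, List.mem_filterMap] at hv
  obtain ⟨⟨m, i⟩, -, hv⟩ := hv
  rw [← hq]
  rcases hP : (R.word m)[i]? with _ | P
  · simp [Col.tok, hP] at hv
  rcases hu : P.up with _ | _
  · rw [R.tok_of_down hP hu, Option.bind_eq_some_iff] at hv
    obtain ⟨r, hr, hv⟩ := hv
    rw [Option.map_eq_some_iff] at hv
    obtain ⟨u, -, rfl⟩ := hv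
    exact (List.getElem?_eq_some_iff.1 hr).1
  · cases m with
    | zero => rw [R.tok_of_up_zero hP hu] at hv; simp at hv
    | succ m =>
      rw [R.tok_of_up hP hu, Option.bind_eq_some_iff] at hv
      obtain ⟨r, hr, hv⟩ := hv
      rw [Option.map_eq_some_iff] at hv
      obtain ⟨u, -, rfl⟩ := hv
      exact (List.getElem?_eq_some_iff.1 hr).1

end Region

end Evaluation

lemma IsExpansion.reindex {N O O' : Type*} {f : N → Option N} {g : O → Option O}
    {g' : O' → Option O'} {hd : O' → N} {tl : O' → List N} (h : IsExpansion g' f hd tl)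
    (φ : O ≃ O') (hg : ∀ o, g' (φ o) = (g o).map φ) :
    IsExpansion g f (fun o => hd (φ o)) fun o => tl (φ o) := by
  refine ⟨fun o => h.chain _, fun o => ?_, h.inj.comp φ.injective, fun o o' => h.tail _ _,
    fun o y hy => ?_⟩
  · rw [h.last, hg, Option.map_map]
    rfl
  · obtain ⟨o', ho'⟩ := h.cover _ y hy
    exact ⟨φ.symm o', by simpa using ho'⟩

/-! ### Locality of `J'` -/

section Invariance

variable {k A : Type*} [Field k] [Ring A] [HopfAlgebra k A] {ι : Type*} [Fintype ι]
  (e : Module.Basis ι k A) {K : Type*} {n : ℕ} {μ ν : Fin n → Bool}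
  {ent ext : K → Bool × ℕ} {thk : K → Bool}

/-- The outer points of two diagrams which agree outside of some parts. -/
def AgreeOutside.equiv {D D' : Diagram} {p q q' : ℕ} (H : AgreeOutside D D' p q q') (K : Type*) :
    OuterNode D p q ⊕ K ≃ OuterNode D' p q' ⊕ K :=
  Equiv.sumCongr (Equiv.subtypeEquivRight fun c => by
    refine and_congr_right fun hc => ?_
    rw [← D.ptAt_isSome_iff, ← D'.ptAt_isSome_iff, H.ptAt_eq c fun h => by
      simp only [h, Bool.false_eq_true, if_false] at hc; exact hc.le]) (Equiv.refl K)

lemma AgreeOutside.endPoint_equiv {D D' : Diagram} {p q q' : ℕ} (H : AgreeOutside D D' p q q')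
    {e : K → Bool × ℕ} (o : OuterNode D p q ⊕ K) :
    endPoint D' p q' e (H.equiv K o) = endPoint D p q e o := by
  rcases o with u | j <;> rfl

/-- From the exit of an inside strand, or from an outer node, both diagrams reach the entry of the
same inside strand or the same outer node. So one contracted map serves for both. -/
lemma exists_next {D D' : Diagram} {p q q' : ℕ} (H : AgreeOutside D D' p q q') {R : Col}
    {tl : K → List (ℕ × ℕ)} {vis : K → List (ℕ × Bool)} (h : Region D p R)
    (S : R.Strands ent ext thk tl vis) (hq : R.rows.length = q) (o : OuterNode D p q ⊕ K) :
    ∃ g : Option (OuterNode D p q ⊕ K),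
      D.next (outerPoint p q (endPoint D p q ext o)) =
        g.map (fun o => outerPoint p q (endPoint D p q ent o)) ∧
      D'.next (outerPoint p q' (endPoint D p q ext o)) =
        g.map fun o => outerPoint p q' (endPoint D p q ent o) := by
  rcases H.next _ (h.outward S hq o) with ⟨h1, h2⟩ | ⟨c, hc, h1, h2⟩
  · exact ⟨none, h1, h2⟩
  · obtain ⟨m, L, P, P', -, -, hP', -⟩ := D.next_spec h1
    obtain ⟨o', rfl⟩ := h.exists_endPoint S hq hc hP'
    exact ⟨some o', h1, h2⟩

variable {pre X X' post : List Slice}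

/-- Replacing a part of a diagram by another one with the same strands and the same invariants. -/
theorem J_eq_of_sameSum (hγ : Function.Bijective (HopfAlgebra.antipode k : A →ₗ[k] A))
    (Z Z' : CD μ ν) {R R' : Col} {tl tl' : K → List (ℕ × ℕ)} {vis vis' : K → List (ℕ × Bool)}
    (H : AgreeOutside Z.toDiagram Z'.toDiagram pre.length X.length X'.length)
    (hD : Z.slices = pre ++ (X ++ post)) (hD' : Z'.slices = pre ++ (X' ++ post))
    (h : Region Z.toDiagram pre.length R) (h' : Region Z'.toDiagram pre.length R')
    (S : R.Strands ent ext thk tl vis) (S' : R'.Strands ent ext thk tl' vis')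
    (hq : R.rows.length = X.length) (hq' : R'.rows.length = X'.length)
    (hcomp : ∀ (x : Z.Node) (x' : Z'.Node), SameLevel pre.length X.length X'.length x.1.1 x'.1.1 →
      x.1.2 = x'.1.2 → Z.comp x = Z'.comp x')
    (hsum : SameSum e (⨂[k] i, Factor k A (μ i) (ν i)) thk X X' vis vis') : Z.J e = Z'.J e := by
  classical
  set p := pre.length with hp
  set q := X.length with hqX
  set q' := X'.length with hqX'
  let O := OuterNode Z.toDiagram p q ⊕ K
  choose g hg using exists_next H h S hq
  let hd : O → ℕ × ℕ := fun o => outerPoint p q (endPoint Z.toDiagram p q ent o)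
  let tlZ : O → List (ℕ × ℕ) := tailPoints Z.toDiagram p q tl
  let hd' : O → ℕ × ℕ := fun o => outerPoint p q' (endPoint Z.toDiagram p q ent o)
  let tlZ' : O → List (ℕ × ℕ) := fun o => tailPoints Z'.toDiagram p q' tl' (H.equiv K o)
  have hE : IsExpansion g Z.next hd tlZ := h.isExpansion S hq fun o => (hg o).1
  have hE' : IsExpansion g Z'.next hd' tlZ' := by
    have h1 := (h'.isExpansion S' hq' (g := fun o => (g ((H.equiv K).symm o)).map (H.equiv K))
      fun o => by
        obtain ⟨o, rfl⟩ := (H.equiv K).surjective o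
        rw [H.endPoint_equiv, (hg o).2, Equiv.symm_apply_apply, Option.map_map]
        congr 1
        funext o
        simp only [Function.comp_apply, H.endPoint_equiv]).reindex (H.equiv K) (g := g)
      fun o => by rw [Equiv.symm_apply_apply]
    simpa only [H.endPoint_equiv] using h1
  have hnode (o : O) : (hd o).2 < (Z.word (hd o).1).length := by
    rcases o with u | j
    · exact u.2.2
    · exact (Z.ptAt_isSome_iff _).1 ⟨_, h.ptAt_ent S hq j⟩
  have hnode' (o : O) : (hd' o).2 < (Z'.word (hd' o).1).length := by
    rcases o with u | j
    · obtain ⟨P, hP⟩ := (Z.ptAt_isSome_iff _).2 u.2.2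
      refine (Z'.ptAt_isSome_iff _).1 ⟨P, ?_⟩
      rw [← hP]
      refine (H.ptAt_eq u.1 fun h => ?_).symm
      have := u.2.1
      simp only [h, Bool.false_eq_true, if_false] at this
      exact this.le
    · exact (Z'.ptAt_isSome_iff _).1 ⟨_, h'.ptAt_ent S' hq' j⟩
  have hcompE (o : O) : Z'.comp ⟨hd' o, hnode' o⟩ = Z.comp ⟨hd o, hnode o⟩ := by
    refine (hcomp _ _ ?_ rfl).symm
    obtain ⟨c, hc, hc'⟩ : ∃ c, endPoint Z.toDiagram p q ent o = c ∧ (c.1 = false → c.2.1 ≤ p) := by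
      refine ⟨_, rfl, fun hb => ?_⟩
      rcases o with u | j
      · have := u.2.1
        replace hb : u.1.1 = false := hb
        simp only [hb, Bool.false_eq_true, if_false] at this
        exact this.le
      · rw [endPoint_inr, boundaryPoint] at hb ⊢
        simp only at hb
        simp [hb]
    obtain ⟨b, m, i⟩ := c
    simp only [hd, hd', hc, outerPoint]
    cases b
    · exact Or.inl ⟨hc' rfl, rfl⟩
    · exact Or.inr ⟨m, rfl, rfl⟩
  -- Injectivity is inherited from `next`, because distinct contracted points have distinct exits.
  have hgP : PInj g := fun a b c ha hb => by
    refine endPoint_injective (D := Z.toDiagram) (p := p) (q := q) S.ext_inj true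
      (fun j => ⟨thk j, by rw [Bool.true_xor]; exact h.ptAt_ext S hq j⟩)
      (Z.next_pInj _ _ (hd c) ?_ ?_)
    · simp only [(hg a).1, ha]; rfl
    · simp only [(hg b).1, hb]; rfl
  have hfin : Finite O := by
    have : Finite Z.Node := Z.toDiagram.finite_node
    exact Finite.of_injective (β := Z.Node) (fun o => ⟨hd o, hnode o⟩) fun a b hab =>
      hE.inj (congrArg Subtype.val hab)
  -- The orbits are chosen for the contracted map and then expanded in both diagrams, which keeps
  -- the order along the components comparable.
  have hor (i : Fin n) : ∃ o l, IsOrbit g o l ∧ Z.comp ⟨hd o, hnode o⟩ = i := by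
    obtain ⟨x, hx⟩ := Z.comp_surjective i
    obtain ⟨o', ho'⟩ := h.exists_path S hq x
    obtain ⟨o, l, ho, hl⟩ := exists_orbit hgP o'
    refine ⟨o, l, ho, ?_⟩
    rw [← hx, ← (Z.orbit_mem_iff (hE.isOrbit ho) (hnode o) x).1 ?_]
    have : x.1 ∈ (o :: l).flatMap fun o => hd o :: tlZ o := List.mem_flatMap.2 ⟨o', hl, ho'⟩
    rw [List.flatMap_cons, List.cons_append] at this
    exact this
  choose o l ho hoi using hor
  have hfam : Z.IsOrbitFamily (fun i => hd (o i))
      fun i => tlZ (o i) ++ (l i).flatMap fun o => hd o :: tlZ o :=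
    ⟨fun i => hE.isOrbit (ho i), fun i => ⟨hnode _, hoi i⟩⟩
  have hfam' : Z'.IsOrbitFamily (fun i => hd' (o i))
      fun i => tlZ' (o i) ++ (l i).flatMap fun o => hd' o :: tlZ' o :=
    ⟨fun i => hE'.isOrbit (ho i), fun i => ⟨hnode' _, (hcompE _).trans (hoi i)⟩⟩
  have hmem (i : Fin n) (t : O) : t ∈ o i :: l i ↔ Z.comp ⟨hd t, hnode t⟩ = i := by
    have h1 := Z.orbit_mem_iff (hE.isOrbit (ho i)) (hnode _) ⟨hd t, hnode t⟩
    rw [hoi] at h1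
    rw [← h1]
    have h2 : hd (o i) :: (tlZ (o i) ++ (l i).flatMap fun o => hd o :: tlZ o) =
      (o i :: l i).flatMap fun o => hd o :: tlZ o := by simp
    rw [h2, List.mem_flatMap]
    constructor
    · exact fun ht => ⟨t, ht, by simp⟩
    · rintro ⟨o', ho', ht⟩
      rcases List.mem_cons.1 ht with ht | ht
      · exact hE.inj ht ▸ ho'
      · exact absurd ht (hE.tail _ _)
  have hos : OccursOnce fun i => o i :: l i :=
    ⟨fun i => (ho i).nodup hgP, fun t => ⟨_, (hmem _ t).2 rfl⟩,
      fun t i j hi hj => ((hmem i t).1 hi).symm.trans ((hmem j t).1 hj)⟩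
  have hthk (i : Fin n) (j : K) (hj : Sum.inr j ∈ o i :: l i) : thk j = μ i := by
    rw [← (hmem i _).1 hj]
    refine Eq.trans ?_ (Z.thick_eq _)
    have h1 := h.ptAt_ent S hq j
    rw [Diagram.ptAt] at h1
    obtain ⟨h2, h3⟩ := List.getElem?_eq_some_iff.1 h1
    exact (congrArg Pt.thick h3).symm
  -- The labels at the exits. They do not depend on the state of the part, for which a list of
  -- `none` of the right length is inserted.
  let E (t₁ t₃ : List (Option ι)) (o : O) : Heis k A :=
    nodeLabel e Z'.toDiagram (t₁ ++ (List.replicate q' none ++ t₃))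
      (outerPoint p q' (endPoint Z.toDiagram p q ext o))
  -- With the state outside fixed, the product along each inside strand enters one word as a single
  -- letter, multiplied by the label at its exit. Hence the result is multilinear in these products.
  let G (t₁ t₃ : List (Option ι)) :
      MultilinearMap k (fun _ : K => Heis k A) (⨂[k] i, Factor k A (μ i) (ν i)) :=
    ((wordMap k A μ ν (fun i => o i :: l i) hos).currySum fun u => E t₁ t₃ (.inl u)).compLinearMap
      fun j => mulLeftHC (thk j) (E t₁ t₃ (.inr j))
  have key (t₁ t₃ : List (Option ι)) (hd₀ : O → ℕ × ℕ) (tl₀ : O → List (ℕ × ℕ))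
      (y : ℕ × ℕ → Heis k A) (x : K → Heis k A) (h1 : ∀ u, y (hd₀ (.inl u)) = E t₁ t₃ (.inl u))
      (h2 : ∀ u, tl₀ (.inl u) = [])
      (h3 : ∀ j, evalWord (thk j) ((hd₀ (.inr j) :: tl₀ (.inr j)).map y) =
        HC.of k A (thk j) (mulLeftHC (thk j) (E t₁ t₃ (.inr j)) (x j))) :
      wordTensor μ ν (fun i => hd₀ (o i) :: (tl₀ (o i) ++ (l i).flatMap fun o => hd₀ o :: tl₀ o)) y
        = G t₁ t₃ x := by
    have h4 : G t₁ t₃ x = wordTensor μ ν (fun i => o i :: l i) (Sum.elim (fun u => E t₁ t₃ (.inl u))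
        fun j => mulLeftHC (thk j) (E t₁ t₃ (.inr j)) (x j)) := by
      simp only [G, MultilinearMap.compLinearMap_apply, MultilinearMap.currySum_apply]
      change wordTensor μ ν _ _ = _
      congr 1
    rw [h4, wordTensor, wordTensor]
    congr 1
    funext i
    congr 1
    have h5 : hd₀ (o i) :: (tl₀ (o i) ++ (l i).flatMap fun o => hd₀ o :: tl₀ o) =
      (o i :: l i).flatMap fun o => hd₀ o :: tl₀ o := by simp
    rw [h5]
    refine evalWord_flatMap _ _ _ _ _ fun t ht => ?_
    rcases t with u | j
    · rw [h2, List.map_singleton, evalWord_cons, evalWord_nil, one_mul, h1]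
      rfl
    · rw [← hthk i j ht, h3]
      rfl
  have hout (t : O) : Outward Z.toDiagram p q (endPoint Z.toDiagram p q ext t) := h.outward S hq t
  rw [J_eq_orbits e hγ Z hfam, J_eq_orbits e hγ Z' hfam', sum_stateList Z.toDiagram (fun t =>
    wordTensor μ ν _ (nodeLabel e Z.toDiagram t)), sum_stateList Z'.toDiagram (fun t =>
    wordTensor μ ν _ (nodeLabel e Z'.toDiagram t)), hD, hD']
  simp only [stateSum_append]
  refine stateSum_congr _ fun t₁ h₁ => ?_
  have hZ : stateSum X (fun t₂ => stateSum post fun t₃ => wordTensor μ ν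
      (fun i => hd (o i) :: (tlZ (o i) ++ (l i).flatMap fun o => hd o :: tlZ o))
      (nodeLabel e Z.toDiagram (t₁ ++ (t₂ ++ t₃)))) =
      stateSum X fun t₂ => stateSum post fun t₃ => G t₁ t₃ (stateVal e thk X vis t₂) := by
    refine stateSum_congr _ fun t₂ h₂ => stateSum_congr _ fun t₃ _ => ?_
    have hE₂ (t : O) : nodeLabel e Z.toDiagram (t₁ ++ (t₂ ++ t₃))
        (outerPoint p q (endPoint Z.toDiagram p q ext t)) = E t₁ t₃ t :=
      H.nodeLabel e hD hD' h₁ h₂ (by simp [hqX']) (hout t)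
    refine key t₁ t₃ hd tlZ _ _ (fun u => hE₂ (.inl u)) (fun u => rfl) fun j => ?_
    rw [h.evalWord_path e S hq hD h₁ h₂ j, hE₂ (.inr j)]
  have hZ' : stateSum X' (fun t₂ => stateSum post fun t₃ => wordTensor μ ν
      (fun i => hd' (o i) :: (tlZ' (o i) ++ (l i).flatMap fun o => hd' o :: tlZ' o))
      (nodeLabel e Z'.toDiagram (t₁ ++ (t₂ ++ t₃)))) =
      stateSum X' fun t₂ => stateSum post fun t₃ => G t₁ t₃ (stateVal e thk X' vis' t₂) := by
    refine stateSum_congr _ fun t₂ h₂ => stateSum_congr _ fun t₃ _ => ?_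
    have hE₂ (t : O) : nodeLabel e Z'.toDiagram (t₁ ++ (t₂ ++ t₃))
        (outerPoint p q' (endPoint Z.toDiagram p q ext t)) = E t₁ t₃ t :=
      (H.nodeLabel e (t₂ := List.replicate q none) hD hD' h₁ (by simp [hqX]) h₂ (hout t)).symm.trans
        (H.nodeLabel e hD hD' h₁ (by simp [hqX]) (by simp [hqX']) (hout t))
    refine key t₁ t₃ hd' tlZ' _ _ (fun u => hE₂ (.inl u)) (fun u => rfl) fun j => ?_
    have h4 := h'.evalWord_path (t₃ := t₃) e S' hq' hD' h₁ h₂ j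
    have h5 := hE₂ (.inr j)
    rw [endPoint_inr] at h5 h4
    rw [← h5]
    exact h4
  -- The states of `post` are moved outside, so that `hsum` can be applied with the whole exterior
  -- fixed.
  rw [hZ, hZ', stateSum_comm X, stateSum_comm X']
  refine stateSum_congr _ fun t₃ _ => hsum (G t₁ t₃)

end Invariance

/-! ### Replacing columns in a diagram -/

section Columns

variable {D D' : Diagram} {pre X X' post : List Slice}

lemma getElem?_region (hD : D.slices = pre ++ (X ++ post)) {j : ℕ} (hj : j < X.length) :
    D.slices[pre.length + j]? = X[j]? := by
  rw [hD, List.getElem?_append_right (by omega), Nat.add_sub_cancel_left,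
    List.getElem?_append_left hj]

lemma Region.of_slices {R : Col} (hD : D.slices = pre ++ (X ++ post)) (hR : R.rows = X.map some)
    (htop : D.word pre.length = R.top) : Region D pre.length R := by
  have hlen : R.rows.length = X.length := by rw [hR, List.length_map]
  refine ⟨fun j hj => ?_, fun j r hr => ?_⟩
  · rw [hlen] at hj
    cases j with
    | zero => exact htop
    | succ j =>
      have h1 := getElem?_region hD (j := j) hj
      rw [← add_assoc, Diagram.word, h1, Col.word, hR, List.getElem?_map,
        List.getElem?_eq_getElem hj]
      rfl
  · rw [hR, List.getElem?_map, Option.map_eq_some_iff] at hr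
    obtain ⟨L, hL, rfl⟩ := hr
    exact ⟨L, rfl, by rw [getElem?_region hD (List.getElem?_eq_some_iff.1 hL).1, hL]⟩

lemma word_top_eq (htop : D.top = D'.top) (hD : D.slices = pre ++ (X ++ post))
    (hD' : D'.slices = pre ++ (X' ++ post)) {m : ℕ} (hm : m ≤ pre.length) :
    D.word m = D'.word m := by
  cases m with
  | zero => exact htop
  | succ m =>
    rw [Diagram.word, Diagram.word, hD, hD', List.getElem?_append_left hm,
      List.getElem?_append_left hm]

lemma AgreeOutside.of_slices (htop : D.top = D'.top) (hD : D.slices = pre ++ (X ++ post))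
    (hD' : D'.slices = pre ++ (X' ++ post))
    (hbot : D.word (pre.length + X.length) = D'.word (pre.length + X'.length)) :
    AgreeOutside D D' pre.length X.length X'.length := by
  have hs (m : ℕ) : D.slices[pre.length + X.length + m]? = D'.slices[pre.length + X'.length + m]? := by
    rw [hD, hD']
    simp only [← List.append_assoc]
    rw [List.getElem?_append_right (by simp), List.getElem?_append_right (by simp)]
    congr 1
    simp
  refine ⟨fun m hm => word_top_eq htop hD hD' hm, fun m => ?_, fun m hm => ?_, hs⟩
  · cases m with
    | zero => exact hbot
    | succ m => rw [← add_assoc, ← add_assoc, Diagram.word, Diagram.word, hs]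
  · rw [hD, hD', List.getElem?_append_left hm, List.getElem?_append_left hm]

variable {k A : Type*} [Field k] [Ring A] [HopfAlgebra k A] {ι : Type*} [Fintype ι]
  (e : Module.Basis ι k A) {K : Type*} {n : ℕ} {μ ν : Fin n → Bool}
  {ent ext : K → Bool × ℕ} {thk : K → Bool}

/-- Replacing a column by another one with the same strands and the same invariants. -/
theorem J_eq_of_columns (hγ : Function.Bijective (HopfAlgebra.antipode k : A →ₗ[k] A))
    (Z Z' : CD μ ν) {R R' : Col} {tl tl' : K → List (ℕ × ℕ)} {vis vis' : K → List (ℕ × Bool)}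
    (htop : Z.top = Z'.top) (hD : Z.slices = pre ++ X ++ post)
    (hD' : Z'.slices = pre ++ X' ++ post) (hX : X ≠ []) (hR : R.rows = X.map some)
    (hR' : R'.rows = X'.map some) (hwf : R.Wf) (hRtop : R.top = R'.top)
    (hRbot : R.word R.rows.length = R'.word R'.rows.length)
    (S : R.Strands ent ext thk tl vis) (S' : R'.Strands ent ext thk tl' vis')
    (hcomp : ∀ (x : Z.Node) (x' : Z'.Node), SameLevel pre.length X.length X'.length x.1.1 x'.1.1 →
      x.1.2 = x'.1.2 → Z.comp x = Z'.comp x')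
    (hsum : SameSum e (⨂[k] i, Factor k A (μ i) (ν i)) thk X X' vis vis') : Z.J e = Z'.J e := by
  rw [List.append_assoc] at hD hD'
  have hlen : R.rows.length = X.length := by rw [hR, List.length_map]
  have hlen' : R'.rows.length = X'.length := by rw [hR', List.length_map]
  -- The first slice of `X` determines the strands at the upper boundary. The list `X'` may be
  -- empty, so for `Z'` they are taken from `Z`.
  obtain ⟨L, Ls, rfl⟩ := List.exists_cons_of_ne_nil hX
  have hw : Z.word pre.length = R.top := by
    have h1 : Z.slices[pre.length]? = some L := by rw [hD]; simp
    rw [Z.word_eq_src h1]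
    exact (hwf 0 L (by rw [hR]; rfl)).symm
  have hw' : Z'.word pre.length = R'.top := by
    rw [← word_top_eq htop hD hD' le_rfl, hw, hRtop]
  have h := Region.of_slices hD hR hw
  have h' := Region.of_slices hD' hR' hw'
  refine J_eq_of_sameSum e hγ Z Z' (AgreeOutside.of_slices htop hD hD' ?_) hD hD' h h' S S' hlen
    hlen' hcomp hsum
  rw [← hlen, ← hlen', h.word _ le_rfl, h'.word _ le_rfl, hRbot]

end Columns

/-! ### Columns of vertical strands -/

namespace Col

/-- A column of vertical strands. -/
def through (l : List Pt) (q : ℕ) : Col := ⟨l, List.replicate q none⟩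

lemma through_length (l : List Pt) (q : ℕ) : (through l q).rows.length = q := by simp [through]

lemma through_word (l : List Pt) {q j : ℕ} (hj : j ≤ q) : (through l q).word j = l := by
  induction j with
  | zero => rfl
  | succ j ih =>
    have : (through l q).rows[j]? = some none := by
      simp [through, Nat.lt_of_succ_le hj]
    rw [word, this, ih (by omega)]

lemma through_wf (l : List Pt) (q : ℕ) : (through l q).Wf := by
  intro j L h
  simp [through, List.getElem?_replicate] at h

/-- Strands which are given by lists of points. -/
lemma Strands.of_path {C : Col} {K : Type*} {ent ext : K → Bool × ℕ} {thk : K → Bool}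
    {vis : K → List (ℕ × Bool)} (path : K → List (ℕ × ℕ))
    (chain : ∀ k, (path k).IsChain fun a b => C.next a = some b)
    (head : ∀ k, (path k).head? = some (C.bd (ent k)))
    (last : ∀ k, (path k).getLast? = some (C.bd (ext k)))
    (ent_pt : ∀ k, (C.word (C.bd (ent k)).1)[(C.bd (ent k)).2]? = some ⟨thk k, (ent k).1⟩)
    (ext_pt : ∀ k, (C.word (C.bd (ext k)).1)[(C.bd (ext k)).2]? = some ⟨thk k, !(ext k).1⟩)
    (cover : ∀ j ≤ C.rows.length, ∀ i < (C.word j).length, ∃ k, (j, i) ∈ path k)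
    (ent_inj : Function.Injective ent) (ext_inj : Function.Injective ext)
    (vis_eq : ∀ k, (path k).filterMap C.tok = vis k) :
    C.Strands ent ext thk (fun k => (path k).tail) vis := by
  have hp (k : K) : C.bd (ent k) :: (path k).tail = path k := by
    obtain ⟨t, ht⟩ : ∃ t, path k = C.bd (ent k) :: t := by
      have := head k
      rcases h : path k with _ | ⟨a, t⟩
      · rw [h] at this; simp at this
      · rw [h, List.head?_cons, Option.some_inj] at this
        exact ⟨t, by rw [this]⟩
    rw [ht, List.tail_cons]
  refine ⟨fun k => ?_, fun k => ?_, ent_pt, ext_pt, fun j hj i hi => ?_, ent_inj, ext_inj,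
    fun k => ?_⟩
  · rw [hp]; exact chain k
  · have := last k
    rw [List.getLast?_eq_getLast_of_ne_nil (by rw [← hp]; exact List.cons_ne_nil _ _),
      Option.some_inj] at this
    simp only [hp]
    exact this
  · obtain ⟨k, hk⟩ := cover j hj i hi
    exact ⟨k, by rwa [hp]⟩
  · rw [hp]; exact vis_eq k

lemma through_strands (l : List Pt) (q : ℕ) : ∃ tl, (through l q).Strands
    (fun i : Fin l.length => (l[i].up, (i : ℕ))) (fun i => (!l[i].up, (i : ℕ)))
    (fun i => l[i].thick) tl fun _ => [] := by
  have hw {j : ℕ} (hj : j ≤ q) (i : Fin l.length) : ((through l q).word j)[i.1]? = some l[i] := by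
    rw [through_word l hj]; exact List.getElem?_eq_getElem i.2
  have hr {j : ℕ} (hj : j < q) : (through l q).rows[j]? = some none := by simp [through, hj]
  have hbd (x : Bool × ℕ) : (through l q).bd x = (if x.1 then q else 0, x.2) := by
    rw [bd, through_length]
  have hle (b : Bool) : (if b then q else 0) ≤ q := by split_ifs <;> omega
  let path (i : Fin l.length) : List (ℕ × ℕ) :=
    if l[i].up then ((List.range (q + 1)).map fun j => (j, i.1)).reverse
    else (List.range (q + 1)).map fun j => (j, i.1)
  have hmem (i : Fin l.length) (x : ℕ × ℕ) : x ∈ path i ↔ x.1 ≤ q ∧ x.2 = i := by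
    have : x ∈ path i ↔ x ∈ (List.range (q + 1)).map fun j => (j, i.1) := by
      simp only [path]
      split_ifs
      · rw [List.mem_reverse]
      · rfl
    rw [this, List.mem_map]
    constructor
    · rintro ⟨j, hj, rfl⟩
      exact ⟨by simpa [Nat.lt_succ_iff] using hj, rfl⟩
    · rintro ⟨h1, h2⟩
      exact ⟨x.1, by simpa [Nat.lt_succ_iff] using h1, Prod.ext rfl h2.symm⟩
  refine ⟨_, Strands.of_path path (fun i => ?_) (fun i => ?_) (fun i => ?_) (fun i => ?_)
    (fun i => ?_) (fun j hj i hi => ?_) (fun i i' h => ?_) (fun i i' h => ?_) (fun i => ?_)⟩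
  · simp only [path]
    rcases hu : l[i].up with _ | _
    · rw [if_neg (by simp), List.isChain_map, List.isChain_range]
      intro m hm
      rw [(through l q).next_of_down (hw (by omega) i) hu, hr (by omega)]
      rfl
    · rw [if_pos rfl, List.isChain_reverse, List.isChain_map, List.isChain_range]
      intro m hm
      rw [(through l q).next_of_up (hw (by omega) i) hu, hr (by omega)]
      rfl
  · rw [hbd]
    simp only [path]
    rcases hu : l[i].up with _ | _
    · simp [List.range_succ_eq_map]
    · simp [List.range_succ]
  · rw [hbd]
    simp only [path]
    rcases hu : l[i].up with _ | _
    · simp [List.range_succ]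
    · simp [List.range_succ_eq_map]
  · rw [hbd]
    exact hw (hle _) i
  · rw [hbd, Bool.not_not]
    exact hw (hle _) i
  · rw [through_length] at hj
    rw [through_word l hj] at hi
    exact ⟨⟨i, hi⟩, (hmem _ _).2 ⟨hj, rfl⟩⟩
  · exact Fin.ext (congrArg Prod.snd h)
  · exact Fin.ext (congrArg Prod.snd h)
  · refine List.filterMap_eq_nil_iff.2 fun x hx => ?_
    obtain ⟨h1, h2⟩ := (hmem _ _).1 hx
    obtain ⟨m, i'⟩ := x
    simp only at h1 h2
    subst h2
    have h3 (j : ℕ) (r) (hj : (through l q).rows[j]? = some r) : r = none := by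
      simp [through, List.getElem?_replicate] at hj; exact hj.2.symm
    rcases hu : l[i].up with _ | _
    · rw [(through l q).tok_of_down (hw h1 i) hu]
      rcases h4 : (through l q).rows[m]? with _ | r
      · rfl
      · rw [h3 _ _ h4]; rfl
    · cases m with
      | zero => exact (through l q).tok_of_up_zero (hw h1 i) hu
      | succ m =>
        rw [(through l q).tok_of_up (hw h1 i) hu]
        rcases h4 : (through l q).rows[m]? with _ | r
        · rfl
        · rw [h3 _ _ h4]; rfl

end Col

/-! ### Strands given by explicit lists -/

/-- A strand of a column; it runs from `src` to `tgt` if `pt` is directed downwards, and the other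
way round else. -/
structure Arc where
  pt : Pt
  src : Bool × ℕ
  tgt : Bool × ℕ

namespace Arc

/-- The end where the strand enters. -/
def ent (a : Arc) : Bool × ℕ := if a.pt.up then a.tgt else a.src

/-- The end where the strand leaves. -/
def ext (a : Arc) : Bool × ℕ := if a.pt.up then a.src else a.tgt

/-- A list which is given from `src` to `tgt`, in the order of the orientation. -/
def orient {α : Type*} (a : Arc) (l : List α) : List α := if a.pt.up then l.reverse else l

end Arc

namespace Col

/-- Equality of pairs of numbers. -/
def eqPair (x y : ℕ × ℕ) : Bool := x.1 == y.1 && x.2 == y.2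

lemma eqPair_iff {x y : ℕ × ℕ} : eqPair x y = true ↔ x = y := by
  simp [eqPair, Prod.ext_iff]

/-- A list of points follows the orientation. -/
def isPath (C : Col) : List (ℕ × ℕ) → Bool
  | [] => true
  | [_] => true
  | x :: y :: l => (match C.next x with
    | none => false
    | some z => eqPair z y) && isPath C (y :: l)

lemma isPath_iff {C : Col} (l : List (ℕ × ℕ)) (h : C.isPath l = true) :
    l.IsChain fun a b => C.next a = some b := by
  induction l with
  | nil => exact List.isChain_nil
  | cons x l ih =>
    cases l with
    | nil => exact List.isChain_singleton _
    | cons y l =>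
      rw [isPath, Bool.and_eq_true] at h
      rw [List.isChain_cons_cons]
      refine ⟨?_, ih h.2⟩
      have h1 := h.1
      rcases hx : C.next x with _ | z
      · rw [hx] at h1; simp at h1
      · rw [hx] at h1
        rw [eqPair_iff.1 h1]

/-- All points of a column are on one of the given strands. -/
def covered (C : Col) (paths : List (List (ℕ × ℕ))) : Bool :=
  (List.range (C.rows.length + 1)).all fun j => (List.range (C.word j).length).all fun i =>
    paths.any fun p => p.any (eqPair (j, i))

/-- The given strands are all the strands of a column; `paths` lists their points and `toks` the
strands of crossings which they traverse, from `src` to `tgt`. -/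
structure HasArcs (C : Col) (arcs : List Arc) (paths : List (List (ℕ × ℕ)))
    (toks : List (List (ℕ × Bool))) : Prop where
  chain : ((List.zipWith Arc.orient arcs paths).all C.isPath) = true
  head : (List.zipWith Arc.orient arcs paths).map List.head? = arcs.map fun a => some (C.bd a.ent)
  last : (List.zipWith Arc.orient arcs paths).map List.getLast? =
    arcs.map fun a => some (C.bd a.ext)
  ent_pt : arcs.map (fun a => (C.word (C.bd a.ent).1)[(C.bd a.ent).2]?) =
    arcs.map fun a => some ⟨a.pt.thick, a.ent.1⟩
  ext_pt : arcs.map (fun a => (C.word (C.bd a.ext).1)[(C.bd a.ext).2]?) =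
    arcs.map fun a => some ⟨a.pt.thick, !a.ext.1⟩
  cover : C.covered (List.zipWith Arc.orient arcs paths) = true
  inj : decide ((arcs.map Arc.ent).Nodup ∧ (arcs.map Arc.ext).Nodup) = true
  vis_eq : (List.zipWith Arc.orient arcs paths).map (List.filterMap C.tok) =
    List.zipWith Arc.orient arcs toks

/-- The conditions of `HasArcs` are equations between lists and Booleans, so that they hold by
evaluation for explicit columns. Here they are turned into the indexed form that the locality
argument uses. -/
lemma HasArcs.strands {C : Col} {arcs : List Arc} {paths : List (List (ℕ × ℕ))}
    {toks : List (List (ℕ × Bool))} (h : C.HasArcs arcs paths toks) :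
    ∃ tl, C.Strands (fun j : Fin arcs.length => arcs[j].ent) (fun j => arcs[j].ext)
      (fun j => arcs[j].pt.thick) tl fun j => arcs[j].orient (toks[j.1]?.getD []) := by
  have hmap {β : Type} {u v : Arc → β} (h : arcs.map u = arcs.map v) (j : Fin arcs.length) :
      u arcs[j] = v arcs[j] := List.map_inj_left.1 h _ (List.getElem_mem _)
  have hinj {β : Type} {u : Arc → β} (h : (arcs.map u).Nodup) :
      Function.Injective fun j : Fin arcs.length => u arcs[j] := by
    intro i j hij
    refine Fin.ext ((h.getElem_inj_iff (hi := by simp) (hj := by simp)).1 ?_)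
    simpa using hij
  have hlen : (List.zipWith Arc.orient arcs paths).length = arcs.length := by
    simpa using congrArg List.length h.head
  generalize hP : List.zipWith Arc.orient arcs paths = P at hlen
  have hz {β : Type} {u : List (ℕ × ℕ) → β} {v : Arc → β} (h : P.map u = arcs.map v)
      (j : Fin arcs.length) : u (P[j.1]'(j.2.trans_eq hlen.symm)) = v arcs[j] := by
    have h1 := congrArg (fun l => l[j.1]?) h
    simpa [List.getElem?_eq_getElem (j.2.trans_eq hlen.symm)] using h1
  obtain ⟨chain, head, last, ent_pt, ext_pt, cover, inj, vis_eq⟩ := h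
  rw [hP] at chain head last cover vis_eq
  refine ⟨_, Strands.of_path (fun j => P[j.1]'(j.2.trans_eq hlen.symm)) (fun j => ?_) (hz head) (hz last)
    (hmap ent_pt) (hmap ext_pt) (fun m hm i hi => ?_) (hinj (of_decide_eq_true inj).1)
    (hinj (of_decide_eq_true inj).2) fun j => ?_⟩
  · exact isPath_iff _ (List.all_eq_true.1 chain _ (List.getElem_mem _))
  · have h1 := List.all_eq_true.1 (List.all_eq_true.1 cover m (by simpa [Nat.lt_succ_iff] using hm))
      i (by simpa using hi)
    obtain ⟨p, hp, h2⟩ := List.any_eq_true.1 h1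
    obtain ⟨x, hx, h3⟩ := List.any_eq_true.1 h2
    obtain ⟨j, hj, rfl⟩ := List.mem_iff_getElem.1 hp
    exact ⟨⟨j, hj.trans_eq hlen⟩, by rw [eqPair_iff.1 h3]; exact hx⟩
  · have h1 := congrArg (fun l => l[j.1]?) vis_eq
    simp only [List.getElem?_map, List.getElem?_zipWith, List.getElem?_eq_getElem j.2,
      List.getElem?_eq_getElem (j.2.trans_eq hlen.symm), Option.map_some] at h1
    rcases h2 : toks[j.1]? with _ | t
    · rw [h2] at h1; simp at h1
    · rw [h2] at h1
      simpa using h1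

end Col

lemma Col.wf_of_composable {w : List Pt} {M : List Slice} (h : Composable w M) :
    (Col.mk w (M.map some)).Wf := by
  have key : ∀ (M : List Slice) (w : List Pt), Composable w M → ∀ j L L', M[j]? = some L →
      M[j + 1]? = some L' → L.tgt = L'.src := by
    intro M
    induction M with
    | nil => intro w _ j L L' h; simp at h
    | cons L₀ M ih =>
      intro w hw j L L' h h'
      cases j with
      | zero =>
        cases M with
        | nil => simp at h'
        | cons L₁ M =>
          simp only [List.getElem?_cons_zero, List.getElem?_cons_succ, Option.some_inj] at h h'
          rw [← h, ← h']
          exact hw.2.1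
      | succ j => exact ih _ hw.2 j L L' (by simpa using h) (by simpa using h')
  intro j L hL
  simp only [List.getElem?_map, Option.map_eq_some_iff, Option.some_inj, exists_eq_right] at hL
  cases j with
  | zero =>
    cases M with
    | nil => simp at hL
    | cons L₀ M =>
      simp only [List.getElem?_cons_zero, Option.some_inj] at hL
      rw [← hL]
      exact h.1
  | succ j =>
    have hj := (List.getElem?_eq_some_iff.1 hL).1
    have h1 : M[j]? = some M[j] := List.getElem?_eq_getElem (by omega)
    simp only [Col.word, List.getElem?_map, h1, Option.map_some]
    exact key M w h j _ _ h1 hL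

/-! ### Adding vertical strands on both sides -/

namespace Col

variable {A B : Col}

lemma Compat.row_left (h : A.Compat B) {j : ℕ} {L : Slice} (hA : A.rows[j]? = some (some L)) :
    (A.hcomp B).rows[j]? = some (some (L.whisker [] (B.word j))) := by
  rcases h.cases (List.getElem?_eq_some_iff.1 hA).1 with ⟨L', h1, -, h3⟩ | ⟨L', h1, -, -⟩ | ⟨h1, -, -⟩
  · rw [hA, Option.some_inj, Option.some_inj] at h1
    rw [h3, h1]
  · rw [hA] at h1; simp at h1
  · rw [hA] at h1; simp at h1

lemma Compat.row_right (h : A.Compat B) {j : ℕ} {L : Slice} (hB : B.rows[j]? = some (some L)) :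
    (A.hcomp B).rows[j]? = some (some (L.whisker (A.word j) [])) := by
  rcases h.cases (h.length ▸ (List.getElem?_eq_some_iff.1 hB).1) with
    ⟨L', -, h2, -⟩ | ⟨L', -, h2, h3⟩ | ⟨-, h2, -⟩
  · rw [hB] at h2; simp at h2
  · rw [hB, Option.some_inj, Option.some_inj] at h2
    rw [h3, h2]
  · rw [hB] at h2; simp at h2

lemma through_join (l : List Pt) (q j : ℕ) : ((through l q).rows[j]?).join = none := by
  simp only [through, List.getElem?_replicate]
  split_ifs <;> rfl

lemma compat_through_left (l : List Pt) (B : Col) : (through l B.rows.length).Compat B :=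
  ⟨through_length _ _, fun _ => Or.inl (through_join _ _ _)⟩

lemma compat_through_right (l : List Pt) (A : Col) : A.Compat (through l A.rows.length) :=
  ⟨(through_length _ _).symm, fun _ => Or.inr (through_join _ _ _)⟩

/-- A column with vertical strands on both sides. -/
def whisker (l r : List Pt) (C : Col) : Col :=
  ((through l C.rows.length).hcomp C).hcomp (through r C.rows.length)

variable {C : Col} (l r : List Pt)

lemma compat_whisker : ((through l C.rows.length).hcomp C).Compat (through r C.rows.length) := by
  have h := compat_through_right r ((through l C.rows.length).hcomp C)
  rwa [hcomp_length, through_length] at h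

lemma whisker_length : (C.whisker l r).rows.length = C.rows.length := by
  rw [whisker, hcomp_length, hcomp_length, through_length]

lemma whisker_word {j : ℕ} (hj : j ≤ C.rows.length) :
    (C.whisker l r).word j = l ++ C.word j ++ r := by
  have hl : j ≤ (through l C.rows.length).rows.length := by rwa [through_length]
  rw [whisker, hcomp_word (compat_whisker l r) (by rwa [hcomp_length]),
    hcomp_word (compat_through_left l C) hl, through_word l hj, through_word r hj]

lemma whisker_wf (h : C.Wf) : (C.whisker l r).Wf :=
  hcomp_wf (compat_whisker l r) (hcomp_wf (compat_through_left l C) (through_wf _ _) h)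
    (through_wf _ _)

lemma whisker_rows (w : List Pt) (M : List Slice) :
    ((Col.mk w (M.map some)).whisker l r).rows = (M.map (Slice.whisker l r)).map some := by
  refine List.ext_getElem? fun j => ?_
  by_cases hj : j < M.length
  · have h1 : (M.map some)[j]? = some (some M[j]) := by
      rw [List.getElem?_map, List.getElem?_eq_getElem hj]; rfl
    have h2 := (compat_through_left l (Col.mk w (M.map some))).row_right h1
    rw [whisker, (compat_whisker l r).row_left h2, through_word _ (by simpa using hj.le),
      through_word _ (by simpa using hj.le), List.getElem?_map, List.getElem?_map,
      List.getElem?_eq_getElem hj]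
    simp [Slice.whisker]
  · rw [List.getElem?_eq_none (by rw [whisker_length]; simpa using hj),
      List.getElem?_eq_none (by simpa using hj)]

/-- The new ends depend on the column only through its old ends and the widths `m₀` and `m₁`. Two
columns with the same ends and widths therefore get literally the same ends. -/
lemma Strands.whisker {K : Type*} {ent ext : K → Bool × ℕ} {thk : K → Bool}
    {tl : K → List (ℕ × ℕ)} {vis : K → List (ℕ × Bool)} (S : C.Strands ent ext thk tl vis)
    (hC : C.Wf) {m₀ m₁ : ℕ} (h₀ : C.top.length = m₀) (h₁ : (C.word C.rows.length).length = m₁) :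
    ∃ tl', (C.whisker l r).Strands
      (Sum.elim (Sum.elim (fun i : Fin l.length => (l[i].up, (i : ℕ)))
        fun j => displace l.length l.length (ent j))
        fun i : Fin r.length => displace (l.length + m₀) (l.length + m₁) (r[i].up, (i : ℕ)))
      (Sum.elim (Sum.elim (fun i : Fin l.length => (!l[i].up, (i : ℕ)))
        fun j => displace l.length l.length (ext j))
        fun i : Fin r.length => displace (l.length + m₀) (l.length + m₁) (!r[i].up, (i : ℕ)))
      (Sum.elim (Sum.elim (fun i : Fin l.length => l[i].thick) thk)
        fun i : Fin r.length => r[i].thick) tl'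
      (Sum.elim (Sum.elim (fun _ : Fin l.length => []) vis) fun _ : Fin r.length => []) := by
  obtain ⟨tl₁, S₁⟩ := through_strands l C.rows.length
  obtain ⟨tl₂, S₂⟩ := through_strands r C.rows.length
  have hlen := through_length l C.rows.length
  refine ⟨_, Strands.hcomp (compat_whisker l r) (hcomp_wf (compat_through_left l C)
    (through_wf _ _) hC) (Strands.hcomp (compat_through_left l C) (through_wf _ _) S₁ S rfl ?_) S₂
    ?_ ?_⟩
  · rw [through_word l hlen.le]
  · rw [← h₀]; exact List.length_append
  · rw [hcomp_length, hcomp_word (compat_through_left l C) le_rfl, through_word l hlen.le,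
      List.length_append, hlen, h₁]

end Col

/-! ### State sums with additional strands -/

section SameSumLemmas

variable {k A : Type*} [Field k] [Ring A] [HopfAlgebra k A] {ι : Type*} [Fintype ι]
  (e : Module.Basis ι k A) {K K' : Type*} {thk : K → Bool} {thk' : K' → Bool}
  {W : Type*} [AddCommGroup W] [Module k W] {X X' : List Slice} {vis vis' : K → List (ℕ × Bool)}

omit [Fintype ι] in
lemma tokLabel_whisker (l r : List Pt) (t : List (Option ι)) (v : ℕ × Bool) :
    tokLabel e (X.map (Slice.whisker l r)) t v = tokLabel e X t v := by
  simp only [tokLabel, List.getElem?_map]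
  rcases X[v.1]? with _ | L <;> rcases t[v.1]? with _ | _ | a <;> rfl

variable {e}

lemma SameSum.whisker (h : SameSum e W thk X X' vis vis') (l r : List Pt) :
    SameSum e W thk (X.map (Slice.whisker l r)) (X'.map (Slice.whisker l r)) vis vis' := by
  intro G
  rw [stateSum_whisker, stateSum_whisker]
  have h1 (X : List Slice) (t : List (Option ι)) : tokLabel e (X.map (Slice.whisker l r)) t =
    tokLabel e X t := funext fun v => tokLabel_whisker e l r t v
  unfold stateVal
  simp only [h1]
  exact h G

/-- The added strands meet no crossings, so their products are `1` in every state and can be fixed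
as arguments of the test map. -/
lemma SameSum.sumElim_right (h : SameSum e W thk X X' vis vis') (thk' : K' → Bool) :
    SameSum e W (Sum.elim thk' thk) X X' (Sum.elim (fun _ => []) vis)
      (Sum.elim (fun _ => []) vis') := by
  intro G
  let x : K' → Heis k A := fun j => (HC.of k A (thk' j)).symm 1
  have key (X : List Slice) (vis : K → List (ℕ × Bool)) (t : List (Option ι)) :
      G (stateVal e (Sum.elim thk' thk) X (Sum.elim (fun _ => []) vis) t) =
        G.currySum x (stateVal e thk X vis t) := by
    rw [MultilinearMap.currySum_apply]
    congr 1
    funext j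
    rcases j with j | j
    · exact congrArg (HC.of k A (thk' j)).symm (evalWord_nil _)
    · rfl
  simp only [key]
  exact h _

lemma SameSum.sumElim_left (h : SameSum e W thk X X' vis vis') (thk' : K' → Bool) :
    SameSum e W (Sum.elim thk thk') X X' (Sum.elim vis fun _ => [])
      (Sum.elim vis' fun _ => []) := by
  intro G
  have key (X : List Slice) (vis : K → List (ℕ × Bool)) (t : List (Option ι)) :
      G (stateVal e (Sum.elim thk thk') X (Sum.elim vis fun _ => []) t) =
        G.domDomCongr (Equiv.sumComm K K')
          (stateVal e (Sum.elim thk' thk) X (Sum.elim (fun _ => []) vis) t) := by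
    rw [MultilinearMap.domDomCongr_apply]
    congr 1
    funext j
    rcases j with j | j <;> rfl
  simp only [key]
  exact h.sumElim_right thk' _

variable {n : ℕ} {μ ν : Fin n → Bool} {pre post : List Slice}

variable (e) in
/-- Replacing a part of a diagram with vertical strands on both sides. -/
theorem J_eq_of_arcs (hγ : Function.Bijective (HopfAlgebra.antipode k : A →ₗ[k] A))
    (Z Z' : CD μ ν) (l r : List Pt) {M M' : List Slice} (htop : Z.top = Z'.top)
    (hD : Z.slices = pre ++ M.map (Slice.whisker l r) ++ post)
    (hD' : Z'.slices = pre ++ M'.map (Slice.whisker l r) ++ post)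
    (hcomp : ∀ (x : Z.Node) (x' : Z'.Node), SameLevel pre.length M.length M'.length x.1.1 x'.1.1 →
      x.1.2 = x'.1.2 → Z.comp x = Z'.comp x')
    (w : List Pt) (arcs : List Arc) (paths paths' : List (List (ℕ × ℕ)))
    (toks toks' : List (List (ℕ × Bool))) (hM : M ≠ [])
    (hw : Composable w M) (hw' : Composable w M')
    (hbot : (Col.mk w (M.map some)).word M.length = (Col.mk w (M'.map some)).word M'.length)
    (harcs : (Col.mk w (M.map some)).HasArcs arcs paths toks)
    (harcs' : (Col.mk w (M'.map some)).HasArcs arcs paths' toks')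
    (hsum : SameSum e (⨂[k] i, Factor k A (μ i) (ν i)) (fun j : Fin arcs.length => arcs[j].pt.thick)
      M M' (fun j => arcs[j].orient (toks[j.1]?.getD []))
      fun j => arcs[j].orient (toks'[j.1]?.getD [])) : Z.J e = Z'.J e := by
  obtain ⟨tl, S⟩ := harcs.strands
  obtain ⟨tl', S'⟩ := harcs'.strands
  have hwf := Col.wf_of_composable hw
  have hwf' := Col.wf_of_composable hw'
  obtain ⟨tl₁, T⟩ := S.whisker l r hwf (m₀ := w.length)
    (m₁ := ((Col.mk w (M.map some)).word M.length).length) rfl (by rw [List.length_map])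
  obtain ⟨tl₁', T'⟩ := S'.whisker l r hwf' (m₀ := w.length)
    (m₁ := ((Col.mk w (M.map some)).word M.length).length) rfl (by rw [List.length_map, hbot])
  refine J_eq_of_columns e hγ Z Z' htop hD hD' (by simpa using hM) (Col.whisker_rows l r w M)
    (Col.whisker_rows l r w M') (Col.whisker_wf l r hwf) rfl ?_ T T' (by simpa using hcomp) ?_
  · rw [Col.whisker_length, Col.whisker_length, Col.whisker_word l r le_rfl,
      Col.whisker_word l r le_rfl, List.length_map, List.length_map, hbot]
  · exact ((hsum.whisker l r).sumElim_right _).sumElim_left _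

end SameSumLemmas

/-! ### Algebraic identities behind slides and half turns -/

section TurnIdentities

variable {k A : Type*} [Field k] [Ring A] [HopfAlgebra k A] {ι : Type*} [Fintype ι]
  (e : Module.Basis ι k A) {W : Type*} [AddCommGroup W] [Module k W]

open HopfAlgebra

lemma lower_up (c : Bool) (x : A) : lower k A ⟨c, true⟩ x = lower k A ⟨c, false⟩ (gam k A x) := by
  cases c <;> simp [lower, Pt.twist, pow_two, Module.End.one_eq_id]

lemma upper_up (c : Bool) (f : Module.Dual k A) :
    upper k A ⟨c, true⟩ f = upper k A ⟨c, false⟩ ((gamBar k A).dualMap f) := by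
  cases c <;> simp [upper, Pt.twist, pow_two, Module.End.one_eq_id]

/-- If `γ² = 1`, then `γ⁻¹ = γ`, and a map can be moved across the canonical element. -/
lemma sum_antipode_swap (h2 : ∀ a : A, antipode k (antipode k a) = a)
    (hγ : Function.Bijective (antipode k : A →ₗ[k] A)) (B : A →ₗ[k] Module.Dual k A →ₗ[k] W) :
    ∑ x, B (gam k A (e x)) (e.coord x) = ∑ x, B (e x) ((gamBar k A).dualMap (e.coord x)) := by
  rw [sum_canonical_comp]
  have : gamBar k A = gam k A := by
    ext x
    apply hγ.1
    exact (gam_gamBar hγ x).trans (h2 x).symm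
  rw [this]

variable (hγ : Function.Bijective (antipode k : A →ₗ[k] A))
include hγ

/-- Moved across the canonical element, `γ` becomes `γ^*` and cancels `(γ⁻¹)^*`. -/
lemma sum_antipode_shift (B : A →ₗ[k] Module.Dual k A →ₗ[k] W) :
    ∑ x, B (gam k A (e x)) ((gamBar k A).dualMap (e.coord x)) = ∑ x, B (e x) (e.coord x) := by
  have h1 := sum_canonical_comp e (B.compl₂ (gamBar k A).dualMap) (gam k A)
  simp only [LinearMap.compl₂_apply] at h1
  rw [h1]
  refine Finset.sum_congr rfl fun x _ => ?_
  congr 1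
  ext y
  simp [gam_gamBar hγ]

/-- A half turn reverses both strands. If they are parallel, one `γ` and one `(γ⁻¹)^*` are added or
removed together, which `sum_antipode_shift` allows. If they are antiparallel, one of the two is
traded for the other, and this requires `sum_antipode_swap`. -/
lemma halfTurn_identity (G : Heis k A →ₗ[k] Heis k A →ₗ[k] W) (s : Bool) (a b : Pt)
    (h : a.up = b.up ∨ ∀ a : A, antipode k (antipode k a) = a) :
    ∑ x, G (leftLabel e s a.flip x) (rightLabel e s b.flip x) =
      ∑ x, G (leftLabel e s a x) (rightLabel e s b x) := by
  obtain ⟨c, u⟩ := a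
  obtain ⟨c', u'⟩ := b
  have key (B : A →ₗ[k] Module.Dual k A →ₗ[k] W) := sum_antipode_shift e hγ B
  have swap (hu : u ≠ u') (B : A →ₗ[k] Module.Dual k A →ₗ[k] W) :=
    sum_antipode_swap e (h.resolve_left hu) hγ B
  have k1 := key (G.compl₁₂ (lower k A ⟨c, false⟩) (upper k A ⟨c', false⟩))
  have k2 := key (G.flip.compl₁₂ (lower k A ⟨c', false⟩ ∘ₗ gam k A) (upper k A ⟨c, false⟩))
  have s1 (hu : u ≠ u') := swap hu (G.compl₁₂ (lower k A ⟨c, false⟩) (upper k A ⟨c', false⟩))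
  have s2 (hu : u ≠ u') :=
    swap hu (G.flip.compl₁₂ (lower k A ⟨c', false⟩ ∘ₗ gam k A) (upper k A ⟨c, false⟩))
  simp only [LinearMap.compl₁₂_apply, LinearMap.flip_apply, LinearMap.comp_apply] at k1 k2 s1 s2
  cases s <;> cases u <;> cases u' <;>
    simp only [leftLabel, rightLabel, Pt.flip, Bool.not_false, Bool.not_true, signedBasis, if_true,
      Bool.false_eq_true, if_false, lower_up, upper_up, k1, k2]
  · exact (s2 (by simp)).symm
  · exact s2 (by simp)
  · exact s1 (by simp)
  · exact (s1 (by simp)).symm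

/-- Only `u` is reversed, but the crossing also changes its kind, which adds or removes a `γ` on the
under-strand. If `u` is directed upwards, the two changes cancel, either literally (`u` below) or by
`sum_antipode_shift` (`u` above). Otherwise a `γ²` is left over. -/
lemma slide_identity (G : Heis k A →ₗ[k] Heis k A →ₗ[k] W) (s : Bool) (u t : Pt)
    (h : u.up = true ∨ ∀ a : A, antipode k (antipode k a) = a) :
    ∑ x, G (leftLabel e s u x) (rightLabel e s t x) =
      ∑ x, G (rightLabel e (!s) u.flip x) (leftLabel e (!s) t x) := by
  obtain ⟨c, u⟩ := u
  have k1 := sum_antipode_shift e hγ (G.flip.compl₁₂ (lower k A t) (upper k A ⟨c, false⟩))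
  have s1 (hu : u ≠ true) := sum_antipode_swap e (h.resolve_left hu) hγ
    (G.flip.compl₁₂ (lower k A t) (upper k A ⟨c, false⟩))
  simp only [LinearMap.compl₁₂_apply, LinearMap.flip_apply] at k1 s1
  cases s <;> cases u <;>
    simp only [leftLabel, rightLabel, Pt.flip, Bool.not_false, Bool.not_true, signedBasis, if_true,
      Bool.false_eq_true, if_false, lower_up, upper_up]
  · exact s1 (by simp)
  · exact k1
  · have h2 (x : A) : gam k A (gam k A x) = x := h.resolve_left (by simp) x
    simp only [h2]

end TurnIdentities

/-! ### Multilinear maps in at most three variables -/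

section Curry

variable {k H W : Type*} [Field k] [AddCommGroup H] [Module k H] [AddCommGroup W] [Module k W]

/-- A multilinear map in one variable. -/
def curryOne : MultilinearMap k (fun _ : Fin 1 => H) W →ₗ[k] H →ₗ[k] W where
  toFun G := { toFun := fun x => G.curryLeft x ![]
               map_add' := fun x y => by rw [map_add]; rfl
               map_smul' := fun c x => by rw [map_smul]; rfl }
  map_add' _ _ := rfl
  map_smul' _ _ := rfl

/-- A multilinear map in two variables. -/
def curryTwo : MultilinearMap k (fun _ : Fin 2 => H) W →ₗ[k] H →ₗ[k] H →ₗ[k] W where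
  toFun G := curryOne ∘ₗ G.curryLeft
  map_add' _ _ := rfl
  map_smul' _ _ := rfl

/-- A multilinear map in three variables. -/
def curryThree : MultilinearMap k (fun _ : Fin 3 => H) W →ₗ[k] H →ₗ[k] H →ₗ[k] H →ₗ[k] W where
  toFun G := curryTwo ∘ₗ G.curryLeft
  map_add' _ _ := rfl
  map_smul' _ _ := rfl

end Curry

/-! ### Products of labels along explicit strands -/

section Arcs

variable {k A : Type*} [Field k] [Ring A] [HopfAlgebra k A] {ι : Type*}
  (e : Module.Basis ι k A)

lemma stateVal_orient (arcs : List Arc) (toks : Fin arcs.length → List (ℕ × Bool)) (X : List Slice)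
    (t : List (Option ι)) (j : Fin arcs.length) :
    stateVal e (fun j : Fin arcs.length => arcs[j].pt.thick) X (fun j => arcs[j].orient (toks j)) t j =
      strandProd arcs[j].pt ((toks j).map (tokLabel e X t)) := by
  rw [stateVal, LinearEquiv.symm_apply_eq, ← evalWord_orient, Arc.orient]
  split_ifs
  · rw [List.map_reverse]
  · rfl

lemma genLabel_left (s : Bool) (a b : Pt) (x : ι) :
    genLabel e (.cross s a b) s x = leftLabel e s a x := by
  cases s <;> rfl

lemma genLabel_right (s : Bool) (a b : Pt) (x : ι) :
    genLabel e (.cross s a b) (!s) x = rightLabel e s b x := by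
  cases s <;> rfl

end Arcs

section ReplacedArcs

variable {k A : Type*} [Field k] [Ring A] [HopfAlgebra k A] {ι : Type*} [Fintype ι]
  (e : Module.Basis ι k A) (W : Type*) [AddCommGroup W] [Module k W]

/-- Two pastings of slices which have the same strands and the same invariants. -/
structure SameArcs (M M' : List Slice) (w : List Pt) (arcs : List Arc)
    (paths paths' : List (List (ℕ × ℕ))) (toks toks' : List (List (ℕ × Bool))) : Prop where
  ne_nil : M ≠ []
  composable : Composable w M
  composable' : Composable w M'
  bot : (Col.mk w (M.map some)).word M.length = (Col.mk w (M'.map some)).word M'.length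
  hasArcs : (Col.mk w (M.map some)).HasArcs arcs paths toks
  hasArcs' : (Col.mk w (M'.map some)).HasArcs arcs paths' toks'
  sum_eq : ∀ G : MultilinearMap k (fun _ : Fin arcs.length => Heis k A) W,
    stateSum M (fun t => G fun j =>
      strandProd arcs[j].pt ((toks[j.1]?.getD []).map (tokLabel e M t))) =
    stateSum M' fun t => G fun j =>
      strandProd arcs[j].pt ((toks'[j.1]?.getD []).map (tokLabel e M' t))

variable {e W} {M M' : List Slice} {w : List Pt} {arcs : List Arc}
  {paths paths' : List (List (ℕ × ℕ))} {toks toks' : List (List (ℕ × Bool))}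

lemma SameArcs.sameSum (h : SameArcs e W M M' w arcs paths paths' toks toks') :
    SameSum e W (fun j : Fin arcs.length => arcs[j].pt.thick) M M'
      (fun j => arcs[j].orient (toks[j.1]?.getD []))
      fun j => arcs[j].orient (toks'[j.1]?.getD []) := by
  intro G
  have key (X : List Slice) (toks : List (List (ℕ × Bool))) (t : List (Option ι)) :
      stateVal e (fun j : Fin arcs.length => arcs[j].pt.thick) X
        (fun j => arcs[j].orient (toks[j.1]?.getD [])) t =
      fun j => strandProd arcs[j].pt ((toks[j.1]?.getD []).map (tokLabel e X t)) :=
    funext fun j => stateVal_orient e arcs (fun j => toks[j.1]?.getD []) X t j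
  simp only [key]
  exact h.sum_eq G

lemma apply_arcs_one {a₀ : Arc} {l₀ : List (ℕ × Bool)} (F : ℕ × Bool → Heis k A)
    (G : MultilinearMap k (fun _ : Fin [a₀].length => Heis k A) W) :
    (G fun j => strandProd [a₀][j].pt (([l₀][j.1]?.getD []).map F)) =
      curryOne (k := k) G (strandProd a₀.pt (l₀.map F)) := by
  refine congrArg G (funext fun j => ?_)
  fin_cases j
  rfl

lemma apply_arcs_two {a₀ a₁ : Arc} {l₀ l₁ : List (ℕ × Bool)} (F : ℕ × Bool → Heis k A)
    (G : MultilinearMap k (fun _ : Fin [a₀, a₁].length => Heis k A) W) :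
    (G fun j => strandProd [a₀, a₁][j].pt (([l₀, l₁][j.1]?.getD []).map F)) =
      curryTwo (k := k) G (strandProd a₀.pt (l₀.map F)) (strandProd a₁.pt (l₁.map F)) := by
  refine congrArg G (funext fun j => ?_)
  fin_cases j <;> rfl

lemma apply_arcs_three {a₀ a₁ a₂ : Arc} {l₀ l₁ l₂ : List (ℕ × Bool)} (F : ℕ × Bool → Heis k A)
    (G : MultilinearMap k (fun _ : Fin [a₀, a₁, a₂].length => Heis k A) W) :
    (G fun j => strandProd [a₀, a₁, a₂][j].pt (([l₀, l₁, l₂][j.1]?.getD []).map F)) =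
      curryThree (k := k) G (strandProd a₀.pt (l₀.map F)) (strandProd a₁.pt (l₁.map F))
        (strandProd a₂.pt (l₂.map F)) := by
  refine congrArg G (funext fun j => ?_)
  fin_cases j <;> rfl

omit [Fintype ι]

lemma tokLabel_zero (L : Slice) (X : List Slice) (x : ι) (t : List (Option ι)) (u : Bool) :
    tokLabel e (L :: X) (some x :: t) (0, u) = genLabel e L.gen u x := rfl

lemma tokLabel_one (L L₁ : Slice) (X : List Slice) (o : Option ι) (x : ι) (t : List (Option ι))
    (u : Bool) : tokLabel e (L :: L₁ :: X) (o :: some x :: t) (1, u) = genLabel e L₁.gen u x := rfl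

lemma tokLabel_two (L L₁ L₂ : Slice) (X : List Slice) (o o₁ : Option ι) (x : ι)
    (t : List (Option ι)) (u : Bool) :
    tokLabel e (L :: L₁ :: L₂ :: X) (o :: o₁ :: some x :: t) (2, u) = genLabel e L₂.gen u x := rfl

end ReplacedArcs

/-! ### The strands of the colored moves -/

section MoveArcs

variable {k A : Type*} [Field k] [Ring A] [HopfAlgebra k A] {ι : Type*} [Fintype ι]
  (e : Module.Basis ι k A) (W : Type*) [AddCommGroup W] [Module k W]

/-- The points of every strand are listed from `src` to `tgt`, and so are the crossings met. How
strands are followed depends on their directions but not on their colours; once the directions are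
known, all geometric conditions hold by evaluation. Without crossings both state sums consist of a
single term, with all products equal to `1`. -/
lemma sameArcs_virtCancel (a b : Pt) :
    SameArcs e W
      [⟨[], .virt a b, []⟩, ⟨[], .virt b a, []⟩]
      []
      [a, b]
      [⟨a, (false, 0), (true, 0)⟩, ⟨b, (false, 1), (true, 1)⟩]
      [[(0, 0), (1, 1), (2, 0)], [(0, 1), (1, 0), (2, 1)]]
      [[(0, 0)], [(0, 1)]]
      [[], []] [[], []] where
  ne_nil := List.cons_ne_nil _ _
  composable := by
    rcases a with ⟨ta, _ | _⟩ <;> rcases b with ⟨tb, _ | _⟩ <;>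
      exact ⟨rfl, rfl, trivial⟩
  composable' := trivial
  bot := by
    rcases a with ⟨ta, _ | _⟩ <;> rcases b with ⟨tb, _ | _⟩ <;>
      exact rfl
  hasArcs := by
    rcases a with ⟨ta, _ | _⟩ <;> rcases b with ⟨tb, _ | _⟩ <;>
      exact ⟨rfl, rfl, rfl, rfl, rfl, rfl, rfl, rfl⟩
  hasArcs' := by
    rcases a with ⟨ta, _ | _⟩ <;> rcases b with ⟨tb, _ | _⟩ <;>
      exact ⟨rfl, rfl, rfl, rfl, rfl, rfl, rfl, rfl⟩
  sum_eq G := by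
    simp only [stateSum, Gen.isCross, Bool.false_eq_true, if_false, apply_arcs_two,
      List.map_nil, strandProd_nil]

lemma sameArcs_virtBraid (a b c : Pt) :
    SameArcs e W
      [⟨[], .virt a b, [c]⟩, ⟨[b], .virt a c, []⟩, ⟨[], .virt b c, [a]⟩]
      [⟨[a], .virt b c, []⟩, ⟨[], .virt a c, [b]⟩, ⟨[c], .virt a b, []⟩]
      [a, b, c]
      [⟨a, (false, 0), (true, 2)⟩, ⟨b, (false, 1), (true, 1)⟩, ⟨c, (false, 2), (true, 0)⟩]
      [[(0, 0), (1, 1), (2, 2), (3, 2)], [(0, 1), (1, 0), (2, 0), (3, 1)], [(0, 2), (1, 2), (2,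
        1), (3, 0)]]
      [[(0, 0), (1, 0), (2, 1), (3, 2)], [(0, 1), (1, 2), (2, 2), (3, 1)], [(0, 2), (1, 1), (2,
        0), (3, 0)]]
      [[], [], []] [[], [], []] where
  ne_nil := List.cons_ne_nil _ _
  composable := by
    rcases a with ⟨ta, _ | _⟩ <;> rcases b with ⟨tb, _ | _⟩ <;> rcases c with ⟨tc, _ | _⟩ <;>
      exact ⟨rfl, rfl, rfl, trivial⟩
  composable' := by
    rcases a with ⟨ta, _ | _⟩ <;> rcases b with ⟨tb, _ | _⟩ <;> rcases c with ⟨tc, _ | _⟩ <;>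
      exact ⟨rfl, rfl, rfl, trivial⟩
  bot := by
    rcases a with ⟨ta, _ | _⟩ <;> rcases b with ⟨tb, _ | _⟩ <;> rcases c with ⟨tc, _ | _⟩ <;>
      exact rfl
  hasArcs := by
    rcases a with ⟨ta, _ | _⟩ <;> rcases b with ⟨tb, _ | _⟩ <;> rcases c with ⟨tc, _ | _⟩ <;>
      exact ⟨rfl, rfl, rfl, rfl, rfl, rfl, rfl, rfl⟩
  hasArcs' := by
    rcases a with ⟨ta, _ | _⟩ <;> rcases b with ⟨tb, _ | _⟩ <;> rcases c with ⟨tc, _ | _⟩ <;>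
      exact ⟨rfl, rfl, rfl, rfl, rfl, rfl, rfl, rfl⟩
  sum_eq G := by
    simp only [stateSum, Gen.isCross, Bool.false_eq_true, if_false, apply_arcs_three,
      List.map_nil, strandProd_nil]

/-- The crossing is row `0` on one side and row `2` on the other, with the same two strands and so
with the same labels. -/
lemma sameArcs_virtCross (s : Bool) (a b c : Pt) :
    SameArcs e W
      [⟨[], .cross s a b, [c]⟩, ⟨[b], .virt a c, []⟩, ⟨[], .virt b c, [a]⟩]
      [⟨[a], .virt b c, []⟩, ⟨[], .virt a c, [b]⟩, ⟨[c], .cross s a b, []⟩]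
      [a, b, c]
      [⟨a, (false, 0), (true, 2)⟩, ⟨b, (false, 1), (true, 1)⟩, ⟨c, (false, 2), (true, 0)⟩]
      [[(0, 0), (1, 1), (2, 2), (3, 2)], [(0, 1), (1, 0), (2, 0), (3, 1)], [(0, 2), (1, 2), (2,
        1), (3, 0)]]
      [[(0, 0), (1, 0), (2, 1), (3, 2)], [(0, 1), (1, 2), (2, 2), (3, 1)], [(0, 2), (1, 1), (2,
        0), (3, 0)]]
      [[(0, s)], [(0, !s)], []] [[(2, s)], [(2, !s)], []] where
  ne_nil := List.cons_ne_nil _ _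
  composable := by
    rcases a with ⟨ta, _ | _⟩ <;> rcases b with ⟨tb, _ | _⟩ <;> rcases c with ⟨tc, _ | _⟩ <;>
      exact ⟨rfl, rfl, rfl, trivial⟩
  composable' := by
    rcases a with ⟨ta, _ | _⟩ <;> rcases b with ⟨tb, _ | _⟩ <;> rcases c with ⟨tc, _ | _⟩ <;>
      exact ⟨rfl, rfl, rfl, trivial⟩
  bot := by
    rcases a with ⟨ta, _ | _⟩ <;> rcases b with ⟨tb, _ | _⟩ <;> rcases c with ⟨tc, _ | _⟩ <;>
      exact rfl
  hasArcs := by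
    rcases a with ⟨ta, _ | _⟩ <;> rcases b with ⟨tb, _ | _⟩ <;> rcases c with ⟨tc, _ | _⟩ <;>
      exact ⟨rfl, rfl, rfl, rfl, rfl, rfl, rfl, rfl⟩
  hasArcs' := by
    rcases a with ⟨ta, _ | _⟩ <;> rcases b with ⟨tb, _ | _⟩ <;> rcases c with ⟨tc, _ | _⟩ <;>
      exact ⟨rfl, rfl, rfl, rfl, rfl, rfl, rfl, rfl⟩
  sum_eq G := by
    simp only [stateSum, Gen.isCross, if_true, Bool.false_eq_true, if_false, apply_arcs_three,
      List.map_cons, List.map_nil, tokLabel_zero, tokLabel_two, genLabel_left, genLabel_right,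
      strandProd_nil]

lemma sameArcs_virtMini (u t : Pt) :
    SameArcs e W
      [⟨[], .virt u t, [u.flip]⟩, ⟨[t], .mini u, []⟩]
      [⟨[u], .virt t u.flip, []⟩, ⟨[], .mini u, [t]⟩]
      [u, t, u.flip]
      [⟨u, (false, 0), (false, 2)⟩, ⟨t, (false, 1), (true, 0)⟩]
      [[(0, 0), (1, 1), (1, 2), (0, 2)], [(0, 1), (1, 0), (2, 0)]]
      [[(0, 0), (1, 0), (1, 1), (0, 2)], [(0, 1), (1, 2), (2, 0)]]
      [[], []] [[], []] where
  ne_nil := List.cons_ne_nil _ _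
  composable := by
    rcases u with ⟨tu, _ | _⟩ <;> rcases t with ⟨tt, _ | _⟩ <;>
      exact ⟨rfl, rfl, trivial⟩
  composable' := by
    rcases u with ⟨tu, _ | _⟩ <;> rcases t with ⟨tt, _ | _⟩ <;>
      exact ⟨rfl, rfl, trivial⟩
  bot := by
    rcases u with ⟨tu, _ | _⟩ <;> rcases t with ⟨tt, _ | _⟩ <;>
      exact rfl
  hasArcs := by
    rcases u with ⟨tu, _ | _⟩ <;> rcases t with ⟨tt, _ | _⟩ <;>
      exact ⟨rfl, rfl, rfl, rfl, rfl, rfl, rfl, rfl⟩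
  hasArcs' := by
    rcases u with ⟨tu, _ | _⟩ <;> rcases t with ⟨tt, _ | _⟩ <;>
      exact ⟨rfl, rfl, rfl, rfl, rfl, rfl, rfl, rfl⟩
  sum_eq G := by
    simp only [stateSum, Gen.isCross, Bool.false_eq_true, if_false, apply_arcs_two,
      List.map_nil, strandProd_nil]

/-- An arc runs from `src` to `tgt` if its `pt` is directed downwards. At a maximum both ends are at
the bottom, and the strand starts on the left if the left leg is directed upwards; hence the arc
carries `u.flip`. -/
lemma sameArcs_virtMaxi (u t : Pt) :
    SameArcs e W
      [⟨[t], .maxi u, []⟩, ⟨[], .virt t u, [u.flip]⟩]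
      [⟨[], .maxi u, [t]⟩, ⟨[u], .virt u.flip t, []⟩]
      [t]
      [⟨u.flip, (true, 0), (true, 2)⟩, ⟨t, (false, 0), (true, 1)⟩]
      [[(2, 0), (1, 1), (1, 2), (2, 2)], [(0, 0), (1, 0), (2, 1)]]
      [[(2, 0), (1, 0), (1, 1), (2, 2)], [(0, 0), (1, 2), (2, 1)]]
      [[], []] [[], []] where
  ne_nil := List.cons_ne_nil _ _
  composable := by
    rcases u with ⟨tu, _ | _⟩ <;> rcases t with ⟨tt, _ | _⟩ <;>
      exact ⟨rfl, rfl, trivial⟩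
  composable' := by
    rcases u with ⟨tu, _ | _⟩ <;> rcases t with ⟨tt, _ | _⟩ <;>
      exact ⟨rfl, rfl, trivial⟩
  bot := by
    rcases u with ⟨tu, _ | _⟩ <;> rcases t with ⟨tt, _ | _⟩ <;>
      exact rfl
  hasArcs := by
    rcases u with ⟨tu, _ | _⟩ <;> rcases t with ⟨tt, _ | _⟩ <;>
      exact ⟨rfl, rfl, rfl, rfl, rfl, rfl, rfl, rfl⟩
  hasArcs' := by
    rcases u with ⟨tu, _ | _⟩ <;> rcases t with ⟨tt, _ | _⟩ <;>
      exact ⟨rfl, rfl, rfl, rfl, rfl, rfl, rfl, rfl⟩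
  sum_eq G := by
    simp only [stateSum, Gen.isCross, Bool.false_eq_true, if_false, apply_arcs_two,
      List.map_nil, strandProd_nil]

lemma sameArcs_virtKinkMini (u : Pt) :
    SameArcs e W
      [⟨[], .virt u u.flip, []⟩, ⟨[], .mini u.flip, []⟩]
      [⟨[], .mini u, []⟩]
      [u, u.flip]
      [⟨u, (false, 0), (false, 1)⟩]
      [[(0, 0), (1, 1), (1, 0), (0, 1)]]
      [[(0, 0), (0, 1)]]
      [[]] [[]] where
  ne_nil := List.cons_ne_nil _ _
  composable := by
    rcases u with ⟨tu, _ | _⟩ <;>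
      exact ⟨rfl, rfl, trivial⟩
  composable' := by
    rcases u with ⟨tu, _ | _⟩ <;>
      exact ⟨rfl, trivial⟩
  bot := by
    rcases u with ⟨tu, _ | _⟩ <;>
      exact rfl
  hasArcs := by
    rcases u with ⟨tu, _ | _⟩ <;>
      exact ⟨rfl, rfl, rfl, rfl, rfl, rfl, rfl, rfl⟩
  hasArcs' := by
    rcases u with ⟨tu, _ | _⟩ <;>
      exact ⟨rfl, rfl, rfl, rfl, rfl, rfl, rfl, rfl⟩
  sum_eq G := by
    simp only [stateSum, Gen.isCross, Bool.false_eq_true, if_false, apply_arcs_one,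
      List.map_nil, strandProd_nil]

lemma sameArcs_virtKinkMaxi (u : Pt) :
    SameArcs e W
      [⟨[], .maxi u, []⟩, ⟨[], .virt u u.flip, []⟩]
      [⟨[], .maxi u.flip, []⟩]
      []
      [⟨u, (true, 0), (true, 1)⟩]
      [[(2, 0), (1, 1), (1, 0), (2, 1)]]
      [[(1, 0), (1, 1)]]
      [[]] [[]] where
  ne_nil := List.cons_ne_nil _ _
  composable := by
    rcases u with ⟨tu, _ | _⟩ <;>
      exact ⟨rfl, rfl, trivial⟩
  composable' := by
    rcases u with ⟨tu, _ | _⟩ <;>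
      exact ⟨rfl, trivial⟩
  bot := by
    rcases u with ⟨tu, _ | _⟩ <;>
      exact rfl
  hasArcs := by
    rcases u with ⟨tu, _ | _⟩ <;>
      exact ⟨rfl, rfl, rfl, rfl, rfl, rfl, rfl, rfl⟩
  hasArcs' := by
    rcases u with ⟨tu, _ | _⟩ <;>
      exact ⟨rfl, rfl, rfl, rfl, rfl, rfl, rfl, rfl⟩
  sum_eq G := by
    simp only [stateSum, Gen.isCross, Bool.false_eq_true, if_false, apply_arcs_one,
      List.map_nil, strandProd_nil]

lemma sameArcs_zigzagRight (a : Pt) :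
    SameArcs e W
      [⟨[a], .maxi a.flip, []⟩, ⟨[], .mini a, [a]⟩]
      []
      [a]
      [⟨a, (false, 0), (true, 0)⟩]
      [[(0, 0), (1, 0), (1, 1), (1, 2), (2, 0)]]
      [[(0, 0)]]
      [[]] [[]] where
  ne_nil := List.cons_ne_nil _ _
  composable := by
    rcases a with ⟨ta, _ | _⟩ <;>
      exact ⟨rfl, rfl, trivial⟩
  composable' := trivial
  bot := by
    rcases a with ⟨ta, _ | _⟩ <;>
      exact rfl
  hasArcs := by
    rcases a with ⟨ta, _ | _⟩ <;>
      exact ⟨rfl, rfl, rfl, rfl, rfl, rfl, rfl, rfl⟩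
  hasArcs' := by
    rcases a with ⟨ta, _ | _⟩ <;>
      exact ⟨rfl, rfl, rfl, rfl, rfl, rfl, rfl, rfl⟩
  sum_eq G := by
    simp only [stateSum, Gen.isCross, Bool.false_eq_true, if_false, apply_arcs_one,
      List.map_nil, strandProd_nil]

lemma sameArcs_zigzagLeft (a : Pt) :
    SameArcs e W
      [⟨[], .maxi a, [a]⟩, ⟨[a], .mini a.flip, []⟩]
      []
      [a]
      [⟨a, (false, 0), (true, 0)⟩]
      [[(0, 0), (1, 2), (1, 1), (1, 0), (2, 0)]]
      [[(0, 0)]]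
      [[]] [[]] where
  ne_nil := List.cons_ne_nil _ _
  composable := by
    rcases a with ⟨ta, _ | _⟩ <;>
      exact ⟨rfl, rfl, trivial⟩
  composable' := trivial
  bot := by
    rcases a with ⟨ta, _ | _⟩ <;>
      exact rfl
  hasArcs := by
    rcases a with ⟨ta, _ | _⟩ <;>
      exact ⟨rfl, rfl, rfl, rfl, rfl, rfl, rfl, rfl⟩
  hasArcs' := by
    rcases a with ⟨ta, _ | _⟩ <;>
      exact ⟨rfl, rfl, rfl, rfl, rfl, rfl, rfl, rfl⟩
  sum_eq G := by
    simp only [stateSum, Gen.isCross, Bool.false_eq_true, if_false, apply_arcs_one,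
      List.map_nil, strandProd_nil]

variable (hγ : Function.Bijective (HopfAlgebra.antipode k : A →ₗ[k] A))
include hγ

/-- At the second crossing, of kind `!s`, the strand `a` comes from the top right. Its mark is
written `!!s`, because this is the form in which `genLabel_right` applies. -/
lemma sameArcs_zeroTwo (s : Bool) (a b : Pt) :
    SameArcs e W
      [⟨[], .cross s a b, []⟩, ⟨[], .cross (!s) b a, []⟩]
      []
      [a, b]
      [⟨a, (false, 0), (true, 0)⟩, ⟨b, (false, 1), (true, 1)⟩]
      [[(0, 0), (1, 1), (2, 0)], [(0, 1), (1, 0), (2, 1)]]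
      [[(0, 0)], [(0, 1)]]
      [[(0, s), (1, !!s)], [(0, !s), (1, !s)]] [[], []] where
  ne_nil := List.cons_ne_nil _ _
  composable := by
    rcases a with ⟨ta, _ | _⟩ <;> rcases b with ⟨tb, _ | _⟩ <;>
      exact ⟨rfl, rfl, trivial⟩
  composable' := trivial
  bot := by
    rcases a with ⟨ta, _ | _⟩ <;> rcases b with ⟨tb, _ | _⟩ <;>
      exact rfl
  hasArcs := by
    rcases a with ⟨ta, _ | _⟩ <;> rcases b with ⟨tb, _ | _⟩ <;>
      exact ⟨rfl, rfl, rfl, rfl, rfl, rfl, rfl, rfl⟩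
  hasArcs' := by
    rcases a with ⟨ta, _ | _⟩ <;> rcases b with ⟨tb, _ | _⟩ <;>
      exact ⟨rfl, rfl, rfl, rfl, rfl, rfl, rfl, rfl⟩
  sum_eq G := by
    simp only [stateSum, Gen.isCross, if_true, apply_arcs_two, List.map_cons, List.map_nil,
      tokLabel_zero, tokLabel_one, genLabel_left, genLabel_right, strandProd_nil]
    exact zeroTwo_identity e hγ (curryTwo G) s a b

lemma sameArcs_slideMini (s : Bool) (u t : Pt)
    (h : u.up = true ∨ ∀ a : A, HopfAlgebra.antipode k (HopfAlgebra.antipode k a) = a) :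
    SameArcs e W
      [⟨[], .cross s u t, [u.flip]⟩, ⟨[t], .mini u, []⟩]
      [⟨[u], .cross (!s) t u.flip, []⟩, ⟨[], .mini u, [t]⟩]
      [u, t, u.flip]
      [⟨u, (false, 0), (false, 2)⟩, ⟨t, (false, 1), (true, 0)⟩]
      [[(0, 0), (1, 1), (1, 2), (0, 2)], [(0, 1), (1, 0), (2, 0)]]
      [[(0, 0), (1, 0), (1, 1), (0, 2)], [(0, 1), (1, 2), (2, 0)]]
      [[(0, s)], [(0, !s)]] [[(0, !!s)], [(0, !s)]] where
  ne_nil := List.cons_ne_nil _ _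
  composable := by
    clear h
    rcases u with ⟨tu, _ | _⟩ <;> rcases t with ⟨tt, _ | _⟩ <;>
      exact ⟨rfl, rfl, trivial⟩
  composable' := by
    clear h
    rcases u with ⟨tu, _ | _⟩ <;> rcases t with ⟨tt, _ | _⟩ <;>
      exact ⟨rfl, rfl, trivial⟩
  bot := by
    clear h
    rcases u with ⟨tu, _ | _⟩ <;> rcases t with ⟨tt, _ | _⟩ <;>
      exact rfl
  hasArcs := by
    clear h
    rcases u with ⟨tu, _ | _⟩ <;> rcases t with ⟨tt, _ | _⟩ <;>
      exact ⟨rfl, rfl, rfl, rfl, rfl, rfl, rfl, rfl⟩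
  hasArcs' := by
    clear h
    rcases u with ⟨tu, _ | _⟩ <;> rcases t with ⟨tt, _ | _⟩ <;>
      exact ⟨rfl, rfl, rfl, rfl, rfl, rfl, rfl, rfl⟩
  sum_eq G := by
    simp only [stateSum, Gen.isCross, if_true, Bool.false_eq_true, if_false, apply_arcs_two,
      List.map_cons, List.map_nil, tokLabel_zero, genLabel_left, genLabel_right,
      strandProd_singleton]
    exact slide_identity e hγ (curryTwo G) s u t h

/-- The arc of the maximum carries `u.flip`, so this is `slide_identity` for `u.flip` and the
opposite kind, read from right to left. Accordingly the condition on the direction of `u` is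
opposite to that for a minimum. -/
lemma sameArcs_slideMaxi (s : Bool) (u t : Pt)
    (h : u.up = false ∨ ∀ a : A, HopfAlgebra.antipode k (HopfAlgebra.antipode k a) = a) :
    SameArcs e W
      [⟨[t], .maxi u, []⟩, ⟨[], .cross s t u, [u.flip]⟩]
      [⟨[], .maxi u, [t]⟩, ⟨[u], .cross (!s) u.flip t, []⟩]
      [t]
      [⟨u.flip, (true, 0), (true, 2)⟩, ⟨t, (false, 0), (true, 1)⟩]
      [[(2, 0), (1, 1), (1, 2), (2, 2)], [(0, 0), (1, 0), (2, 1)]]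
      [[(2, 0), (1, 0), (1, 1), (2, 2)], [(0, 0), (1, 2), (2, 1)]]
      [[(1, !s)], [(1, s)]] [[(1, !s)], [(1, !!s)]] where
  ne_nil := List.cons_ne_nil _ _
  composable := by
    clear h
    rcases u with ⟨tu, _ | _⟩ <;> rcases t with ⟨tt, _ | _⟩ <;>
      exact ⟨rfl, rfl, trivial⟩
  composable' := by
    clear h
    rcases u with ⟨tu, _ | _⟩ <;> rcases t with ⟨tt, _ | _⟩ <;>
      exact ⟨rfl, rfl, trivial⟩
  bot := by
    clear h
    rcases u with ⟨tu, _ | _⟩ <;> rcases t with ⟨tt, _ | _⟩ <;>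
      exact rfl
  hasArcs := by
    clear h
    rcases u with ⟨tu, _ | _⟩ <;> rcases t with ⟨tt, _ | _⟩ <;>
      exact ⟨rfl, rfl, rfl, rfl, rfl, rfl, rfl, rfl⟩
  hasArcs' := by
    clear h
    rcases u with ⟨tu, _ | _⟩ <;> rcases t with ⟨tt, _ | _⟩ <;>
      exact ⟨rfl, rfl, rfl, rfl, rfl, rfl, rfl, rfl⟩
  sum_eq G := by
    simp only [stateSum, Gen.isCross, if_true, Bool.false_eq_true, if_false, apply_arcs_two,
      List.map_cons, List.map_nil, tokLabel_one, genLabel_left, genLabel_right,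
      strandProd_singleton]
    have h1 := slide_identity e hγ (curryTwo (k := k) G) (!s) u.flip t (h.imp_left fun h => by simp [Pt.flip, h])
    rw [Bool.not_not, Pt.flip_flip] at h1
    exact h1.symm

lemma sameArcs_pachner₁ (s : Bool) (a b c : Pt) (h : b.thick = b.up)
    (h2 : b.up = true → ∀ a : A, HopfAlgebra.antipode k (HopfAlgebra.antipode k a) = a) :
    SameArcs e W
      [⟨[a], .cross s b c, []⟩, ⟨[], .cross s a c, [b]⟩, ⟨[c], .cross s a b, []⟩]
      [⟨[], .cross s a b, [c]⟩, ⟨[b], .virt a c, []⟩, ⟨[], .cross s b c, [a]⟩]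
      [a, b, c]
      [⟨a, (false, 0), (true, 2)⟩, ⟨b, (false, 1), (true, 1)⟩, ⟨c, (false, 2), (true, 0)⟩]
      [[(0, 0), (1, 0), (2, 1), (3, 2)], [(0, 1), (1, 2), (2, 2), (3, 1)], [(0, 2), (1, 1), (2,
        0), (3, 0)]]
      [[(0, 0), (1, 1), (2, 2), (3, 2)], [(0, 1), (1, 0), (2, 0), (3, 1)], [(0, 2), (1, 2), (2,
        1), (3, 0)]]
      [[(1, s), (2, s)], [(0, s), (2, !s)], [(0, !s), (1, !s)]] [[(0, s)], [(0, !s), (2, s)], [(2, !s)]] where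
  ne_nil := List.cons_ne_nil _ _
  composable := by
    clear h h2
    rcases a with ⟨ta, _ | _⟩ <;> rcases b with ⟨tb, _ | _⟩ <;> rcases c with ⟨tc, _ | _⟩ <;>
      exact ⟨rfl, rfl, rfl, trivial⟩
  composable' := by
    clear h h2
    rcases a with ⟨ta, _ | _⟩ <;> rcases b with ⟨tb, _ | _⟩ <;> rcases c with ⟨tc, _ | _⟩ <;>
      exact ⟨rfl, rfl, rfl, trivial⟩
  bot := by
    clear h h2
    rcases a with ⟨ta, _ | _⟩ <;> rcases b with ⟨tb, _ | _⟩ <;> rcases c with ⟨tc, _ | _⟩ <;>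
      exact rfl
  hasArcs := by
    clear h h2
    rcases a with ⟨ta, _ | _⟩ <;> rcases b with ⟨tb, _ | _⟩ <;> rcases c with ⟨tc, _ | _⟩ <;>
      exact ⟨rfl, rfl, rfl, rfl, rfl, rfl, rfl, rfl⟩
  hasArcs' := by
    clear h h2
    rcases a with ⟨ta, _ | _⟩ <;> rcases b with ⟨tb, _ | _⟩ <;> rcases c with ⟨tc, _ | _⟩ <;>
      exact ⟨rfl, rfl, rfl, rfl, rfl, rfl, rfl, rfl⟩
  sum_eq G := by
    simp only [stateSum, Gen.isCross, if_true, Bool.false_eq_true, if_false, apply_arcs_three,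
      List.map_cons, List.map_nil, tokLabel_zero, tokLabel_one, tokLabel_two, genLabel_left,
      genLabel_right]
    exact pachner₁_identity e hγ (curryThree G) s a b c h h2

lemma sameArcs_pachner₂ (s : Bool) (a b c : Pt) (h : b.thick ≠ b.up) :
    SameArcs e W
      [⟨[], .cross s a b, [c]⟩, ⟨[b], .cross s a c, []⟩, ⟨[], .cross s b c, [a]⟩]
      [⟨[a], .cross s b c, []⟩, ⟨[], .virt a c, [b]⟩, ⟨[c], .cross s a b, []⟩]
      [a, b, c]
      [⟨a, (false, 0), (true, 2)⟩, ⟨b, (false, 1), (true, 1)⟩, ⟨c, (false, 2), (true, 0)⟩]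
      [[(0, 0), (1, 1), (2, 2), (3, 2)], [(0, 1), (1, 0), (2, 0), (3, 1)], [(0, 2), (1, 2), (2,
        1), (3, 0)]]
      [[(0, 0), (1, 0), (2, 1), (3, 2)], [(0, 1), (1, 2), (2, 2), (3, 1)], [(0, 2), (1, 1), (2,
        0), (3, 0)]]
      [[(0, s), (1, s)], [(0, !s), (2, s)], [(1, !s), (2, !s)]] [[(2, s)], [(0, s), (2, !s)], [(0, !s)]] where
  ne_nil := List.cons_ne_nil _ _
  composable := by
    clear h
    rcases a with ⟨ta, _ | _⟩ <;> rcases b with ⟨tb, _ | _⟩ <;> rcases c with ⟨tc, _ | _⟩ <;>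
      exact ⟨rfl, rfl, rfl, trivial⟩
  composable' := by
    clear h
    rcases a with ⟨ta, _ | _⟩ <;> rcases b with ⟨tb, _ | _⟩ <;> rcases c with ⟨tc, _ | _⟩ <;>
      exact ⟨rfl, rfl, rfl, trivial⟩
  bot := by
    clear h
    rcases a with ⟨ta, _ | _⟩ <;> rcases b with ⟨tb, _ | _⟩ <;> rcases c with ⟨tc, _ | _⟩ <;>
      exact rfl
  hasArcs := by
    clear h
    rcases a with ⟨ta, _ | _⟩ <;> rcases b with ⟨tb, _ | _⟩ <;> rcases c with ⟨tc, _ | _⟩ <;>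
      exact ⟨rfl, rfl, rfl, rfl, rfl, rfl, rfl, rfl⟩
  hasArcs' := by
    clear h
    rcases a with ⟨ta, _ | _⟩ <;> rcases b with ⟨tb, _ | _⟩ <;> rcases c with ⟨tc, _ | _⟩ <;>
      exact ⟨rfl, rfl, rfl, rfl, rfl, rfl, rfl, rfl⟩
  sum_eq G := by
    simp only [stateSum, Gen.isCross, if_true, Bool.false_eq_true, if_false, apply_arcs_three,
      List.map_cons, List.map_nil, tokLabel_zero, tokLabel_one, tokLabel_two, genLabel_left,
      genLabel_right]
    exact pachner₂_identity e hγ (curryThree G) s a b c h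

end MoveArcs

/-! ### The strands of the half turns -/

section HalfTurns

variable {k A : Type*} [Field k] [Ring A] [HopfAlgebra k A] {ι : Type*} [Fintype ι]
  (e : Module.Basis ι k A) (W : Type*) [AddCommGroup W] [Module k W]

variable (hγ : Function.Bijective (HopfAlgebra.antipode k : A →ₗ[k] A))
include hγ

lemma sameArcs_halfTurnRight (s : Bool) (a b : Pt)
    (h : a.up = b.up ∨ ∀ a : A, HopfAlgebra.antipode k (HopfAlgebra.antipode k a) = a) :
    SameArcs e W
      [⟨[a, b], .maxi a.flip, []⟩, ⟨[a, b, a.flip], .maxi b.flip, [a]⟩,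
        ⟨[a, b], .cross s a.flip b.flip, [b, a]⟩, ⟨[a], .mini b, [a.flip, b, a]⟩,
        ⟨[], .mini a, [b, a]⟩]
      [⟨[], .cross s a b, []⟩]
      [a, b]
      [⟨a, (false, 0), (true, 1)⟩, ⟨b, (false, 1), (true, 0)⟩]
      [[(0, 0), (1, 0), (2, 0), (3, 0), (4, 0), (4, 1), (3, 3), (2, 2), (1, 2), (1, 3), (2, 5),
        (3, 5), (4, 3), (5, 1)], [(0, 1), (1, 1), (2, 1), (3, 1), (3, 2), (2, 3), (2, 4),
        (3, 4), (4, 2), (5, 0)]]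
      [[(0, 0), (1, 1)], [(0, 1), (1, 0)]]
      [[(2, s)], [(2, !s)]] [[(0, s)], [(0, !s)]] where
  ne_nil := List.cons_ne_nil _ _
  composable := by
    clear h
    rcases a with ⟨ta, _ | _⟩ <;> rcases b with ⟨tb, _ | _⟩ <;>
      exact ⟨rfl, rfl, rfl, rfl, rfl, trivial⟩
  composable' := by
    clear h
    rcases a with ⟨ta, _ | _⟩ <;> rcases b with ⟨tb, _ | _⟩ <;>
      exact ⟨rfl, trivial⟩
  bot := by
    clear h
    rcases a with ⟨ta, _ | _⟩ <;> rcases b with ⟨tb, _ | _⟩ <;>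
      exact rfl
  hasArcs := by
    clear h
    rcases a with ⟨ta, _ | _⟩ <;> rcases b with ⟨tb, _ | _⟩ <;>
      exact ⟨rfl, rfl, rfl, rfl, rfl, rfl, rfl, rfl⟩
  hasArcs' := by
    clear h
    rcases a with ⟨ta, _ | _⟩ <;> rcases b with ⟨tb, _ | _⟩ <;>
      exact ⟨rfl, rfl, rfl, rfl, rfl, rfl, rfl, rfl⟩
  sum_eq G := by
    simp only [stateSum, Gen.isCross, if_true, Bool.false_eq_true, if_false, apply_arcs_two,
      List.map_cons, List.map_nil, tokLabel_zero, tokLabel_two, genLabel_left, genLabel_right,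
      strandProd_singleton]
    exact halfTurn_identity e hγ (curryTwo G) s a b h

lemma sameArcs_halfTurnLeft (s : Bool) (a b : Pt)
    (h : a.up = b.up ∨ ∀ a : A, HopfAlgebra.antipode k (HopfAlgebra.antipode k a) = a) :
    SameArcs e W
      [⟨[], .maxi b, [a, b]⟩, ⟨[b], .maxi a, [b.flip, a, b]⟩,
        ⟨[b, a], .cross s a.flip b.flip, [a, b]⟩, ⟨[b, a, b.flip], .mini a.flip, [b]⟩,
        ⟨[b, a], .mini b.flip, []⟩]
      [⟨[], .cross s a b, []⟩]
      [a, b]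
      [⟨a, (false, 0), (true, 1)⟩, ⟨b, (false, 1), (true, 0)⟩]
      [[(0, 0), (1, 2), (2, 4), (3, 4), (3, 3), (2, 2), (2, 1), (3, 1), (4, 1), (5, 1)], [(0,
        1), (1, 3), (2, 5), (3, 5), (4, 3), (4, 2), (3, 2), (2, 3), (1, 1), (1, 0), (2,
        0), (3, 0), (4, 0), (5, 0)]]
      [[(0, 0), (1, 1)], [(0, 1), (1, 0)]]
      [[(2, s)], [(2, !s)]] [[(0, s)], [(0, !s)]] where
  ne_nil := List.cons_ne_nil _ _
  composable := by
    clear h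
    rcases a with ⟨ta, _ | _⟩ <;> rcases b with ⟨tb, _ | _⟩ <;>
      exact ⟨rfl, rfl, rfl, rfl, rfl, trivial⟩
  composable' := by
    clear h
    rcases a with ⟨ta, _ | _⟩ <;> rcases b with ⟨tb, _ | _⟩ <;>
      exact ⟨rfl, trivial⟩
  bot := by
    clear h
    rcases a with ⟨ta, _ | _⟩ <;> rcases b with ⟨tb, _ | _⟩ <;>
      exact rfl
  hasArcs := by
    clear h
    rcases a with ⟨ta, _ | _⟩ <;> rcases b with ⟨tb, _ | _⟩ <;>
      exact ⟨rfl, rfl, rfl, rfl, rfl, rfl, rfl, rfl⟩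
  hasArcs' := by
    clear h
    rcases a with ⟨ta, _ | _⟩ <;> rcases b with ⟨tb, _ | _⟩ <;>
      exact ⟨rfl, rfl, rfl, rfl, rfl, rfl, rfl, rfl⟩
  sum_eq G := by
    simp only [stateSum, Gen.isCross, if_true, Bool.false_eq_true, if_false, apply_arcs_two,
      List.map_cons, List.map_nil, tokLabel_zero, tokLabel_two, genLabel_left, genLabel_right,
      strandProd_singleton]
    exact halfTurn_identity e hγ (curryTwo G) s a b h

end HalfTurns

/-! ### All moves other than the exchange of heights -/

section Moves

variable {k A : Type*} [Field k] [Ring A] [HopfAlgebra k A] {ι : Type*} [Fintype ι]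
  (e : Module.Basis ι k A)

lemma sameArcs_of_move (W : Type*) [AddCommGroup W] [Module k W]
    (hγ : Function.Bijective (HopfAlgebra.antipode k : A →ₗ[k] A)) {x : Bool} {M M' : List Slice}
    (h : Move x M M')
    (h2 : x = true → ∀ a : A, HopfAlgebra.antipode k (HopfAlgebra.antipode k a) = a) :
    ∃ w arcs paths paths' toks toks', SameArcs e W M M' w arcs paths paths' toks toks' := by
  -- For slides and half turns the Boolean of the move is `false` exactly if the directions satisfy
  -- the condition under which no assumption on `γ²` is needed.
  have split {p : Prop} {y : Bool} (hy : y = false → p)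
      (h2 : y = true → ∀ a : A, HopfAlgebra.antipode k (HopfAlgebra.antipode k a) = a) :
      p ∨ ∀ a : A, HopfAlgebra.antipode k (HopfAlgebra.antipode k a) = a := by
    cases y
    · exact .inl (hy rfl)
    · exact .inr (h2 rfl)
  cases h with
  | pachner₁ s a b c h => exact ⟨_, _, _, _, _, _, sameArcs_pachner₁ e W hγ s a b c h h2⟩
  | pachner₂ s a b c h => exact ⟨_, _, _, _, _, _, sameArcs_pachner₂ e W hγ s a b c h⟩
  | zeroTwo s a b => exact ⟨_, _, _, _, _, _, sameArcs_zeroTwo e W hγ s a b⟩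
  | virtCancel a b => exact ⟨_, _, _, _, _, _, sameArcs_virtCancel e W a b⟩
  | virtBraid a b c => exact ⟨_, _, _, _, _, _, sameArcs_virtBraid e W a b c⟩
  | virtCross s a b c => exact ⟨_, _, _, _, _, _, sameArcs_virtCross e W s a b c⟩
  | virtMini u t => exact ⟨_, _, _, _, _, _, sameArcs_virtMini e W u t⟩
  | virtMaxi u t => exact ⟨_, _, _, _, _, _, sameArcs_virtMaxi e W u t⟩
  | virtKinkMini u => exact ⟨_, _, _, _, _, _, sameArcs_virtKinkMini e W u⟩
  | virtKinkMaxi u => exact ⟨_, _, _, _, _, _, sameArcs_virtKinkMaxi e W u⟩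
  | zigzagRight a => exact ⟨_, _, _, _, _, _, sameArcs_zigzagRight e W a⟩
  | zigzagLeft a => exact ⟨_, _, _, _, _, _, sameArcs_zigzagLeft e W a⟩
  | slideMini s u t =>
    exact ⟨_, _, _, _, _, _, sameArcs_slideMini e W hγ s u t (split (by simp) h2)⟩
  | slideMaxi s u t =>
    exact ⟨_, _, _, _, _, _, sameArcs_slideMaxi e W hγ s u t (split id h2)⟩
  | halfTurnRight s a b =>
    exact ⟨_, _, _, _, _, _, sameArcs_halfTurnRight e W hγ s a b (split (by simp) h2)⟩
  | halfTurnLeft s a b =>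
    exact ⟨_, _, _, _, _, _, sameArcs_halfTurnLeft e W hγ s a b (split (by simp) h2)⟩

end Moves

/-! ### The exchange of heights -/

/-- The strands of an elementary diagram. -/
def Gen.arcs : Gen → List Arc
  | .cross _ a b | .virt a b => [⟨a, (false, 0), (true, 1)⟩, ⟨b, (false, 1), (true, 0)⟩]
  | .mini a => [⟨a, (false, 0), (false, 1)⟩]
  | .maxi a => [⟨a.flip, (true, 0), (true, 1)⟩]

/-- The strands of crossings which are traversed by the strands of an elementary diagram in a
column, in which it is the row `j`. -/
def Gen.toks (j : ℕ) : Gen → List (List (ℕ × Bool))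
  | .cross s _ _ => [[(j, s)], [(j, !s)]]
  | .virt _ _ => [[], []]
  | .mini _ | .maxi _ => [[]]

lemma Gen.hasArcs_upper (g : Gen) :
    ∃ paths, (Col.mk g.src [some ⟨[], g, []⟩, none]).HasArcs g.arcs paths (g.toks 0) := by
  rcases g with ⟨s, a, b⟩ | ⟨a, b⟩ | a | a
  · refine ⟨[[(0, 0), (1, 1), (2, 1)], [(0, 1), (1, 0), (2, 0)]], ?_⟩
    rcases a with ⟨ta, _ | _⟩ <;> rcases b with ⟨tb, _ | _⟩ <;>
      exact ⟨rfl, rfl, rfl, rfl, rfl, rfl, rfl, rfl⟩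
  · refine ⟨[[(0, 0), (1, 1), (2, 1)], [(0, 1), (1, 0), (2, 0)]], ?_⟩
    rcases a with ⟨ta, _ | _⟩ <;> rcases b with ⟨tb, _ | _⟩ <;>
      exact ⟨rfl, rfl, rfl, rfl, rfl, rfl, rfl, rfl⟩
  · refine ⟨[[(0, 0), (0, 1)]], ?_⟩
    rcases a with ⟨ta, _ | _⟩ <;> exact ⟨rfl, rfl, rfl, rfl, rfl, rfl, rfl, rfl⟩
  · refine ⟨[[(2, 0), (1, 0), (1, 1), (2, 1)]], ?_⟩
    rcases a with ⟨ta, _ | _⟩ <;> exact ⟨rfl, rfl, rfl, rfl, rfl, rfl, rfl, rfl⟩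

lemma Gen.hasArcs_lower (g : Gen) :
    ∃ paths, (Col.mk g.src [none, some ⟨[], g, []⟩]).HasArcs g.arcs paths (g.toks 1) := by
  rcases g with ⟨s, a, b⟩ | ⟨a, b⟩ | a | a
  · refine ⟨[[(0, 0), (1, 0), (2, 1)], [(0, 1), (1, 1), (2, 0)]], ?_⟩
    rcases a with ⟨ta, _ | _⟩ <;> rcases b with ⟨tb, _ | _⟩ <;>
      exact ⟨rfl, rfl, rfl, rfl, rfl, rfl, rfl, rfl⟩
  · refine ⟨[[(0, 0), (1, 0), (2, 1)], [(0, 1), (1, 1), (2, 0)]], ?_⟩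
    rcases a with ⟨ta, _ | _⟩ <;> rcases b with ⟨tb, _ | _⟩ <;>
      exact ⟨rfl, rfl, rfl, rfl, rfl, rfl, rfl, rfl⟩
  · refine ⟨[[(0, 0), (1, 0), (1, 1), (0, 1)]], ?_⟩
    rcases a with ⟨ta, _ | _⟩ <;> exact ⟨rfl, rfl, rfl, rfl, rfl, rfl, rfl, rfl⟩
  · refine ⟨[[(2, 0), (2, 1)]], ?_⟩
    rcases a with ⟨ta, _ | _⟩ <;> exact ⟨rfl, rfl, rfl, rfl, rfl, rfl, rfl, rfl⟩

namespace Col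

/-- Two columns with the same ends, the strands of which have the same ends, too. -/
structure SameEnds {K : Type*} (C C' : Col) (thk : K → Bool) (vis vis' : K → List (ℕ × Bool)) :
    Prop where
  strands : ∃ ent ext tl tl', C.Strands ent ext thk tl vis ∧ C'.Strands ent ext thk tl' vis'
  wf : C.Wf
  wf' : C'.Wf
  top : C.top = C'.top
  bot : C.word C.rows.length = C'.word C'.rows.length

/-- Both juxtapositions displace the ends of the right columns by the widths of the left columns.
These widths agree at the top and at the bottom, though possibly not in between. -/
lemma SameEnds.hcomp {A A' B B' : Col} {K K' : Type*} {thk : K → Bool} {thk' : K' → Bool}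
    {vis vis' : K → List (ℕ × Bool)} {wis wis' : K' → List (ℕ × Bool)}
    (hA : A.SameEnds A' thk vis vis') (hB : B.SameEnds B' thk' wis wis') (h : A.Compat B)
    (h' : A'.Compat B') : (A.hcomp B).SameEnds (A'.hcomp B') (Sum.elim thk thk')
      (Sum.elim vis wis) (Sum.elim vis' wis') := by
  obtain ⟨ent, ext, tl, tl', S, S'⟩ := hA.strands
  obtain ⟨_, _, _, _, T, T'⟩ := hB.strands
  refine ⟨⟨_, _, _, _, Strands.hcomp h hA.wf S T rfl rfl, Strands.hcomp h' hA.wf' S' T'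
    (congrArg List.length hA.top.symm) (congrArg List.length hA.bot.symm)⟩,
    hcomp_wf h hA.wf hB.wf, hcomp_wf h' hA.wf' hB.wf', ?_, ?_⟩
  · change A.top ++ B.top = A'.top ++ B'.top
    rw [hA.top, hB.top]
  · rw [hcomp_length, hcomp_length, hcomp_word h le_rfl, hcomp_word h' le_rfl, hA.bot, h.length,
      h'.length, hB.bot]

lemma sameEnds_through (l : List Pt) (q : ℕ) : (through l q).SameEnds (through l q)
    (fun i : Fin l.length => l[i].thick) (fun _ => []) fun _ => [] := by
  obtain ⟨_, S⟩ := through_strands l q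
  exact ⟨⟨_, _, _, _, S, S⟩, through_wf _ _, through_wf _ _, rfl, rfl⟩

/-- An elementary diagram above vertical strands. -/
def upper (g : Gen) : Col := ⟨g.src, [some ⟨[], g, []⟩, none]⟩

/-- An elementary diagram below vertical strands. -/
def lower (g : Gen) : Col := ⟨g.src, [none, some ⟨[], g, []⟩]⟩

lemma sameEnds_upper_lower (g : Gen) : (upper g).SameEnds (lower g)
    (fun j : Fin g.arcs.length => g.arcs[j].pt.thick)
    (fun j => g.arcs[j].orient ((g.toks 0)[j.1]?.getD []))
    fun j => g.arcs[j].orient ((g.toks 1)[j.1]?.getD []) := by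
  obtain ⟨_, h⟩ := g.hasArcs_upper
  obtain ⟨_, h'⟩ := g.hasArcs_lower
  obtain ⟨_, S⟩ := h.strands
  obtain ⟨_, S'⟩ := h'.strands
  refine ⟨⟨_, _, _, _, S, S'⟩, ?_, ?_, rfl, rfl⟩
  · rintro (_ | _ | j) L hL
    · obtain rfl : _ = L := by simpa [upper] using hL
      simp [upper, word, Slice.src]
    · simp [upper] at hL
    · simp [upper] at hL
  · rintro (_ | _ | j) L hL
    · simp [lower] at hL
    · obtain rfl : _ = L := by simpa [lower] using hL
      simp [lower, word, Slice.src]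
    · simp [lower] at hL

lemma SameEnds.symm {C C' : Col} {K : Type*} {thk : K → Bool} {vis vis' : K → List (ℕ × Bool)}
    (h : C.SameEnds C' thk vis vis') : C'.SameEnds C thk vis' vis := by
  obtain ⟨_, _, _, _, S, S'⟩ := h.strands
  exact ⟨⟨_, _, _, _, S', S⟩, h.wf', h.wf, h.top.symm, h.bot.symm⟩

lemma compat_iff_two {A B : Col} {a a' b b' : Option Slice} (hA : A.rows = [a, a'])
    (hB : B.rows = [b, b']) (h : a = none ∨ b = none) (h' : a' = none ∨ b' = none) :
    A.Compat B := by
  refine ⟨by rw [hA, hB]; rfl, ?_⟩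
  rw [hA, hB]
  rintro (_ | _ | j)
  · simpa using h
  · simpa using h'
  · simp

/-- Two elementary diagrams side by side, of which the left one is above the right one. -/
def leftAbove (l m r : List Pt) (g g' : Gen) : Col :=
  ((((through l 2).hcomp (upper g)).hcomp (through m 2)).hcomp (lower g')).hcomp (through r 2)

/-- Two elementary diagrams side by side, of which the left one is below the right one. -/
def leftBelow (l m r : List Pt) (g g' : Gen) : Col :=
  ((((through l 2).hcomp (lower g)).hcomp (through m 2)).hcomp (upper g')).hcomp (through r 2)

variable (l m r : List Pt) (g g' : Gen)

lemma leftAbove_rows : (leftAbove l m r g g').rows =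
    [⟨l, g, m ++ g'.src ++ r⟩, ⟨l ++ g.tgt ++ m, g', r⟩].map some := by
  simp [leftAbove, hcomp, hrow, through, upper, lower, List.range_succ, Slice.whisker, word,
    Slice.tgt]

lemma leftBelow_rows : (leftBelow l m r g g').rows =
    [⟨l ++ g.src ++ m, g', r⟩, ⟨l, g, m ++ g'.tgt ++ r⟩].map some := by
  simp [leftBelow, hcomp, hrow, through, upper, lower, List.range_succ, Slice.whisker, word,
    Slice.tgt]

/-- The elementary diagrams and the numbers of vertical strands are arbitrary, so evaluation is not
available. Instead each side is a juxtaposition of five columns, in which the elementary diagrams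
occupy different rows, and each factor has the same ends on both sides. -/
lemma sameEnds_exchange : (leftAbove l m r g g').SameEnds (leftBelow l m r g g')
    (Sum.elim (Sum.elim (Sum.elim (Sum.elim (fun i : Fin l.length => l[i].thick)
      fun j : Fin g.arcs.length => g.arcs[j].pt.thick) fun i : Fin m.length => m[i].thick)
      fun j : Fin g'.arcs.length => g'.arcs[j].pt.thick) fun i : Fin r.length => r[i].thick)
    (Sum.elim (Sum.elim (Sum.elim (Sum.elim (fun _ => [])
      fun j => g.arcs[j].orient ((g.toks 0)[j.1]?.getD [])) fun _ => [])
      fun j => g'.arcs[j].orient ((g'.toks 1)[j.1]?.getD [])) fun _ => [])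
    (Sum.elim (Sum.elim (Sum.elim (Sum.elim (fun _ => [])
      fun j => g.arcs[j].orient ((g.toks 1)[j.1]?.getD [])) fun _ => [])
      fun j => g'.arcs[j].orient ((g'.toks 0)[j.1]?.getD [])) fun _ => []) := by
  have h₁ := (sameEnds_through l 2).hcomp (sameEnds_upper_lower g)
    (compat_iff_two rfl rfl (.inl rfl) (.inl rfl)) (compat_iff_two rfl rfl (.inl rfl) (.inl rfl))
  have h₂ := h₁.hcomp (sameEnds_through m 2)
    (compat_iff_two rfl rfl (.inr rfl) (.inr rfl)) (compat_iff_two rfl rfl (.inr rfl) (.inr rfl))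
  have h₃ := h₂.hcomp (sameEnds_upper_lower g').symm
    (compat_iff_two rfl rfl (.inr rfl) (.inl rfl)) (compat_iff_two rfl rfl (.inl rfl) (.inr rfl))
  exact h₃.hcomp (sameEnds_through r 2)
    (compat_iff_two rfl rfl (.inr rfl) (.inr rfl)) (compat_iff_two rfl rfl (.inr rfl) (.inr rfl))

end Col

/-- The exchange of the first two slices. -/
def swapSlices (v : ℕ × Bool) : ℕ × Bool :=
  (match v.1 with
  | 0 => 1
  | 1 => 0
  | j => j, v.2)

lemma Arc.orient_map {α β : Type*} (a : Arc) (f : α → β) (l : List α) :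
    (a.orient l).map f = a.orient (l.map f) := by
  unfold Arc.orient
  split_ifs
  · rw [List.map_reverse]
  · rfl

lemma Gen.toks_swap (g : Gen) (j : ℕ) :
    ((g.toks 0)[j]?.getD []).map swapSlices = (g.toks 1)[j]?.getD [] ∧
      ((g.toks 1)[j]?.getD []).map swapSlices = (g.toks 0)[j]?.getD [] := by
  rcases g with ⟨s, a, b⟩ | ⟨a, b⟩ | a | a <;> rcases j with _ | _ | j <;> exact ⟨rfl, rfl⟩

section Exchange

variable {k A : Type*} [Field k] [Ring A] [HopfAlgebra k A] {ι : Type*} [Fintype ι]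
  (e : Module.Basis ι k A)

/-- The two slices keep their elementary diagrams and thus their labels. Only the row numbers and
the order of the two summations are exchanged. -/
lemma sameSum_swap {W : Type*} [AddCommGroup W] [Module k W] {K : Type*} (thk : K → Bool)
    {L₀ L₁ L₀' L₁' : Slice} (h₀ : L₀.gen = L₀'.gen) (h₁ : L₁.gen = L₁'.gen)
    {vis vis' : K → List (ℕ × Bool)} (h : ∀ j, vis' j = (vis j).map swapSlices) :
    SameSum e W thk [L₀, L₁] [L₁', L₀'] vis vis' := by
  intro G
  have hs {L L' : Slice} (hL : L.gen = L'.gen) (F : List (Option ι) → W) :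
      stateSum [L] F = stateSum [L'] F := by
    simp only [stateSum, hL]
  rw [← List.singleton_append, stateSum_append, ← List.singleton_append (l := [L₀']),
    stateSum_append, stateSum_comm, hs h₁]
  refine stateSum_congr _ fun t' ht' => ?_
  rw [hs h₀]
  refine stateSum_congr _ fun t ht => ?_
  obtain ⟨x, rfl⟩ := List.length_eq_one_iff.1 ht
  obtain ⟨y, rfl⟩ := List.length_eq_one_iff.1 ht'
  congr 1
  funext j
  rw [stateVal, stateVal, h j, List.map_map]
  congr 3
  funext v
  obtain ⟨_ | _ | v, u⟩ := v
  · rcases x with _ | a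
    · rfl
    · exact congrArg (genLabel e · u a) h₀
  · rcases y with _ | a
    · rfl
    · exact congrArg (genLabel e · u a) h₁
  · simp [tokLabel, swapSlices]

variable {n : ℕ} {μ ν : Fin n → Bool}

lemma sameSum_exchange (W : Type*) [AddCommGroup W] [Module k W] (l m r : List Pt) (g g' : Gen) :
    SameSum e W
      (Sum.elim (Sum.elim (Sum.elim (Sum.elim (fun i : Fin l.length => l[i].thick)
        fun j : Fin g.arcs.length => g.arcs[j].pt.thick) fun i : Fin m.length => m[i].thick)
        fun j : Fin g'.arcs.length => g'.arcs[j].pt.thick) fun i : Fin r.length => r[i].thick)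
      [⟨l, g, m ++ g'.src ++ r⟩, ⟨l ++ g.tgt ++ m, g', r⟩]
      [⟨l ++ g.src ++ m, g', r⟩, ⟨l, g, m ++ g'.tgt ++ r⟩]
      (Sum.elim (Sum.elim (Sum.elim (Sum.elim (fun _ => [])
        fun j => g.arcs[j].orient ((g.toks 0)[j.1]?.getD [])) fun _ => [])
        fun j => g'.arcs[j].orient ((g'.toks 1)[j.1]?.getD [])) fun _ => [])
      (Sum.elim (Sum.elim (Sum.elim (Sum.elim (fun _ => [])
        fun j => g.arcs[j].orient ((g.toks 1)[j.1]?.getD [])) fun _ => [])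
        fun j => g'.arcs[j].orient ((g'.toks 0)[j.1]?.getD [])) fun _ => []) := by
  apply sameSum_swap
  · rfl
  · rfl
  rintro ((((i | j) | i) | j) | i)
  · rfl
  · simp only [Sum.elim_inl, Sum.elim_inr]
    rw [Arc.orient_map, (g.toks_swap j).1]
  · rfl
  · simp only [Sum.elim_inl, Sum.elim_inr]
    rw [Arc.orient_map, (g'.toks_swap j).2]
  · rfl

variable (hγ : Function.Bijective (HopfAlgebra.antipode k : A →ₗ[k] A))
include hγ

lemma J_eq_of_exchange (Z Z' : CD μ ν) (l m r : List Pt) (g g' : Gen) (pre post : List Slice)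
    (htop : Z.top = Z'.top)
    (hD : Z.slices = pre ++ [⟨l, g, m ++ g'.src ++ r⟩, ⟨l ++ g.tgt ++ m, g', r⟩] ++ post)
    (hD' : Z'.slices = pre ++ [⟨l ++ g.src ++ m, g', r⟩, ⟨l, g, m ++ g'.tgt ++ r⟩] ++ post)
    (hcomp : ∀ (x : Z.Node) (x' : Z'.Node), SameLevel pre.length 2 2 x.1.1 x'.1.1 →
      x.1.2 = x'.1.2 → Z.comp x = Z'.comp x') : Z.J e = Z'.J e := by
  have H := Col.sameEnds_exchange l m r g g'
  obtain ⟨_, _, _, _, S, S'⟩ := H.strands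
  exact J_eq_of_columns e hγ Z Z' htop hD hD' (List.cons_ne_nil _ _)
    (Col.leftAbove_rows l m r g g') (Col.leftBelow_rows l m r g g') H.wf H.top H.bot S S' hcomp
    (sameSum_exchange e _ l m r g g')

/-- The excluded moves are exactly those with `x = true`, so `γ² = 1` is available precisely where
an identity may leave a factor `γ²`. -/
theorem J_eq_of_step {x keep : Bool} {Z Z' : CD μ ν} {p q q' : ℕ} (h : Z.Step x keep Z' p q q')
    (h2 : x = true → ∀ a : A, HopfAlgebra.antipode k (HopfAlgebra.antipode k a) = a) :
    Z.J e = Z'.J e := by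
  obtain ⟨h, hcomp⟩ := h
  cases h with
  | move hM l r pre post _ _ htop hD hD' =>
    obtain ⟨w, arcs, paths, paths', toks, toks', H⟩ :=
      sameArcs_of_move e (⨂[k] i, Factor k A (μ i) (ν i)) hγ hM h2
    exact J_eq_of_arcs e hγ Z Z' l r htop hD hD' hcomp w arcs paths paths' toks toks' H.ne_nil
      H.composable H.composable' H.bot H.hasArcs H.hasArcs' H.sameSum
  | exchange l m r g g' pre post _ _ htop hD hD' =>
    exact J_eq_of_exchange e hγ Z Z' l m r g g' pre post htop hD hD' hcomp

end Exchange

end ColTri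

/-- The value of `J'` depends on the type of a triangulation alone and equality is an equivalence
relation, so it suffices to treat a single step, and this is `J_eq_of_step`. -/
theorem proposition6p1 {k A : Type*} [Field k] [Ring A] [HopfAlgebra k A]
    (hγ : Function.Bijective (HopfAlgebra.antipode k : A →ₗ[k] A))
    {ι : Type*} [Fintype ι] (b : Module.Basis ι k A) {n : ℕ} (μ ν : Fin n → Bool) :
    (∀ X X' : ColTri.CT μ ν, X.Equiv' X' → X.diagram.J b = X'.diagram.J b) ∧
    ((∀ a : A, HopfAlgebra.antipode k (HopfAlgebra.antipode k a) = a) →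
      ∀ X X' : ColTri.CT μ ν, X.Equiv X' → X.diagram.J b = X'.diagram.J b) := by
  constructor
  · intro X X' h
    induction h with
    | rel X X' h =>
      obtain ⟨keep, p, q, q', h, -⟩ := h
      exact ColTri.J_eq_of_step b hγ h (by simp)
    | refl => rfl
    | symm _ _ _ ih => exact ih.symm
    | trans _ _ _ _ _ ih ih' => exact ih.trans ih'
  · intro h2 X X' h
    induction h with
    | rel X X' h =>
      obtain ⟨x, keep, p, q, q', h, -⟩ := h
      exact ColTri.J_eq_of_step b hγ h fun _ => h2
    | refl => rfl
    | symm _ _ _ ih => exact ih.symm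
    | trans _ _ _ _ _ ih ih' => exact ih.trans ih'
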